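/- **Network.** Time is slotted. A finite set of nodes is partitioned into clusters; each cluster $\mathcal C$ is strongly connected by wireless links, and its rate region $\Gamma_{\mathcal C}$ is the convex hull of a compact set of non-negative rate vectors supported on its links, every link being usable at a positive rate. Each cluster has at least one gateway; the other nodes are internal. Finitely many mobiles connect the clusters; each gateway has access to exactly one mobile. Time is divided into super time slots of $T$ slots; in each super time slot mobile $m$ is in contact with one of its gateways, and this position is an irreducible aperiodic Markov chain with stationary distribution $\pi_m$ (any initial position; no assumption on the joint law of different mobiles). At each contact up to $R=rT$ packets are exchanged in each direction, $r>0$ fixed. Each internal node $s$ generates $x_s^d\ge 0$ packets per slot for each internal node $d\ne s$; if $s,d$ are in one cluster the flow stays in that cluster. The vector $\mathbf x$ is *supportable* if there are link flows $\mu^{[s,d]}\ge 0$ (confined to the cluster for intra-cluster flows), with $x_s^d1_{\{s=n\}}+\sum_a\mu^{[s,d]}_{(a,n)}=\sum_b\mu^{[s,d]}_{(n,b)}$ for all $n\neq d$, whose sums over $[s,d]$ are dominated in every cluster by an element of $\Gamma_{\mathcal C}$ and, on each mobile–gateway link $(m,g)$ and $(g,m)$, by $r\,\pi_m(g)$. **BP+SR.**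 Queues are empty at time $0$ and all transfers are limited by what the queue holds, and are work-conserving; ties, and which packets of a queue go first, are arbitrary. Type-I queues $q_n^b$ are kept for nodes $b$ of the cluster of $n$. Type-II queues $u_n^l$ are kept at internal nodes for the gateways of the cluster, at gateways for all other gateways and for the internal nodes of the cluster, at mobiles for all gateways; at a gateway a type-II queue consists of a real part $\tilde u_g^l$ and a regulated part $u_g^l$. Let $\tau=\lfloor t/T\rfloor$, let $u[\tau]$ be the type-II lengths at the beginning of super slot $\tau$, and $K_n=T/|\mathcal C(n)|$. (I) For each inter-cluster flow $[s,d]$ the source and destination gateways $(g_s,g_d)$ minimize $u_s^{g_s}[\tau]+u_{g_s}^{g_d}[\tau]+u_{g_d}^d[\tau]$. (II) New inter-cluster packets enter $u_s^{g_s}$, new intra-cluster packets enter $q_s^d$. In each slot, $\eta$ packets go from $u_s^{g}$ to $q_s^{g}$ if $u_s^{g}[\tau]/K_s>q_s^{g}[t]$. On arrival at gateway $g$ they enter $\tilde u_g^{g_d}$. (III) For gateways $g_1\ne g_2$ of one cluster, with $l$ maximizing $u_{g_1}^l[\tau]-u_{g_2}^l[\tau]$ over all gateways $l$, $\eta$ packets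 per slot go from $u_{g_1}^l$ to $q_{g_1}^{g_2}$ if $(u_{g_1}^l[\tau]-u_{g_2}^l[\tau])/K_{g_1}>q_{g_1}^{g_2}[t]$; on arrival at $g_2$ they enter $u_{g_2}^{l}$ if $l\neq g_2$. (IV) Packets that reach their destination gateway $g$ enter $\tilde u_{g}^d$; $\eta$ packets per slot go from $u_g^d$ to $q_g^d$ if $u_g^d[\tau]/K_g>q_g^d[t]$. (V) In each slot each cluster uses $\mu\in\Gamma_{\mathcal C}$ maximizing $\sum\mu_{(a,b)}\max_j(q_a^j[t]-q_b^j[t])$ and serves on each link a commodity $j$ attaining the maximum. (VI) At the beginning of super slot $\tau$ a mobile $m$ in contact with $g$ sends $R$ packets of a commodity maximizing $u_m^j[\tau]-u_g^j[\tau]$ over gateways $j$, and $g$ sends $R$ packets of a commodity maximizing $u_g^j[\tau]-u_m^j[\tau]$ if this maximum is non-negative. (VII) In each slot, $(1+\delta)$ times the traffic currently assigned by (I) to the queue $(g,l)$ is moved from $\tilde u_g^l$ to $u_g^l$. Here $\eta>0$ exceeds the total rate out of any node under any element of $\Gamma_{\mathcal C}$. **Theorem.** Fix $\delta>0$, and let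 $\mathbf x$ be such that $(1+\delta+\epsilon)\mathbf x$ is supportable for some $\epsilon>0$. Let $\gamma\ge 0$ with $(1+\gamma)(1+\delta)<1+\delta+\epsilon$. Then there is $T_0$ such that for every $T\ge T_0$ all queues are bounded under BP+SR, in the following sense. 1. For every $\tilde T\ge 1$ there is a constant $B$ such that, whenever each mobile $m$ makes at least $(1+\gamma)^{-1}\pi_m(g)\tilde T$ contacts with each of its gateways $g$ in every super-super time slot (block of $\tilde T$ super time slots), all queues (type I, regulated type II, real type II) are at most $B$ at all times. 2. Under the Markov mobility there is a constant $B$ such that every type-I queue and every (regulated) type-II queue has expected length at most $B$ at all times. 3. Under the Markov mobility there are constants $C,c>0$ such that for all $n$ and all $b\ge0$, the probability that some queue (type I, regulated or real type II) exceeds $b$ at some time $t\le n$ is at most $C(n+1)e^{-cb}$. -/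

import Mathlib

/-!
Intermittently connected networks of clusters joined by Markov mobile carriers, and the
two-scale back-pressure algorithm with source routing (BP+SR), slot by slot.
-/

universe uι uV uJ uΩ

namespace ICN

open scoped Classical in
/-- An intermittently connected network. `V` is the set of all cluster nodes, `ι` the set of
clusters, `J` the set of mobile carriers. Gateways are the nodes that have access to a mobile,
every gateway to exactly one; the other nodes are internal. Mobile `j` moves, once per super time
slot, among its gateways, as a Markov chain with transition matrix `trans j`. -/
structure Network (ι : Type uι) (V : Type uV) (J : Type uJ) [Fintype V] where
  /-- the cluster of a node -/
  cl : V → ι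
  /-- `none`: internal node; `some j`: gateway that can contact mobile `j` -/
  access : V → Option J
  /-- wireless links; they never leave a cluster -/
  Link : V → V → Prop
  link_ne : ∀ a b, Link a b → a ≠ b
  link_cl : ∀ a b, Link a b → cl a = cl b
  /-- feasible vectors of simultaneous transmission rates (packets per time slot) in a cluster -/
  feasible : ι → Set (V → V → ℝ)
  feasible_compact : ∀ i, IsCompact (feasible i)
  feasible_nonneg : ∀ i, ∀ μ ∈ feasible i, ∀ a b, 0 ≤ μ a b
  feasible_support : ∀ i, ∀ μ ∈ feasible i, ∀ a b, μ a b ≠ 0 → Link a b ∧ cl a = i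
  /-- every link can be activated at a positive rate -/
  link_usable : ∀ a b, Link a b → ∃ μ ∈ feasible (cl a), 0 < μ a b
  /-- every cluster is connected by its (multi-hop) wireless links -/
  cluster_connected : ∀ a b, cl a = cl b → Relation.ReflTransGen Link a b
  cluster_gateway : ∀ i, ∃ g j, cl g = i ∧ access g = some j
  mobile_gateway : ∀ j, ∃ g, access g = some j
  /-- transition matrix of a mobile on the gateways it can contact -/
  trans : (j : J) → Matrix {g : V // access g = some j} {g : V // access g = some j} ℝ
  trans_row_sum : ∀ j g, ∑ g', trans j g g' = 1
  trans_irreducible : ∀ j, (trans j).IsIrreducible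
  trans_aperiodic : ∀ j g, ∀ k : ℕ, (∀ n : ℕ, 0 < n → 0 < (trans j ^ n) g g → k ∣ n) → k = 1
  /-- stationary distribution of a mobile -/
  stat : (j : J) → {g : V // access g = some j} → ℝ
  stat_nonneg : ∀ j g, 0 ≤ stat j g
  stat_sum : ∀ j, ∑ g, stat j g = 1
  stat_invariant : ∀ j g', ∑ g, stat j g * trans j g g' = stat j g'

/-- The four roles of a packet in a type-I queue: intra-cluster traffic, source to source gateway,
gateway to gateway of the same cluster, destination gateway to destination. -/
inductive Leg where
  | intra
  | uplink
  | relay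
  | downlink
  deriving DecidableEq

instance : Fintype Leg :=
  ⟨{.intra, .uplink, .relay, .downlink}, by intro x; cases x <;> simp⟩

/-- Packet header: source, destination, destination gateway chosen by the source. (For an
intra-cluster packet the third entry is the destination.) -/
abbrev Header (V : Type uV) : Type uV := V × V × V

/-- Work-conserving service of one queue: `content` is what the queue holds of each kind of packet,
`demand k` is how many packets channel `k` would take, and `out k a` is how many packets of kind
`a` go out over channel `k`. As many packets are sent as content and demand allow; which ones is
left open. -/
def Serves {α κ : Type*} [Fintype α] [Fintype κ]
    (content : α → ℝ) (demand : κ → ℝ) (out : κ → α → ℝ) : Prop :=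
  (∀ k a, 0 ≤ out k a) ∧ (∀ k, ∑ a, out k a ≤ demand k) ∧ (∀ a, ∑ k, out k a ≤ content a) ∧
    ∑ k, ∑ a, out k a = min (∑ a, content a) (∑ k, demand k)

/-- Everything that happens in a run: queue contents by packet kind at the beginning of every time
slot, and all decisions. `t` stands for a time slot, `τ` for a super time slot. -/
structure Execution (ι : Type uι) (V : Type uV) (J : Type uJ) where
  /-- type-I queue at node `n` for node `b`, at slot `t` -/
  q : (t : ℕ) → (n b : V) → Leg × Header V → ℝ
  /-- (regulated) type-II queue at a node or mobile `n` for node `l`, at slot `t` -/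
  u : (t : ℕ) → (n : V ⊕ J) → (l : V) → Header V → ℝ
  /-- real type-II queue at gateway `g` for node `l`, at slot `t` -/
  w : (t : ℕ) → (g l : V) → Header V → ℝ
  /-- source gateway and destination gateway of flow `[s,d]` in super slot `τ` -/
  srcGate : (τ : ℕ) → (s d : V) → V
  dstGate : (τ : ℕ) → (s d : V) → V
  /-- commodity `l_{g₁,g₂}[τ]` that gateway `g₁` offers to gateway `g₂` -/
  relayIdx : (τ : ℕ) → (g₁ g₂ : V) → V
  /-- commodities `j_{(m,g)}[τ]` and `j_{(g,m)}[τ]`, with `g` the gateway in contact with `m` -/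
  dropIdx : (τ : ℕ) → (m : J) → V
  pickIdx : (τ : ℕ) → (m : J) → V
  /-- rate vector of a cluster in slot `t` and commodity `j_{(a,b)}[t]` of a link -/
  sched : (t : ℕ) → (i : ι) → V → V → ℝ
  linkIdx : (t : ℕ) → (a b : V) → V
  /-- packets sent in slot `t` out of type-I queue `(n,b)` to the neighbour `n'` -/
  sendI : (t : ℕ) → (n b n' : V) → Leg × Header V → ℝ
  /-- packets taken in slot `t` out of type-II queue `(n,l)`: for `some b`, into the type-I queue
  `(n,b)` of the same node; for `none`, over the mobile-gateway contact -/
  sendII : (t : ℕ) → (n : V ⊕ J) → (l : V) → Option V → Header V → ℝ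
  /-- packets moved in slot `t` from the real to the regulated queue `(g,l)` -/
  release : (t : ℕ) → (g l : V) → Header V → ℝ

namespace Execution

variable {ι : Type uι} {V : Type uV} {J : Type uJ} [Fintype V]

/-- Lengths of type-I, regulated type-II and real type-II queues. -/
def qLen (e : Execution ι V J) (t : ℕ) (n b : V) : ℝ := ∑ a, e.q t n b a
def uLen (e : Execution ι V J) (t : ℕ) (n : V ⊕ J) (l : V) : ℝ := ∑ h, e.u t n l h
def wLen (e : Execution ι V J) (t : ℕ) (g l : V) : ℝ := ∑ h, e.w t g l h

/-- All queues of the network (both types, regulated and real) have length at most `B` in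
slot `t`. -/
def AllQueuesLE (e : Execution ι V J) (t : ℕ) (B : ℝ) : Prop :=
  (∀ n b, e.qLen t n b ≤ B) ∧ (∀ n l, e.uLen t n l ≤ B) ∧ (∀ g l, e.wLen t g l ≤ B)

end Execution

namespace Network

variable {ι : Type uι} {V : Type uV} {J : Type uJ} [Fintype V]

def IsGateway (N : Network ι V J) (n : V) : Prop := ∃ j, N.access n = some j

/-- The gateways that mobile `j` can contact. -/
abbrev Port (N : Network ι V J) (j : J) : Type uV := {g : V // N.access g = some j}

/-- The convex hull of the feasible rate vectors of a cluster. -/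
def Gam (N : Network ι V J) (i : ι) : Set (V → V → ℝ) := convexHull ℝ (N.feasible i)

open scoped Classical in
/-- Number of nodes of the cluster of `n`. -/
noncomputable def clusterSize (N : Network ι V J) (n : V) : ℕ :=
  (Finset.univ.filter fun a => N.cl a = N.cl n).card

/-- `x s d` is the number of packets per time slot that `s` generates for `d`; sources and
destinations are internal nodes. -/
def IsTraffic (N : Network ι V J) (x : V → V → ℝ) : Prop :=
  (∀ s d, 0 ≤ x s d) ∧
    ∀ s d, x s d ≠ 0 → s ≠ d ∧ ¬ N.IsGateway s ∧ ¬ N.IsGateway d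

/-- `η` is greater than the largest transmission rate out of any node inside a cluster. -/
def ExceedsNodeRates (N : Network ι V J) (η : ℝ) : Prop :=
  0 < η ∧ ∀ i, ∀ μ ∈ N.Gam i, ∀ a, ∑ b, μ a b < η

/-- Links of the whole network: wireless links, and both directions between a gateway and its
mobile. -/
def NetLink (N : Network ι V J) : V ⊕ J → V ⊕ J → Prop
  | .inl a, .inl b => N.Link a b
  | .inl g, .inr m => N.access g = some m
  | .inr m, .inl g => N.access g = some m
  | .inr _, .inr _ => False

open scoped Classical in
/-- The traffic `x` is supportable when a mobile and a gateway in contact can exchange `r` packets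
per time slot, in each direction: there are flow rates `φ s d` on the links, conserved outside the
destination, intra-cluster flows staying in their cluster, that fit into the rate region of every
cluster and into the average capacities `r * stat` of the mobile-gateway links. -/
def Supportable [Fintype J] (N : Network ι V J) (r : ℝ) (x : V → V → ℝ) : Prop :=
  ∃ φ : V → V → V ⊕ J → V ⊕ J → ℝ,
    (∀ s d a b, 0 ≤ φ s d a b) ∧
    (∀ s d a b, φ s d a b ≠ 0 → N.NetLink a b) ∧
    (∀ s d a b, φ s d a b ≠ 0 → N.cl s = N.cl d →
      ∃ a' b', a = .inl a' ∧ b = .inl b' ∧ N.cl a' = N.cl s ∧ N.cl b' = N.cl s) ∧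
    (∀ s d n, n ≠ .inl d →
      (if n = .inl s then x s d else 0) + ∑ a, φ s d a n = ∑ b, φ s d n b) ∧
    (∀ i, ∃ μ ∈ N.Gam i, ∀ a b, N.cl a = i → ∑ s, ∑ d, φ s d (.inl a) (.inl b) ≤ μ a b) ∧
    (∀ j, ∀ g : N.Port j,
      ∑ s, ∑ d, φ s d (.inl g.1) (.inr j) ≤ N.stat j g * r ∧
      ∑ s, ∑ d, φ s d (.inr j) (.inl g.1) ≤ N.stat j g * r)

/-- Trajectory of the mobiles: `pos τ j` is the gateway that mobile `j` is in contact with in super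
time slot `τ`. -/
abbrev Path (N : Network ι V J) : Type (max uJ uV) := ℕ → (j : J) → N.Port j

/-! ### The algorithm -/

/-- Total type-II queue length on the route of `[s,d]` through the gateways `a` and `b`. -/
def routeCost (e : Execution ι V J) (t : ℕ) (s d a b : V) : ℝ :=
  e.uLen t (.inl s) a + e.uLen t (.inl a) b + e.uLen t (.inl b) d

/-- Selection of source and destination gateways at the beginning of a super slot. -/
def SourceRouting (N : Network ι V J) (T : ℕ) (e : Execution ι V J) : Prop :=
  ∀ τ s d, N.cl s ≠ N.cl d →
    (N.IsGateway (e.srcGate τ s d) ∧ N.cl (e.srcGate τ s d) = N.cl s) ∧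
    (N.IsGateway (e.dstGate τ s d) ∧ N.cl (e.dstGate τ s d) = N.cl d) ∧
    ∀ a b, N.IsGateway a → N.cl a = N.cl s → N.IsGateway b → N.cl b = N.cl d →
      routeCost e (τ * T) s d (e.srcGate τ s d) (e.dstGate τ s d) ≤ routeCost e (τ * T) s d a b

/-- Differential backlog of type-II queues for commodity `l` in slot `t`. -/
def diffII (e : Execution ι V J) (t : ℕ) (n n' : V ⊕ J) (l : V) : ℝ :=
  e.uLen t n l - e.uLen t n' l

/-- Commodities for the gateway-gateway and mobile-gateway exchanges of a super slot: gateways of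
largest differential backlog. -/
def InterClusterChoices (N : Network ι V J) (T : ℕ) (pos : N.Path) (e : Execution ι V J) : Prop :=
  (∀ τ g₁ g₂, N.IsGateway g₁ → N.IsGateway g₂ → N.cl g₁ = N.cl g₂ → g₁ ≠ g₂ →
    N.IsGateway (e.relayIdx τ g₁ g₂) ∧ ∀ l, N.IsGateway l →
      diffII e (τ * T) (.inl g₁) (.inl g₂) l
        ≤ diffII e (τ * T) (.inl g₁) (.inl g₂) (e.relayIdx τ g₁ g₂)) ∧
  (∀ τ m, N.IsGateway (e.dropIdx τ m) ∧ ∀ l, N.IsGateway l →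
      diffII e (τ * T) (.inr m) (.inl (pos τ m).1) l
        ≤ diffII e (τ * T) (.inr m) (.inl (pos τ m).1) (e.dropIdx τ m)) ∧
  (∀ τ m, N.IsGateway (e.pickIdx τ m) ∧ ∀ l, N.IsGateway l →
      diffII e (τ * T) (.inl (pos τ m).1) (.inr m) l
        ≤ diffII e (τ * T) (.inl (pos τ m).1) (.inr m) (e.pickIdx τ m))

/-- Differential backlog of type-I queues over a link for commodity `b`. -/
def diffI (e : Execution ι V J) (t : ℕ) (a a' b : V) : ℝ := e.qLen t a b - e.qLen t a' b

/-- Back-pressure inside the clusters: in every slot each cluster uses a rate vector that maximizes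
the sum of rate times largest differential backlog. -/
def IntraClusterChoices (N : Network ι V J) (e : Execution ι V J) : Prop :=
  (∀ t a a', N.Link a a' → N.cl (e.linkIdx t a a') = N.cl a ∧
    ∀ b, N.cl b = N.cl a → diffI e t a a' b ≤ diffI e t a a' (e.linkIdx t a a')) ∧
  (∀ t i, e.sched t i ∈ N.Gam i ∧ ∀ μ ∈ N.Gam i,
    ∑ a, ∑ a', μ a a' * diffI e t a a' (e.linkIdx t a a')
      ≤ ∑ a, ∑ a', e.sched t i a a' * diffI e t a a' (e.linkIdx t a a'))

open scoped Classical in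
/-- Packets that type-I queue `(n,b)` is to send to `n'` in slot `t`. -/
noncomputable def demandI (N : Network ι V J) (e : Execution ι V J) (t : ℕ) (n b n' : V) : ℝ :=
  if N.Link n n' ∧ e.linkIdx t n n' = b then e.sched t (N.cl n) n n' else 0

/-- The type-II backlog (or differential backlog) `D` at node `n`, divided by
`K_n = T / (cluster size)`. -/
noncomputable def theta (N : Network ι V J) (T : ℕ) (n : V) (D : ℝ) : ℝ :=
  D / ((T : ℝ) / N.clusterSize n)

open scoped Classical in
/-- Packets that type-II queue `(n,l)` is to give to channel `c` in slot `t`. -/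
noncomputable def demandII (N : Network ι V J) (T : ℕ) (R η : ℝ) (pos : N.Path)
    (e : Execution ι V J) (t : ℕ) (n : V ⊕ J) (l : V) (c : Option V) : ℝ :=
  match n, c with
  | .inl n, some b =>
    if N.cl b ≠ N.cl n then 0
    else if N.IsGateway n ∧ N.IsGateway l then
      -- gateway to gateway of the same cluster
      if N.IsGateway b ∧ b ≠ n ∧ e.relayIdx (t / T) n b = l ∧
          e.qLen t n b < N.theta T n (diffII e (t / T * T) (.inl n) (.inl b) l) then η else 0
    else
      -- internal node to gateway, or gateway to internal node
      if b = l ∧ (N.IsGateway n ↔ ¬ N.IsGateway l) ∧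
          e.qLen t n b < N.theta T n (e.uLen (t / T * T) (.inl n) l) then η else 0
  | .inl g, none =>
    if T ∣ t ∧ ∃ m, (pos (t / T) m).1 = g ∧ e.pickIdx (t / T) m = l ∧
        0 ≤ diffII e t (.inl g) (.inr m) l then R else 0
  | .inr _, some _ => 0
  | .inr m, none => if T ∣ t ∧ e.dropIdx (t / T) m = l then R else 0

open scoped Classical in
/-- `y_g^l[t]`: packets to be moved from the real to the regulated queue in slot `t`, that is
`1 + δ` times the traffic currently assigned to the queue `(g,l)`. -/
noncomputable def regulated (N : Network ι V J) (x : V → V → ℝ) (T : ℕ) (δ : ℝ)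
    (e : Execution ι V J) (t : ℕ) (g l : V) : ℝ :=
  (1 + δ) *
    if N.IsGateway l then
      ∑ s, ∑ d, if N.cl s ≠ N.cl d ∧ e.srcGate (t / T) s d = g ∧ e.dstGate (t / T) s d = l
        then x s d else 0
    else
      ∑ s, if N.cl s ≠ N.cl l ∧ e.dstGate (t / T) s l = g then x s l else 0

/-- All transfers are work-conserving. -/
def Transfers (N : Network ι V J) (x : V → V → ℝ) (T : ℕ) (R η δ : ℝ) (pos : N.Path)
    (e : Execution ι V J) : Prop :=
  (∀ t n b, Serves (e.q t n b) (N.demandI e t n b) (e.sendI t n b)) ∧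
  (∀ t n l, Serves (e.u t n l) (N.demandII T R η pos e t n l) (e.sendII t n l)) ∧
  (∀ t g l, Serves (e.w t g l) (fun _ : Unit => N.regulated x T δ e t g l)
    (fun _ => e.release t g l))

open scoped Classical in
/-- Packets entering type-I queue `(n,b)` at node `n` itself in slot `t`. -/
noncomputable def injectI (N : Network ι V J) (x : V → V → ℝ) (e : Execution ι V J)
    (t : ℕ) (n b : V) : Leg × Header V → ℝ
  | (.intra, h) => if N.cl n = N.cl b ∧ h = (n, b, b) then x n b else 0
  | (.uplink, h) => if ¬ N.IsGateway n then e.sendII t (.inl n) b (some b) h else 0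
  | (.relay, h) =>
    if N.IsGateway n ∧ N.IsGateway b then ∑ l, e.sendII t (.inl n) l (some b) h else 0
  | (.downlink, h) =>
    if N.IsGateway n ∧ ¬ N.IsGateway b then e.sendII t (.inl n) b (some b) h else 0

open scoped Classical in
/-- New inter-cluster packets deposited by the source `n` in its type-II queue for gateway `l`. -/
noncomputable def newInter (N : Network ι V J) (x : V → V → ℝ) (T : ℕ)
    (e : Execution ι V J) (t : ℕ) (n l : V) (h : Header V) : ℝ :=
  if h.1 = n ∧ N.cl n ≠ N.cl h.2.1 ∧ e.srcGate (t / T) n h.2.1 = l ∧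
    e.dstGate (t / T) n h.2.1 = h.2.2 then x n h.2.1 else 0

/-- Packets with header `h` that reach gateway `g` in slot `t` from other gateways of its
cluster. -/
noncomputable def fromGateway (e : Execution ι V J) (t : ℕ) (g : V) (h : Header V) : ℝ :=
  ∑ n, e.sendI t n g g (.relay, h)

open scoped Classical in
/-- Packets with header `h`, stored for `l`, that reach gateway `g` in slot `t` from its mobile. -/
noncomputable def fromMobile [Fintype J] (N : Network ι V J) (T : ℕ) (pos : N.Path)
    (e : Execution ι V J) (t : ℕ) (g l : V) (h : Header V) : ℝ :=
  ∑ m, if (pos (t / T) m).1 = g then e.sendII t (.inr m) l none h else 0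

open scoped Classical in
/-- Evolution of the queue contents from slot `t` to slot `t + 1`, all queues being empty at
time `0`. Packets that reach the node for which a type-I queue is kept leave that type-I queue: an
uplink packet goes to the real queue for its destination gateway, a relayed packet (or one dropped
by a mobile) goes to the type-II queue for its destination gateway or, if it has arrived there, to
the real queue for its destination; intra-cluster and downlink packets are delivered. -/
def Dynamics [Fintype J] (N : Network ι V J) (x : V → V → ℝ) (T : ℕ) (pos : N.Path)
    (e : Execution ι V J) : Prop :=
  (∀ n b a, e.q 0 n b a = 0) ∧ (∀ n l h, e.u 0 n l h = 0) ∧ (∀ g l h, e.w 0 g l h = 0) ∧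
  (∀ t n b a, e.q (t + 1) n b a =
    if n = b then 0 else
      e.q t n b a - ∑ n', e.sendI t n b n' a + ∑ n', e.sendI t n' b n a + N.injectI x e t n b a) ∧
  (∀ t n l h, e.u (t + 1) (.inl n) l h =
    e.u t (.inl n) l h - ∑ c, e.sendII t (.inl n) l c h
      + N.newInter x T e t n l h + e.release t n l h
      + if l = n then 0 else
          (if h.2.2 = l then fromGateway e t n h else 0) + N.fromMobile T pos e t n l h) ∧
  (∀ t m l h, e.u (t + 1) (.inr m) l h =
    e.u t (.inr m) l h - ∑ c, e.sendII t (.inr m) l c h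
      + e.sendII t (.inl (pos (t / T) m).1) l none h) ∧
  (∀ t g l h, e.w (t + 1) g l h =
    e.w t g l h - e.release t g l h
      + (if N.IsGateway g ∧ h.2.2 = l then ∑ n, e.sendI t n g g (.uplink, h) else 0)
      + if h.2.2 = g ∧ h.2.1 = l then fromGateway e t g h + N.fromMobile T pos e t g g h else 0)

/-- `e` is a run of BP+SR with super time slots of `T` slots, `R` packets per contact and direction,
transfer batches `η` and regulator parameter `δ`, along the trajectory `pos` of the mobiles. -/
def IsExecution [Fintype J] (N : Network ι V J) (x : V → V → ℝ) (T : ℕ) (R η δ : ℝ)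
    (pos : N.Path) (e : Execution ι V J) : Prop :=
  N.SourceRouting T e ∧ N.InterClusterChoices T pos e ∧ N.IntraClusterChoices e ∧
    N.Transfers x T R η δ pos e ∧ N.Dynamics x T pos e

/-! ### The mobiles -/

/-- Each mobile moves as a Markov chain with its transition matrix, from an arbitrary initial
position. -/
def IsMobility (N : Network ι V J) {Ω : Type uΩ} [MeasurableSpace Ω]
    (P : MeasureTheory.Measure Ω) (X : Ω → N.Path) : Prop :=
  (∀ τ j g, MeasurableSet {ω | X ω τ j = g}) ∧
  ∀ j (n : ℕ) (c : ℕ → N.Port j),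
    P {ω | ∀ k ≤ n + 1, X ω k j = c k} =
      P {ω | ∀ k ≤ n, X ω k j = c k} * ENNReal.ofReal (N.trans j (c n) (c (n + 1)))

open scoped Classical in
/-- Every mobile `j` contacts every one of its gateways `g` at least `(1+γ)⁻¹ π_j(g) T'` times in
every block of `T'` super time slots. -/
def RegularContacts (N : Network ι V J) (γ : ℝ) (T' : ℕ) (pos : N.Path) : Prop :=
  ∀ k j g, (1 + γ)⁻¹ * N.stat j g * T' ≤
    ((Finset.Ico (k * T') ((k + 1) * T')).filter fun τ => pos τ j = g).card

end Network

end ICN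

set_option linter.unusedSectionVars false

namespace ICN

open scoped Classical

variable {ι : Type uι} {V : Type uV} {J : Type uJ} [Fintype V]

/-! ### Rate regions, stationary laws and connectivity -/

namespace Network

variable (N : Network ι V J)

theorem gam_nonneg {i : ι} {μ : V → V → ℝ} (h : μ ∈ N.Gam i) (a b : V) : 0 ≤ μ a b := by
  have hc : Convex ℝ {μ : V → V → ℝ | 0 ≤ μ a b} := by
    intro p hp q hq s t hs ht _
    simp only [Set.mem_ofPred_eq, Pi.add_apply, Pi.smul_apply, smul_eq_mul] at *
    positivity
  exact convexHull_min (fun μ hμ => N.feasible_nonneg i μ hμ a b) hc h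

theorem gam_eq_zero {i : ι} {μ : V → V → ℝ} (h : μ ∈ N.Gam i) {a b : V}
    (hab : ¬ (N.Link a b ∧ N.cl a = i)) : μ a b = 0 := by
  have hc : Convex ℝ {μ : V → V → ℝ | μ a b = 0} := by
    intro p hp q hq s t hs ht _
    simp only [Set.mem_ofPred_eq, Pi.add_apply, Pi.smul_apply, smul_eq_mul] at *
    simp [hp, hq]
  refine convexHull_min (fun μ hμ => ?_) hc h
  by_contra hne
  exact hab (N.feasible_support i μ hμ a b hne)

theorem cl_surjective : Function.Surjective N.cl := fun i => by
  obtain ⟨g, j, h, -⟩ := N.cluster_gateway i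
  exact ⟨g, h⟩

theorem exists_gateway (n : V) : ∃ g, N.IsGateway g ∧ N.cl g = N.cl n := by
  obtain ⟨g, j, h, h'⟩ := N.cluster_gateway (N.cl n)
  exact ⟨g, ⟨j, h'⟩, h⟩

theorem exists_gam_pos (hne : ∀ i, (N.Gam i).Nonempty) {a b : V} (h : N.Link a b) :
    ∃ μ : ι → V → V → ℝ, (∀ i, μ i ∈ N.Gam i) ∧ 0 < μ (N.cl a) a b := by
  obtain ⟨μ₀, hμ₀, hpos⟩ := N.link_usable a b h
  choose ν hν using hne
  refine ⟨Function.update ν (N.cl a) μ₀, fun i => ?_, by simpa using hpos⟩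
  by_cases hi : i = N.cl a
  · subst hi
    simpa [Gam] using subset_convexHull ℝ _ hμ₀
  · simpa [hi] using hν i

theorem cl_eq_of_reach {a b : V} (h : Relation.ReflTransGen N.Link a b) : N.cl a = N.cl b := by
  induction h with
  | refl => rfl
  | tail _ h' ih => exact ih.trans (N.link_cl _ _ h')

theorem port_nonempty (j : J) : Nonempty (N.Port j) := by
  obtain ⟨g, hg⟩ := N.mobile_gateway j
  exact ⟨⟨g, hg⟩⟩

theorem trans_nonneg (j : J) (g g' : N.Port j) : 0 ≤ N.trans j g g' :=
  (N.trans_irreducible j).nonneg g g'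

/-- Some state has positive mass; irreducibility gives a power of the matrix that carries mass from
it to `g`, and the law is invariant under all powers. -/
theorem stat_pos (j : J) (g : N.Port j) : 0 < N.stat j g := by
  have hpow : ∀ k : ℕ, ∀ g', ∑ g, N.stat j g * (N.trans j ^ k) g g' = N.stat j g' := by
    intro k
    induction k with
    | zero => intro g'; simp [Matrix.one_apply]
    | succ k ih =>
      intro g'
      simp only [pow_succ, Matrix.mul_apply, Finset.mul_sum]
      rw [Finset.sum_comm]
      simp only [← mul_assoc, ← Finset.sum_mul, ih]
      exact N.stat_invariant j g'
  obtain ⟨g₀, hg₀⟩ : ∃ g₀, 0 < N.stat j g₀ := by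
    by_contra! hcon
    have h1 := N.stat_sum j
    have h2 : ∑ g, N.stat j g ≤ 0 := Finset.sum_nonpos fun g _ => hcon g
    linarith
  have hirr := (Matrix.isIrreducible_iff_exists_pow_pos (N.trans_nonneg j)).1
    (N.trans_irreducible j) g₀ g
  obtain ⟨k, -, hk⟩ := hirr
  have hnn : ∀ g', 0 ≤ (N.trans j ^ k) g' g := fun g' =>
    Matrix.pow_apply_nonneg (N.trans_nonneg j) k g' g
  rw [← hpow k g]
  exact lt_of_lt_of_le (mul_pos hg₀ hk) (Finset.single_le_sum
    (f := fun g' => N.stat j g' * (N.trans j ^ k) g' g)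
    (fun g' _ => mul_nonneg (N.stat_nonneg j g') (hnn g')) (Finset.mem_univ g₀))

/-- Steps that keep a packet within the reach of the same gateways: inside a cluster, or between a
gateway and its mobile. -/
def CLink : V ⊕ J → V ⊕ J → Prop
  | .inl a, .inl b => N.cl a = N.cl b
  | .inl g, .inr m => N.access g = some m
  | .inr m, .inl g => N.access g = some m
  | .inr _, .inr _ => False

/-- The gateway or node `b` can be reached from `n`. -/
def Conn (n : V ⊕ J) (b : V) : Prop := Relation.ReflTransGen N.CLink n (.inl b)

variable {N}

theorem NetLink.cLink {a b : V ⊕ J} (h : N.NetLink a b) : N.CLink a b := by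
  rcases a with a | a <;> rcases b with b | b
  · exact N.link_cl a b h
  · exact h
  · exact h
  · exact h

theorem CLink.symm {a b : V ⊕ J} (h : N.CLink a b) : N.CLink b a := by
  rcases a with a | a <;> rcases b with b | b
  · exact Eq.symm h
  · exact h
  · exact h
  · exact h

theorem Conn.step {a b : V ⊕ J} {l : V} (h : N.Conn a l) (hab : N.CLink a b) : N.Conn b l :=
  Relation.ReflTransGen.head hab.symm h

theorem Conn.target {a : V ⊕ J} {l l' : V} (h : N.Conn a l) (hll : N.cl l = N.cl l') :
    N.Conn a l' :=
  Relation.ReflTransGen.tail h hll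

/-- Flow conservation in potential form. -/
theorem sum_flow_potential [Fintype J] (φ : V ⊕ J → V ⊕ J → ℝ) (s d : V) (y : ℝ)
    (hcons : ∀ n, n ≠ Sum.inl d →
      (if n = Sum.inl s then y else 0) + ∑ a, φ a n = ∑ b, φ n b)
    (Ψ : V ⊕ J → ℝ) (hd : Ψ (.inl d) = 0) :
    ∑ a, ∑ b, φ a b * (Ψ a - Ψ b) = y * Ψ (.inl s) := by
  have h1 : ∑ a, ∑ b, φ a b * (Ψ a - Ψ b) = ∑ n, Ψ n * (∑ b, φ n b - ∑ a, φ a n) := by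
    simp only [mul_sub, Finset.sum_sub_distrib, Finset.mul_sum]
    congr 1
    · exact Finset.sum_congr rfl fun a _ => Finset.sum_congr rfl fun b _ => mul_comm _ _
    · rw [Finset.sum_comm]
      exact Finset.sum_congr rfl fun a _ => Finset.sum_congr rfl fun b _ => mul_comm _ _
  rw [h1]
  have h2 : ∀ n, Ψ n * (∑ b, φ n b - ∑ a, φ a n) = if n = Sum.inl s then y * Ψ (.inl s) else 0 := by
    intro n
    by_cases hn : n = Sum.inl d
    · subst hn
      simp only [hd, zero_mul]
      split_ifs with h
      · rw [← h, hd, mul_zero]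
      · rfl
    · have := hcons n hn
      split_ifs at this ⊢ with h
      · rw [← this, h]; ring
      · rw [← this]; ring
  rw [Finset.sum_congr rfl fun n _ => h2 n]
  simp

/-- Test flow conservation with the indicator of the nodes that are not connected to `d`: no link
crosses its boundary, so a source outside would have to send nothing. -/
theorem Supportable.conn [Fintype J] {r : ℝ} {y : V → V → ℝ} (h : N.Supportable r y) {s d : V}
    (hy : y s d ≠ 0) : N.Conn (.inl s) d := by
  obtain ⟨φ, -, hlink, -, hcons, -⟩ := h
  by_contra hcon
  have := sum_flow_potential (φ s d) s d (y s d) (hcons s d)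
    (fun n => if N.Conn n d then 0 else 1) (if_pos Relation.ReflTransGen.refl)
  rw [Finset.sum_eq_zero] at this
  · simp [hcon] at this
    exact hy this.symm
  · intro a _
    refine Finset.sum_eq_zero fun b _ => ?_
    by_cases hab : φ s d a b = 0
    · simp [hab]
    · have hc := (hlink s d a b hab).cLink
      have : N.Conn a d ↔ N.Conn b d := ⟨fun h => h.step hc, fun h => h.step hc.symm⟩
      simp [this]

theorem Supportable.gam_nonempty [Fintype J] {r : ℝ} {y : V → V → ℝ} (h : N.Supportable r y)
    (i : ι) : (N.Gam i).Nonempty := by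
  obtain ⟨φ, -, -, -, -, hg, -⟩ := h
  obtain ⟨μ, hμ, -⟩ := hg i
  exact ⟨μ, hμ⟩

end Network

/-! ### Duality: the weighted service dominates every supportable traffic -/

/-- Backlogs of an intermittently connected network together with upper bounds for the weights
that the back-pressure rules maximize: `D` on wireless links, `I` for the transfers from type-II to
type-I queues, `up` and `dn` on the links from and to the mobile of a gateway; `S` bounds the
weighted service of the clusters. -/
structure Backlog (N : Network ι V J) where
  U : V ⊕ J → V → ℝ
  Q : V → V → ℝ
  D : V → V → ℝ
  I : V → V → ℝ
  up : V → ℝ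
  dn : V → ℝ
  S : ℝ
  U_nonneg : ∀ n l, 0 ≤ U n l
  U_self : ∀ n, U (.inl n) n = 0
  Q_nonneg : ∀ n b, 0 ≤ Q n b
  Q_self : ∀ n, Q n n = 0
  D_nonneg : ∀ a b, 0 ≤ D a b
  I_nonneg : ∀ n b, 0 ≤ I n b
  up_nonneg : ∀ g, 0 ≤ up g
  dn_nonneg : ∀ g, 0 ≤ dn g
  D_ge : ∀ a b j, N.Link a b → N.cl j = N.cl a → Q a j - Q b j ≤ D a b
  I_ge : ∀ n b, N.cl n = N.cl b → (N.IsGateway n ↔ ¬ N.IsGateway b) →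
    U (.inl n) b - Q n b ≤ I n b
  I_ge_relay : ∀ n b l, n ≠ b → N.cl n = N.cl b → N.IsGateway n → N.IsGateway b → N.IsGateway l →
    U (.inl n) l - U (.inl b) l - Q n b ≤ I n b
  up_ge : ∀ g m l, N.access g = some m → N.IsGateway l → U (.inl g) l - U (.inr m) l ≤ up g
  dn_ge : ∀ g m l, N.access g = some m → N.IsGateway l → U (.inr m) l - U (.inl g) l ≤ dn g
  S_ge : ∀ μ : ι → V → V → ℝ, (∀ i, μ i ∈ N.Gam i) →
    ∑ a, ∑ b, μ (N.cl a) a b * D a b ≤ S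

namespace Backlog

variable {N : Network ι V J} (B : Backlog N)

/-- Weighted service that mobiles offer on average. -/
noncomputable def mobileService [Fintype J] (r : ℝ) : ℝ :=
  r * ∑ j, ∑ g : N.Port j, N.stat j g * (B.up g.1 + B.dn g.1)

/-- Total weighted service. -/
noncomputable def total [Fintype J] (r η : ℝ) : ℝ :=
  B.S + η * ∑ n, ∑ b, B.I n b + B.mobileService r

/-- Value of flow `[s,d]` at a gateway or mobile. -/
noncomputable def ψII (d : V) (n : V ⊕ J) : ℝ :=
  ⨅ b : {b : V // N.IsGateway b ∧ N.cl b = N.cl d}, (B.U n b.1 + B.U (.inl b.1) d)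

/-- Value of flow `[s,d]` at a node inside a cluster, in transit through type-I queues. -/
noncomputable def ψI (d n : V) : ℝ :=
  if N.cl n = N.cl d then
    min (B.Q n d) (⨅ a : {a : V // N.IsGateway a ∧ N.cl a = N.cl n}, (B.Q n a.1 + B.ψII d (.inl a.1)))
  else ⨅ a : {a : V // N.IsGateway a ∧ N.cl a = N.cl n}, (B.Q n a.1 + B.ψII d (.inl a.1))

instance gatewaysNonempty (n : V) : Nonempty {a : V // N.IsGateway a ∧ N.cl a = N.cl n} := by
  obtain ⟨g, h⟩ := N.exists_gateway n
  exact ⟨⟨g, h⟩⟩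

theorem ψII_le (d b : V) (hb : N.IsGateway b) (hbd : N.cl b = N.cl d) (n : V ⊕ J) :
    B.ψII d n ≤ B.U n b + B.U (.inl b) d :=
  ciInf_le (Set.finite_range _).bddBelow (⟨b, hb, hbd⟩ : {b : V // N.IsGateway b ∧ N.cl b = N.cl d})

theorem exists_ψII (d : V) (n : V ⊕ J) : ∃ b, N.IsGateway b ∧ N.cl b = N.cl d ∧
    B.ψII d n = B.U n b + B.U (.inl b) d := by
  obtain ⟨b, hb⟩ := exists_eq_ciInf_of_finite
    (f := fun b : {b : V // N.IsGateway b ∧ N.cl b = N.cl d} => B.U n b.1 + B.U (.inl b.1) d)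
  exact ⟨b.1, b.2.1, b.2.2, hb.symm⟩

theorem ψII_nonneg (d : V) (n : V ⊕ J) : 0 ≤ B.ψII d n := by
  obtain ⟨b, -, -, h⟩ := B.exists_ψII d n
  rw [h]
  exact add_nonneg (B.U_nonneg _ _) (B.U_nonneg _ _)

theorem ψI_le (d n a : V) (ha : N.IsGateway a) (han : N.cl a = N.cl n) :
    B.ψI d n ≤ B.Q n a + B.ψII d (.inl a) := by
  have : (⨅ a : {a : V // N.IsGateway a ∧ N.cl a = N.cl n}, (B.Q n a.1 + B.ψII d (.inl a.1)))
      ≤ B.Q n a + B.ψII d (.inl a) :=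
    ciInf_le (Set.finite_range _).bddBelow
      (⟨a, ha, han⟩ : {b : V // N.IsGateway b ∧ N.cl b = N.cl n})
  unfold ψI
  split_ifs
  · exact (min_le_right _ _).trans this
  · exact this

theorem ψI_le_direct (d n : V) (h : N.cl n = N.cl d) : B.ψI d n ≤ B.Q n d := by
  unfold ψI
  rw [if_pos h]
  exact min_le_left _ _

theorem ψI_cases (d n : V) : (N.cl n = N.cl d ∧ B.ψI d n = B.Q n d) ∨
    ∃ a, N.IsGateway a ∧ N.cl a = N.cl n ∧ B.ψI d n = B.Q n a + B.ψII d (.inl a) := by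
  obtain ⟨b, hb⟩ := exists_eq_ciInf_of_finite
    (f := fun a : {a : V // N.IsGateway a ∧ N.cl a = N.cl n} => B.Q n a.1 + B.ψII d (.inl a.1))
  unfold ψI
  split_ifs with h
  · rcases min_choice (B.Q n d)
      (⨅ a : {a : V // N.IsGateway a ∧ N.cl a = N.cl n}, (B.Q n a.1 + B.ψII d (.inl a.1))) with h' | h'
    · exact .inl ⟨h, h'⟩
    · exact .inr ⟨b.1, b.2.1, b.2.2, by rw [h']; exact hb.symm⟩
  · exact .inr ⟨b.1, b.2.1, b.2.2, hb.symm⟩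

theorem ψI_self (d : V) : B.ψI d d = 0 := by
  refine le_antisymm ((B.ψI_le_direct d d rfl).trans_eq (B.Q_self d)) ?_
  rcases B.ψI_cases d d with ⟨-, h⟩ | ⟨a, -, -, h⟩
  · rw [h]; exact B.Q_nonneg _ _
  · rw [h]; exact add_nonneg (B.Q_nonneg _ _) (B.ψII_nonneg _ _)

theorem ψI_sub_le (d : V) {a b : V} (h : N.Link a b) : B.ψI d a - B.ψI d b ≤ B.D a b := by
  have hcl := N.link_cl a b h
  rcases B.ψI_cases d b with ⟨h1, h2⟩ | ⟨g, hg, hgb, h2⟩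
  · have := B.ψI_le_direct d a (hcl.trans h1)
    have := B.D_ge a b d h (h1.symm.trans hcl.symm)
    linarith
  · have := B.ψI_le d a g hg (hgb.trans hcl.symm)
    have := B.D_ge a b g h (hgb.trans hcl.symm)
    linarith

theorem ψI_le_ψII (d : V) {g : V} (hg : N.IsGateway g) : B.ψI d g ≤ B.ψII d (.inl g) := by
  have := B.ψI_le d g g hg rfl
  rw [B.Q_self] at this
  linarith

theorem I_le_sum (n b : V) : B.I n b ≤ ∑ b, B.I n b :=
  Finset.single_le_sum (f := fun b => B.I n b) (fun b _ => B.I_nonneg n b) (Finset.mem_univ b)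

theorem sum_I_nonneg (n : V) : 0 ≤ ∑ b, B.I n b := Finset.sum_nonneg fun b _ => B.I_nonneg n b

/-- A packet at a gateway passes from the type-II to the type-I layer in one transfer, whichever
option attains `ψI`: towards the destination itself, or towards another gateway of the cluster. If
the minimum is attained at `g` itself, the layers agree. -/
theorem ψII_sub_le (d : V) (hd : ¬ N.IsGateway d) {g : V} (hg : N.IsGateway g) :
    B.ψII d (.inl g) - B.ψI d g ≤ ∑ b, B.I g b := by
  rcases B.ψI_cases d g with ⟨h1, h2⟩ | ⟨a, ha, hag, h2⟩
  · have := B.ψII_le d g hg h1 (.inl g)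
    rw [B.U_self] at this
    have := B.I_ge g d h1 (by simp [hg, hd])
    have := B.I_le_sum g d
    linarith
  · by_cases hga : g = a
    · subst hga
      rw [B.Q_self] at h2
      have := B.sum_I_nonneg g
      linarith
    obtain ⟨b, hb, hbd, h3⟩ := B.exists_ψII d (.inl a)
    have := B.ψII_le d b hb hbd (.inl g)
    have := B.I_ge_relay g a b hga hag.symm hg ha hb
    have := B.I_le_sum g a
    linarith

theorem ψII_up (d : V) {g : V} {m : J} (h : N.access g = some m) :
    B.ψII d (.inl g) - B.ψII d (.inr m) ≤ B.up g := by
  obtain ⟨b, hb, hbd, h3⟩ := B.exists_ψII d (.inr m)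
  have := B.ψII_le d b hb hbd (.inl g)
  have := B.up_ge g m b h hb
  linarith

theorem ψII_dn (d : V) {g : V} {m : J} (h : N.access g = some m) :
    B.ψII d (.inr m) - B.ψII d (.inl g) ≤ B.dn g := by
  obtain ⟨b, hb, hbd, h3⟩ := B.exists_ψII d (.inl g)
  have := B.ψII_le d b hb hbd (.inr m)
  have := B.dn_ge g m b h hb
  linarith

/-- The counterpart of `ψII_sub_le` at the source: the cheapest route starts in a type-II queue, and
one uplink transfer brings the packet into the type-I layer. -/
theorem sub_ψI_le (M : ℝ) {s d : V} (hs : ¬ N.IsGateway s) (hsd : N.cl s ≠ N.cl d)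
    (hM : ∀ a b, N.IsGateway a → N.cl a = N.cl s → N.IsGateway b → N.cl b = N.cl d →
      M ≤ B.U (.inl s) a + B.U (.inl a) b + B.U (.inl b) d) :
    M - B.ψI d s ≤ ∑ b, B.I s b := by
  rcases B.ψI_cases d s with ⟨h1, h2⟩ | ⟨a, ha, has, h2⟩
  · exact absurd h1 hsd
  · obtain ⟨b, hb, hbd, h3⟩ := B.exists_ψII d (.inl a)
    have := hM a b ha has hb hbd
    have := B.I_ge s a has.symm (by simp [hs, ha])
    have := B.I_le_sum s a
    linarith

/-- Weighted service used by a flow. -/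
noncomputable def flowCost [Fintype J] (φ : V ⊕ J → V ⊕ J → ℝ) : ℝ :=
  ∑ a, ∑ b, φ (.inl a) (.inl b) * B.D a b
    + ∑ a, (∑ b, φ (.inl a) (.inl b)) * ∑ b, B.I a b
    + ∑ g, ∑ m, (φ (.inl g) (.inr m) * B.up g + φ (.inr m) (.inl g) * B.dn g)

theorem flowCost_nonneg [Fintype J] (φ : V ⊕ J → V ⊕ J → ℝ) (hφ : ∀ a b, 0 ≤ φ a b) :
    0 ≤ B.flowCost φ := by
  unfold flowCost
  have := B.D_nonneg
  have := B.I_nonneg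
  have := B.up_nonneg
  have := B.dn_nonneg
  refine add_nonneg (add_nonneg ?_ ?_) ?_
  · exact Finset.sum_nonneg fun a _ => Finset.sum_nonneg fun b _ => mul_nonneg (hφ _ _) (B.D_nonneg _ _)
  · exact Finset.sum_nonneg fun a _ => mul_nonneg (Finset.sum_nonneg fun b _ => hφ _ _) (B.sum_I_nonneg a)
  · exact Finset.sum_nonneg fun a _ => Finset.sum_nonneg fun b _ => add_nonneg
      (mul_nonneg (hφ _ _) (B.up_nonneg _)) (mul_nonneg (hφ _ _) (B.dn_nonneg _))

/-- The potential is `ψI` on nodes and `ψII` on mobiles. A contact thus joins the two layers, and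
the gap at the gateway is charged to the wireless flow that leaves it. The gap between `M` and `ψI`
at the source is charged in the same way. -/
theorem inter_le_flowCost [Fintype J] (φ : V ⊕ J → V ⊕ J → ℝ) (hφ : ∀ a b, 0 ≤ φ a b)
    (hlink : ∀ a b, φ a b ≠ 0 → N.NetLink a b) {s d : V} {y : ℝ} (hy : 0 ≤ y)
    (hs : ¬ N.IsGateway s) (hd : ¬ N.IsGateway d) (hsd : N.cl s ≠ N.cl d)
    (hcons : ∀ n, n ≠ Sum.inl d →
      (if n = Sum.inl s then y else 0) + ∑ a, φ a n = ∑ b, φ n b)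
    (M : ℝ)
    (hM : ∀ a b, N.IsGateway a → N.cl a = N.cl s → N.IsGateway b → N.cl b = N.cl d →
      M ≤ B.U (.inl s) a + B.U (.inl a) b + B.U (.inl b) d) :
    y * M ≤ B.flowCost φ := by
  have key := Network.sum_flow_potential φ s d y hcons
    (Sum.elim (B.ψI d) (fun m => B.ψII d (.inr m))) (by simpa using B.ψI_self d)
  simp only [Fintype.sum_sum_type, Sum.elim_inl, Sum.elim_inr, Finset.sum_add_distrib] at key
  have hJJ : ∀ m m', φ (.inr m) (.inr m') = 0 := fun m m' => by
    by_contra h; exact hlink _ _ h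
  simp only [hJJ, zero_mul, Finset.sum_const_zero, add_zero] at key
  have h1 : ∀ a b, φ (.inl a) (.inl b) * (B.ψI d a - B.ψI d b) ≤ φ (.inl a) (.inl b) * B.D a b := by
    intro a b
    by_cases h : φ (.inl a) (.inl b) = 0
    · simp [h]
    · exact mul_le_mul_of_nonneg_left (B.ψI_sub_le d (hlink _ _ h)) (hφ _ _)
  -- exchange with the mobile, seen from the two layers of a gateway
  have h2 : ∀ g, ∑ m, φ (.inl g) (.inr m) * (B.ψI d g - B.ψII d (.inr m))
        + ∑ m, φ (.inr m) (.inl g) * (B.ψII d (.inr m) - B.ψI d g)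
      ≤ ∑ m, (φ (.inl g) (.inr m) * B.up g + φ (.inr m) (.inl g) * B.dn g)
        + (if g = s then 0 else (∑ b, φ (.inl g) (.inl b)) * ∑ b, B.I g b) := by
    intro g
    -- Insert the type-II value of `g` between the two ends of the contact: the drops inside the
    -- type-II layer cost `up` and `dn`, and the layer gap is multiplied by the net inflow from the
    -- mobile.
    have e1 : ∀ m, φ (.inl g) (.inr m) * (B.ψI d g - B.ψII d (.inr m))
        + φ (.inr m) (.inl g) * (B.ψII d (.inr m) - B.ψI d g)
      ≤ (φ (.inl g) (.inr m) * B.up g + φ (.inr m) (.inl g) * B.dn g)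
        + (φ (.inr m) (.inl g) - φ (.inl g) (.inr m)) * (B.ψII d (.inl g) - B.ψI d g) := by
      intro m
      have i1 : φ (.inl g) (.inr m) * (B.ψII d (.inl g) - B.ψII d (.inr m))
          ≤ φ (.inl g) (.inr m) * B.up g := by
        by_cases h : φ (.inl g) (.inr m) = 0
        · simp [h]
        · exact mul_le_mul_of_nonneg_left (B.ψII_up d (hlink _ _ h)) (hφ _ _)
      have i2 : φ (.inr m) (.inl g) * (B.ψII d (.inr m) - B.ψII d (.inl g))
          ≤ φ (.inr m) (.inl g) * B.dn g := by
        by_cases h : φ (.inr m) (.inl g) = 0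
        · simp [h]
        · exact mul_le_mul_of_nonneg_left (B.ψII_dn d (hlink _ _ h)) (hφ _ _)
      nlinarith [i1, i2]
    rw [← Finset.sum_add_distrib]
    refine (Finset.sum_le_sum fun m _ => e1 m).trans ?_
    rw [Finset.sum_add_distrib, ← Finset.sum_mul, Finset.sum_sub_distrib]
    refine add_le_add le_rfl ?_
    by_cases hg : N.IsGateway g
    · have hgs : g ≠ s := fun h => hs (h ▸ hg)
      have hgd : g ≠ d := fun h => hd (h ▸ hg)
      rw [if_neg hgs]
      have hc := hcons (.inl g) (by simpa using hgd)
      rw [if_neg (by simpa using hgs)] at hc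
      simp only [Fintype.sum_sum_type] at hc
      have hin : 0 ≤ ∑ a, φ (.inl a) (.inl g) := Finset.sum_nonneg fun a _ => hφ _ _
      have hout : 0 ≤ ∑ b, φ (.inl g) (.inl b) := Finset.sum_nonneg fun a _ => hφ _ _
      have p1 := B.ψII_sub_le d hd hg
      have p2 := B.ψI_le_ψII d hg
      -- By conservation at `g`, the net inflow from the mobiles is at most the outflow over
      -- wireless links.
      refine (mul_le_mul_of_nonneg_right ?_ (sub_nonneg.2 p2)).trans
        (mul_le_mul_of_nonneg_left p1 hout)
      linarith
    · have z1 : ∀ m, φ (.inr m) (.inl g) = 0 := fun m => by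
        by_contra h; exact hg ⟨m, hlink _ _ h⟩
      have z2 : ∀ m, φ (.inl g) (.inr m) = 0 := fun m => by
        by_contra h; exact hg ⟨m, hlink _ _ h⟩
      simp only [z1, z2, Finset.sum_const_zero, sub_zero, zero_mul]
      split_ifs
      · exact le_rfl
      · exact mul_nonneg (Finset.sum_nonneg fun a _ => hφ _ _) (B.sum_I_nonneg g)
  have h3 : y * (M - B.ψI d s) ≤ (∑ b, φ (.inl s) (.inl b)) * ∑ b, B.I s b := by
    have hc := hcons (.inl s) (by simpa using fun h => hsd (by rw [h]))
    rw [if_pos rfl] at hc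
    have z2 : ∀ m, φ (.inl s) (.inr m) = 0 := fun m => by
      by_contra h; exact hs ⟨m, hlink _ _ h⟩
    simp only [Fintype.sum_sum_type, z2, Finset.sum_const_zero, add_zero] at hc
    have hin : 0 ≤ ∑ a, φ (.inl a) (.inl s) := Finset.sum_nonneg fun a _ => hφ _ _
    have hin' : 0 ≤ ∑ a, φ (.inr a) (.inl s) := Finset.sum_nonneg fun a _ => hφ _ _
    refine (mul_le_mul_of_nonneg_left (B.sub_ψI_le M hs hsd hM) hy).trans
      (mul_le_mul_of_nonneg_right ?_ (B.sum_I_nonneg s))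
    linarith
  have h4 : ∑ a, (∑ b, φ (.inl a) (.inl b)) * ∑ b, B.I a b
      = (∑ b, φ (.inl s) (.inl b)) * ∑ b, B.I s b
        + ∑ g, (if g = s then 0 else (∑ b, φ (.inl g) (.inl b)) * ∑ b, B.I g b) := by
    rw [← Finset.add_sum_erase _ _ (Finset.mem_univ s)]
    congr 1
    rw [← Finset.add_sum_erase _ (fun g => if g = s then (0:ℝ) else _) (Finset.mem_univ s)]
    rw [if_pos rfl, zero_add]
    exact Finset.sum_congr rfl fun g hg => by rw [if_neg (Finset.ne_of_mem_erase hg)]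
  have h5 := Finset.sum_le_sum fun g (_ : g ∈ Finset.univ) => h2 g
  have h6 := Finset.sum_le_sum fun a (_ : a ∈ Finset.univ) =>
    Finset.sum_le_sum fun b (_ : b ∈ Finset.univ) => h1 a b
  rw [Finset.sum_add_distrib, Finset.sum_add_distrib] at h5
  rw [Finset.sum_comm (γ := J) (f := fun m g => φ (.inr m) (.inl g) * (B.ψII d (.inr m) - B.ψI d g))]
    at key
  unfold flowCost
  rw [h4]
  linarith

/-- One layer suffices: the potential is the type-I backlog for `d`, and mobiles carry none of this
flow. -/
theorem intra_le_flowCost [Fintype J] (φ : V ⊕ J → V ⊕ J → ℝ) (hφ : ∀ a b, 0 ≤ φ a b)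
    (hlink : ∀ a b, φ a b ≠ 0 → N.NetLink a b) {s d : V} {y : ℝ}
    (hin : ∀ a b, φ a b ≠ 0 →
      ∃ a' b', a = .inl a' ∧ b = .inl b' ∧ N.cl a' = N.cl s ∧ N.cl b' = N.cl s)
    (hsd : N.cl s = N.cl d)
    (hcons : ∀ n, n ≠ Sum.inl d →
      (if n = Sum.inl s then y else 0) + ∑ a, φ a n = ∑ b, φ n b) :
    y * B.Q s d ≤ B.flowCost φ := by
  have key := Network.sum_flow_potential φ s d y hcons
    (Sum.elim (fun n => B.Q n d) (fun m => 0)) (by simpa using B.Q_self d)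
  simp only [Fintype.sum_sum_type, Sum.elim_inl, Sum.elim_inr, Finset.sum_add_distrib] at key
  have hJ : ∀ m n, φ (.inr m) n = 0 := fun m n => by
    by_contra h
    obtain ⟨a', b', h1, -⟩ := hin _ _ h
    cases h1
  have hJ' : ∀ m n, φ n (.inr m) = 0 := fun m n => by
    by_contra h
    obtain ⟨a', b', -, h1, -⟩ := hin _ _ h
    cases h1
  simp only [hJ, hJ', zero_mul, Finset.sum_const_zero, add_zero] at key
  rw [← key]
  unfold flowCost
  simp only [hJ, hJ', zero_mul, Finset.sum_const_zero, add_zero]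
  have : 0 ≤ ∑ a, (∑ b, φ (.inl a) (.inl b)) * ∑ b, B.I a b :=
    Finset.sum_nonneg fun a _ => mul_nonneg (Finset.sum_nonneg fun b _ => hφ _ _) (B.sum_I_nonneg a)
  refine le_add_of_le_of_nonneg ?_ this
  refine Finset.sum_le_sum fun a _ => Finset.sum_le_sum fun b _ => ?_
  by_cases h : φ (.inl a) (.inl b) = 0
  · simp [h]
  · refine mul_le_mul_of_nonneg_left (B.D_ge a b d (hlink _ _ h) ?_) (hφ _ _)
    obtain ⟨a', b', h1, -, h2, -⟩ := hin _ _ h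
    cases h1
    rw [h2, hsd]

/-- The weighted service dominates every supportable traffic, each flow being charged the cost of
any of its routes. -/
theorem traffic_le_total [Fintype J] {r η : ℝ} (hη : N.ExceedsNodeRates η)
    {y : V → V → ℝ} (hsup : N.Supportable r y) (hy : N.IsTraffic y) (M : V → V → ℝ)
    (hM : ∀ s d, N.cl s ≠ N.cl d → ∀ a b, N.IsGateway a → N.cl a = N.cl s → N.IsGateway b →
      N.cl b = N.cl d → M s d ≤ B.U (.inl s) a + B.U (.inl a) b + B.U (.inl b) d) :
    ∑ s, ∑ d, y s d * (if N.cl s = N.cl d then B.Q s d else M s d) ≤ B.total r η := by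
  obtain ⟨φ, hφ, hlink, hintra, hcons, hgam, hmob⟩ := hsup
  have h1 : ∀ s d, y s d * (if N.cl s = N.cl d then B.Q s d else M s d) ≤ B.flowCost (φ s d) := by
    intro s d
    by_cases h0 : y s d = 0
    · rw [h0, zero_mul]; exact B.flowCost_nonneg _ (hφ s d)
    obtain ⟨-, hs, hd⟩ := hy.2 s d h0
    split_ifs with hsd
    · exact B.intra_le_flowCost _ (hφ s d) (hlink s d) (fun a b h => hintra s d a b h hsd) hsd
        (hcons s d)
    · exact B.inter_le_flowCost _ (hφ s d) (hlink s d) (hy.1 s d) hs hd hsd (hcons s d) _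
        (hM s d hsd)
  refine (Finset.sum_le_sum fun s _ => Finset.sum_le_sum fun d _ => h1 s d).trans ?_
  -- `sum of flow costs = cost of the sum of the flows`
  choose μ hμ hμφ using hgam
  have h2 : ∑ s, ∑ d, B.flowCost (φ s d) = B.flowCost (fun a b => ∑ s, ∑ d, φ s d a b) := by
    simp only [← Fintype.sum_prod_type' (f := fun s d => B.flowCost (φ s d)),
      ← Fintype.sum_prod_type' (f := fun s d => φ s d _ _)]
    unfold flowCost
    simp only [Finset.sum_add_distrib, Finset.sum_mul]
    congr 1
    · congr 1
      · rw [Finset.sum_comm]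
        refine Finset.sum_congr rfl fun a _ => ?_
        rw [Finset.sum_comm]
      · rw [Finset.sum_comm]
        refine Finset.sum_congr rfl fun a _ => ?_
        rw [Finset.sum_comm]
    · congr 1
      · rw [Finset.sum_comm]
        refine Finset.sum_congr rfl fun a _ => ?_
        rw [Finset.sum_comm]
      · rw [Finset.sum_comm]
        refine Finset.sum_congr rfl fun a _ => ?_
        rw [Finset.sum_comm]
  rw [h2]
  set Φ : V ⊕ J → V ⊕ J → ℝ := fun a b => ∑ s, ∑ d, φ s d a b with hΦ
  have hΦ0 : ∀ a b, 0 ≤ Φ a b := fun a b =>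
    Finset.sum_nonneg fun s _ => Finset.sum_nonneg fun d _ => hφ s d a b
  have hle : ∀ a b, Φ (.inl a) (.inl b) ≤ μ (N.cl a) a b := fun a b => hμφ (N.cl a) a b rfl
  unfold flowCost total
  refine add_le_add (add_le_add ?_ ?_) ?_
  · refine (Finset.sum_le_sum fun a _ => Finset.sum_le_sum fun b _ => ?_).trans (B.S_ge μ hμ)
    exact mul_le_mul_of_nonneg_right (hle a b) (B.D_nonneg a b)
  · rw [Finset.mul_sum]
    refine Finset.sum_le_sum fun a _ => mul_le_mul_of_nonneg_right ?_ (B.sum_I_nonneg a)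
    exact (Finset.sum_le_sum fun b _ => hle a b).trans (hη.2 _ _ (hμ _) a).le
  · unfold mobileService
    rw [Finset.sum_comm, Finset.mul_sum]
    refine Finset.sum_le_sum fun m _ => ?_
    have hz : ∀ g, N.access g ≠ some m → Φ (.inl g) (.inr m) = 0 ∧ Φ (.inr m) (.inl g) = 0 := by
      intro g hg
      constructor
      · refine Finset.sum_eq_zero fun s _ => Finset.sum_eq_zero fun d _ => ?_
        by_contra h
        exact hg (hlink s d _ _ h)
      · refine Finset.sum_eq_zero fun s _ => Finset.sum_eq_zero fun d _ => ?_
        by_contra h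
        exact hg (hlink s d _ _ h)
    have hsub : ∑ g, (Φ (.inl g) (.inr m) * B.up g + Φ (.inr m) (.inl g) * B.dn g)
        = ∑ g : N.Port m, (Φ (.inl g.1) (.inr m) * B.up g.1 + Φ (.inr m) (.inl g.1) * B.dn g.1) := by
      rw [← Finset.sum_filter_of_ne (p := fun g => N.access g = some m)]
      · exact Finset.sum_subtype _ (by simp) _
      · intro g _ h
        by_contra hg
        simp [hz g hg] at h
    rw [hsub, Finset.mul_sum]
    refine Finset.sum_le_sum fun g _ => ?_
    have h3 := mul_le_mul_of_nonneg_right (hmob m g).1 (B.up_nonneg g.1)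
    have h4 := mul_le_mul_of_nonneg_right (hmob m g).2 (B.dn_nonneg g.1)
    simp only [hΦ]
    linarith

/-! ### Duality: the weighted service dominates the backlogs -/

variable [Fintype J]

omit [Fintype J] in
theorem S_nonneg (hne : ∀ i, (N.Gam i).Nonempty) : 0 ≤ B.S := by
  choose μ hμ using hne
  exact (Finset.sum_nonneg fun a _ => Finset.sum_nonneg fun b _ =>
    mul_nonneg (N.gam_nonneg (hμ _) a b) (B.D_nonneg a b)).trans (B.S_ge μ hμ)

theorem mobileService_nonneg {r : ℝ} (hr : 0 ≤ r) : 0 ≤ B.mobileService r :=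
  mul_nonneg hr (Finset.sum_nonneg fun j _ => Finset.sum_nonneg fun g _ =>
    mul_nonneg (N.stat_nonneg j g) (add_nonneg (B.up_nonneg _) (B.dn_nonneg _)))

omit [Fintype J] in
theorem sum_sum_I_nonneg : 0 ≤ ∑ n, ∑ b, B.I n b := Finset.sum_nonneg fun n _ => B.sum_I_nonneg n

theorem total_nonneg (hne : ∀ i, (N.Gam i).Nonempty) {r η : ℝ} (hr : 0 ≤ r) (hη : 0 ≤ η) :
    0 ≤ B.total r η :=
  add_nonneg (add_nonneg (B.S_nonneg hne) (mul_nonneg hη B.sum_sum_I_nonneg))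
    (B.mobileService_nonneg hr)

variable (N) in
/-- A function of the backlogs that is at most a constant multiple of the total service. -/
def Dominated (r η : ℝ) (f : Backlog N → ℝ) : Prop :=
  ∃ C, 0 ≤ C ∧ ∀ B : Backlog N, f B ≤ C * B.total r η

theorem Dominated.add {r η : ℝ} {f g : Backlog N → ℝ} (hf : Dominated N r η f)
    (hg : Dominated N r η g) : Dominated N r η fun B => f B + g B := by
  obtain ⟨C, hC, hf⟩ := hf
  obtain ⟨C', hC', hg⟩ := hg
  exact ⟨C + C', add_nonneg hC hC', fun B => by have := hf B; have := hg B; simp only; linarith⟩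

theorem Dominated.mono {r η : ℝ} {f g : Backlog N → ℝ} (hf : Dominated N r η f)
    (h : ∀ B, g B ≤ f B) : Dominated N r η g := by
  obtain ⟨C, hC, hf⟩ := hf
  exact ⟨C, hC, fun B => (h B).trans (hf B)⟩

theorem dominated_of_mul_le {r η : ℝ} {f : Backlog N → ℝ} {c : ℝ} (hc : 0 < c)
    (h : ∀ B, c * f B ≤ B.total r η) : Dominated N r η f :=
  ⟨c⁻¹, inv_nonneg.2 hc.le, fun B => by
    rw [inv_mul_eq_div, le_div_iff₀ hc, mul_comm]; exact h B⟩

variable {r η : ℝ}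

theorem dominated_zero (hne : ∀ i, (N.Gam i).Nonempty) (hr : 0 ≤ r) (hη : 0 ≤ η) :
    Dominated N r η fun _ => 0 :=
  ⟨1, zero_le_one, fun B => by simpa using B.total_nonneg hne hr hη⟩

/-- Test `S_ge` with rate vectors one of which activates this link. -/
theorem dominated_D (hne : ∀ i, (N.Gam i).Nonempty) (hr : 0 ≤ r) (hη : 0 ≤ η) {a b : V}
    (h : N.Link a b) : Dominated N r η fun B => B.D a b := by
  obtain ⟨μ, hμ, hpos⟩ := N.exists_gam_pos hne h
  refine dominated_of_mul_le hpos fun B => ?_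
  have h1 : ∑ b, μ (N.cl a) a b * B.D a b ≤ _ := Finset.single_le_sum
    (f := fun a => ∑ b, μ (N.cl a) a b * B.D a b)
    (fun a _ => Finset.sum_nonneg fun b _ => mul_nonneg (N.gam_nonneg (hμ _) a b) (B.D_nonneg a b))
    (Finset.mem_univ a)
  have h2 : μ (N.cl a) a b * B.D a b ≤ _ := Finset.single_le_sum
    (f := fun b => μ (N.cl a) a b * B.D a b)
    (fun b _ => mul_nonneg (N.gam_nonneg (hμ _) a b) (B.D_nonneg a b))
    (Finset.mem_univ b)
  have h3 := B.S_ge μ hμ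
  have h4 := B.mobileService_nonneg hr
  have h5 := mul_nonneg hη B.sum_sum_I_nonneg
  unfold total
  linarith

theorem dominated_I (hne : ∀ i, (N.Gam i).Nonempty) (hr : 0 ≤ r) (hη : 0 < η) (n b : V) :
    Dominated N r η fun B => B.I n b := by
  refine dominated_of_mul_le hη fun B => ?_
  have h1 : ∑ b, B.I n b ≤ _ := Finset.single_le_sum
    (f := fun n => ∑ b, B.I n b) (fun n _ => B.sum_I_nonneg n) (Finset.mem_univ n)
  have h2 := mul_le_mul_of_nonneg_left ((B.I_le_sum n b).trans h1) hη.le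
  have h4 := B.mobileService_nonneg hr
  have h5 := B.S_nonneg hne
  unfold total
  linarith

theorem dominated_mobile (hne : ∀ i, (N.Gam i).Nonempty) (hr : 0 < r) (hη : 0 ≤ η) {g : V} {m : J}
    (h : N.access g = some m) : Dominated N r η fun B => B.up g + B.dn g := by
  refine dominated_of_mul_le (mul_pos hr (N.stat_pos m ⟨g, h⟩)) fun B => ?_
  have hnn : ∀ j, ∀ g : N.Port j, 0 ≤ N.stat j g * (B.up g.1 + B.dn g.1) := fun j g =>
    mul_nonneg (N.stat_nonneg j g) (add_nonneg (B.up_nonneg _) (B.dn_nonneg _))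
  have h1 : ∑ g : N.Port m, N.stat m g * (B.up g.1 + B.dn g.1) ≤ _ := Finset.single_le_sum
    (f := fun j => ∑ g : N.Port j, N.stat j g * (B.up g.1 + B.dn g.1))
    (fun j _ => Finset.sum_nonneg fun g _ => hnn j g) (Finset.mem_univ m)
  have h2 : N.stat m ⟨g, h⟩ * (B.up g + B.dn g) ≤ _ := Finset.single_le_sum
    (f := fun g : N.Port m => N.stat m g * (B.up g.1 + B.dn g.1))
    (fun g _ => hnn m g) (Finset.mem_univ (⟨g, h⟩ : N.Port m))
  have h3 := mul_le_mul_of_nonneg_left (h2.trans h1) hr.le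
  have h4 := B.S_nonneg hne
  have h5 := mul_nonneg hη B.sum_sum_I_nonneg
  unfold total mobileService
  linarith

/-- Along a wireless path from `a` to `j` the backlog drops by at most `D` per link, and it vanishes
at `j`. -/
theorem dominated_Q (hne : ∀ i, (N.Gam i).Nonempty) (hr : 0 ≤ r) (hη : 0 ≤ η) {a j : V}
    (h : N.cl a = N.cl j) : Dominated N r η fun B => B.Q a j := by
  induction N.cluster_connected a j h using Relation.ReflTransGen.head_induction_on with
  | refl => exact (dominated_zero hne hr hη).mono fun B => (B.Q_self j).le
  | head hab hbj ih =>
    rename_i b c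
    have hcl := N.link_cl b c hab
    have hc : N.cl c = N.cl j := N.cl_eq_of_reach hbj
    exact ((ih hc).add (dominated_D hne hr hη hab)).mono fun B => by
      have := B.D_ge b c j hab (hc.symm.trans hcl.symm)
      linarith

theorem dominated_U (hne : ∀ i, (N.Gam i).Nonempty) (hr : 0 ≤ r) (hη : 0 < η) {n b : V}
    (h : N.cl n = N.cl b) (hg : N.IsGateway n ↔ ¬ N.IsGateway b) :
    Dominated N r η fun B => B.U (.inl n) b :=
  ((dominated_Q hne hr hη.le h).add (dominated_I hne hr hη n b)).mono fun B => by
    have := B.I_ge n b h hg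
    linarith

theorem dominated_U_relay (hne : ∀ i, (N.Gam i).Nonempty) (hr : 0 ≤ r) (hη : 0 < η) {n b l : V}
    (h : N.cl n = N.cl b) (hn : N.IsGateway n) (hb : N.IsGateway b) (hl : N.IsGateway l)
    (hU : Dominated N r η fun B => B.U (.inl b) l) :
    Dominated N r η fun B => B.U (.inl n) l := by
  by_cases hnb : n = b
  · rw [hnb]; exact hU
  · exact ((hU.add (dominated_Q hne hr hη.le h)).add (dominated_I hne hr hη n b)).mono fun B => by
      have := B.I_ge_relay n b l hnb h hn hb hl
      linarith

/-- Telescoping along a path of cluster steps and contacts that ends at `l`, where the backlog is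
zero. The path may visit internal nodes, whose backlogs for distant gateways no weight controls; the
induction therefore carries the bound at all gateways of the current cluster. -/
theorem dominated_U_gateway (hne : ∀ i, (N.Gam i).Nonempty) (hr : 0 < r) (hη : 0 < η) {n : V ⊕ J}
    {l : V} (hl : N.IsGateway l) (h : N.Conn n l) :
    (∀ m, n = .inr m → Dominated N r η fun B => B.U (.inr m) l) ∧
    (∀ a g, n = .inl a → N.IsGateway g → N.cl g = N.cl a →
      Dominated N r η fun B => B.U (.inl g) l) := by
  induction h using Relation.ReflTransGen.head_induction_on with
  | refl =>
    refine ⟨fun m h => (by cases h), fun a g h hg hga => ?_⟩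
    cases h
    exact dominated_U_relay hne hr.le hη hga hg hl hl
      ((dominated_zero hne hr.le hη.le).mono fun B => (B.U_self l).le)
  | head hab hbj ih =>
    rename_i b c
    refine ⟨fun m h => ?_, fun a g h hg hga => ?_⟩
    · subst h
      rcases c with c | c
      · have hc : N.access c = some m := hab
        exact ((ih.2 c c rfl ⟨m, hc⟩ rfl).add (dominated_mobile hne hr hη.le hc)).mono fun B => by
          have := B.dn_ge c m l hc hl
          have := B.up_nonneg c
          linarith
      · exact hab.elim
    · subst h
      rcases c with c | c
      · have hc : N.cl a = N.cl c := hab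
        exact ih.2 c g rfl hg (hga.trans hc)
      · have hc : N.access a = some c := hab
        refine dominated_U_relay hne hr.le hη hga hg ⟨c, hc⟩ hl ?_
        exact ((ih.1 c rfl).add (dominated_mobile hne hr hη.le hc)).mono fun B => by
          have := B.up_ge a c l hc hl
          have := B.dn_nonneg a
          linarith

/-- A type-II queue that the algorithm can fill. -/
def _root_.ICN.Network.Used (N : Network ι V J) (n : V ⊕ J) (l : V) : Prop :=
  (∃ a, n = .inl a ∧ N.cl a = N.cl l ∧ (N.IsGateway a ↔ ¬ N.IsGateway l)) ∨
    (N.IsGateway l ∧ N.Conn n l ∧ ∀ a, n = .inl a → N.IsGateway a)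

theorem dominated_used (hne : ∀ i, (N.Gam i).Nonempty) (hr : 0 < r) (hη : 0 < η) {n : V ⊕ J}
    {l : V} (h : N.Used n l) : Dominated N r η fun B => B.U n l := by
  rcases h with ⟨a, rfl, h1, h2⟩ | ⟨hl, hc, hn⟩
  · exact dominated_U hne hr.le hη h1 h2
  · rcases n with a | m
    · exact (dominated_U_gateway hne hr hη hl hc).2 a a rfl (hn a rfl) rfl
    · exact (dominated_U_gateway hne hr hη hl hc).1 m rfl

/-- The total service dominates all queues that can be filled. -/
theorem exists_sum_le_total (N : Network ι V J) (hne : ∀ i, (N.Gam i).Nonempty) (hr : 0 < r)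
    (hη : 0 < η) :
    ∃ C, 0 < C ∧ ∀ B : Backlog N, (∀ n l, ¬ N.Used n l → B.U n l = 0) →
      (∀ n b, N.cl n ≠ N.cl b → B.Q n b = 0) →
      ∑ n, ∑ l, B.U n l + ∑ n, ∑ b, B.Q n b ≤ C * B.total r η := by
  have h1 : ∀ n l, ∃ C, 0 ≤ C ∧ ∀ B : Backlog N, (∀ n l, ¬ N.Used n l → B.U n l = 0) →
      B.U n l ≤ C * B.total r η := fun n l => by
    by_cases h : N.Used n l
    · obtain ⟨C, hC, h⟩ := dominated_used hne hr hη h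
      exact ⟨C, hC, fun B _ => h B⟩
    · exact ⟨0, le_rfl, fun B hB => by simp [hB n l h]⟩
  have h2 : ∀ n b, ∃ C, 0 ≤ C ∧ ∀ B : Backlog N, (∀ n b, N.cl n ≠ N.cl b → B.Q n b = 0) →
      B.Q n b ≤ C * B.total r η := fun n b => by
    by_cases h : N.cl n = N.cl b
    · obtain ⟨C, hC, h⟩ := dominated_Q hne hr.le hη.le h
      exact ⟨C, hC, fun B _ => h B⟩
    · exact ⟨0, le_rfl, fun B hB => by simp [hB n b h]⟩
  choose CU hCU hU using h1
  choose CQ hCQ hQ using h2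
  -- The summand `1` only makes the constant positive, so that one can divide by it.
  refine ⟨1 + (∑ n, ∑ l, CU n l + ∑ n, ∑ b, CQ n b), ?_, fun B hBU hBQ => ?_⟩
  · have : 0 ≤ ∑ n, ∑ l, CU n l := Finset.sum_nonneg fun n _ => Finset.sum_nonneg fun l _ => hCU n l
    have : 0 ≤ ∑ n, ∑ b, CQ n b := Finset.sum_nonneg fun n _ => Finset.sum_nonneg fun l _ => hCQ n l
    linarith
  · have ht := B.total_nonneg hne hr.le hη.le
    rw [add_mul, one_mul, add_mul]
    simp only [Finset.sum_mul]
    have : ∑ n, ∑ l, B.U n l ≤ ∑ n, ∑ l, CU n l * B.total r η :=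
      Finset.sum_le_sum fun n _ => Finset.sum_le_sum fun l _ => hU n l B hBU
    have : ∑ n, ∑ b, B.Q n b ≤ ∑ n, ∑ b, CQ n b * B.total r η :=
      Finset.sum_le_sum fun n _ => Finset.sum_le_sum fun l _ => hQ n l B hBQ
    linarith

end Backlog

/-! ### Work-conserving service and elementary facts on runs -/

namespace Serves

variable {α κ : Type*} [Fintype α] [Fintype κ] {content : α → ℝ} {demand : κ → ℝ} {out : κ → α → ℝ}

theorem nonneg (h : Serves content demand out) (k : κ) (a : α) : 0 ≤ out k a := h.1 k a

theorem sum_le_demand (h : Serves content demand out) (k : κ) : ∑ a, out k a ≤ demand k := h.2.1 k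

theorem sum_le_content (h : Serves content demand out) (a : α) : ∑ k, out k a ≤ content a := h.2.2.1 a

theorem content_nonneg (h : Serves content demand out) (a : α) : 0 ≤ content a :=
  (Finset.sum_nonneg fun k _ => h.nonneg k a).trans (h.sum_le_content a)

theorem le_content (h : Serves content demand out) (k : κ) (a : α) : out k a ≤ content a :=
  (Finset.single_le_sum (f := fun k => out k a) (fun k _ => h.nonneg k a) (Finset.mem_univ k)).trans
    (h.sum_le_content a)

theorem content_ne_zero (h : Serves content demand out) {k : κ} {a : α} (hne : out k a ≠ 0) :
    content a ≠ 0 := fun h0 =>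
  hne (le_antisymm ((h.le_content k a).trans_eq h0) (h.nonneg k a))

theorem le_demand (h : Serves content demand out) (k : κ) (a : α) : out k a ≤ demand k :=
  (Finset.single_le_sum (f := fun a => out k a) (fun a _ => h.nonneg k a) (Finset.mem_univ a)).trans
    (h.sum_le_demand k)

theorem demand_ne_zero (h : Serves content demand out) {k : κ} {a : α} (hne : out k a ≠ 0) :
    demand k ≠ 0 := fun h0 =>
  hne (le_antisymm ((h.le_demand k a).trans_eq h0) (h.nonneg k a))

theorem sum_eq_demand (h : Serves content demand out) (hle : ∑ k, demand k ≤ ∑ a, content a)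
    (k : κ) : ∑ a, out k a = demand k := by
  have h1 := h.2.2.2
  rw [min_eq_right hle] at h1
  exact (Finset.sum_eq_sum_iff_of_le (fun k _ => h.sum_le_demand k)).1 h1 k (Finset.mem_univ k)

end Serves

/-- A run of BP+SR under the assumptions on the parameters that are used throughout. -/
structure Run [Fintype J] (N : Network ι V J) (x : V → V → ℝ) (T : ℕ) (R η δ : ℝ) (pos : N.Path)
    (e : Execution ι V J) : Prop where
  traffic : N.IsTraffic x
  rates : N.ExceedsNodeRates η
  T_pos : 0 < T
  R_nonneg : 0 ≤ R
  δ_nonneg : 0 ≤ δ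
  conn : ∀ s d, x s d ≠ 0 → N.Conn (.inl s) d
  exec : N.IsExecution x T R η δ pos e

namespace Run

variable [Fintype J] {N : Network ι V J} {x : V → V → ℝ} {T : ℕ} {R η δ : ℝ} {pos : N.Path}
  {e : Execution ι V J}

section projections

variable (h : Run N x T R η δ pos e)
include h

theorem η_pos : 0 < η := h.rates.1
theorem routing : N.SourceRouting T e := h.exec.1
theorem choices : N.InterClusterChoices T pos e := h.exec.2.1
theorem intra : N.IntraClusterChoices e := h.exec.2.2.1
theorem servesI (t n b) : Serves (e.q t n b) (N.demandI e t n b) (e.sendI t n b) :=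
  h.exec.2.2.2.1.1 t n b
theorem servesII (t n l) : Serves (e.u t n l) (N.demandII T R η pos e t n l) (e.sendII t n l) :=
  h.exec.2.2.2.1.2.1 t n l
theorem servesW (t g l) : Serves (e.w t g l) (fun _ : Unit => N.regulated x T δ e t g l)
    (fun _ => e.release t g l) := h.exec.2.2.2.1.2.2 t g l
theorem q_zero (n b a) : e.q 0 n b a = 0 := h.exec.2.2.2.2.1 n b a
theorem u_zero (n l a) : e.u 0 n l a = 0 := h.exec.2.2.2.2.2.1 n l a
theorem w_zero (g l a) : e.w 0 g l a = 0 := h.exec.2.2.2.2.2.2.1 g l a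
theorem q_succ (t n b a) : e.q (t + 1) n b a = if n = b then 0 else
      e.q t n b a - ∑ n', e.sendI t n b n' a + ∑ n', e.sendI t n' b n a + N.injectI x e t n b a :=
  h.exec.2.2.2.2.2.2.2.1 t n b a
theorem u_succ_inl (t n l a) : e.u (t + 1) (.inl n) l a =
    e.u t (.inl n) l a - ∑ c, e.sendII t (.inl n) l c a
      + N.newInter x T e t n l a + e.release t n l a
      + if l = n then 0 else
          (if a.2.2 = l then Network.fromGateway e t n a else 0) + N.fromMobile T pos e t n l a :=
  h.exec.2.2.2.2.2.2.2.2.1 t n l a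
theorem u_succ_inr (t m l a) : e.u (t + 1) (.inr m) l a =
    e.u t (.inr m) l a - ∑ c, e.sendII t (.inr m) l c a
      + e.sendII t (.inl (pos (t / T) m).1) l none a :=
  h.exec.2.2.2.2.2.2.2.2.2.1 t m l a
theorem w_succ (t g l a) : e.w (t + 1) g l a =
    e.w t g l a - e.release t g l a
      + (if N.IsGateway g ∧ a.2.2 = l then ∑ n, e.sendI t n g g (.uplink, a) else 0)
      + if a.2.2 = g ∧ a.2.1 = l then
          Network.fromGateway e t g a + N.fromMobile T pos e t g g a else 0 :=
  h.exec.2.2.2.2.2.2.2.2.2.2 t g l a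

theorem q_nonneg (t n b a) : 0 ≤ e.q t n b a := (h.servesI t n b).content_nonneg a
theorem u_nonneg (t n l a) : 0 ≤ e.u t n l a := (h.servesII t n l).content_nonneg a
theorem w_nonneg (t g l a) : 0 ≤ e.w t g l a := (h.servesW t g l).content_nonneg a
theorem qLen_nonneg (t n b) : 0 ≤ e.qLen t n b := Finset.sum_nonneg fun a _ => h.q_nonneg t n b a
theorem uLen_nonneg (t n l) : 0 ≤ e.uLen t n l := Finset.sum_nonneg fun a _ => h.u_nonneg t n l a
theorem pos_gateway (τ m) : N.IsGateway (pos τ m).1 := ⟨m, (pos τ m).2⟩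

theorem link_of_sendI {t n b n' a} (hne : e.sendI t n b n' a ≠ 0) :
    N.Link n n' ∧ e.linkIdx t n n' = b := by
  by_contra hcon
  exact (h.servesI t n b).demand_ne_zero hne (if_neg hcon)

theorem q_of_sendI {t n b n' a} (hne : e.sendI t n b n' a ≠ 0) : e.q t n b a ≠ 0 :=
  (h.servesI t n b).content_ne_zero hne

theorem u_of_sendII {t n l c a} (hne : e.sendII t n l c a ≠ 0) : e.u t n l a ≠ 0 :=
  (h.servesII t n l).content_ne_zero hne

theorem w_of_release {t g l a} (hne : e.release t g l a ≠ 0) : e.w t g l a ≠ 0 :=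
  (h.servesW t g l).content_ne_zero (k := ()) hne

theorem sendII_some {t n l b a} (hne : e.sendII t (.inl n) l (some b) a ≠ 0) :
    N.cl b = N.cl n ∧
      ((N.IsGateway n ∧ N.IsGateway l ∧ N.IsGateway b ∧ b ≠ n ∧ e.relayIdx (t / T) n b = l) ∨
        (b = l ∧ (N.IsGateway n ↔ ¬ N.IsGateway l))) := by
  have := (h.servesII t (.inl n) l).demand_ne_zero hne
  unfold Network.demandII at this
  simp only at this
  split_ifs at this with h1 h2 h3 h4
  · exact absurd rfl this
  · exact ⟨not_not.1 h1, .inl ⟨h2.1, h2.2, h3.1, h3.2.1, h3.2.2.1⟩⟩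
  · exact absurd rfl this
  · exact ⟨not_not.1 h1, .inr ⟨h4.1, h4.2.1⟩⟩
  · exact absurd rfl this

theorem sendII_inr_some {t m l b a} : e.sendII t (.inr m) l (some b) a = 0 := by
  by_contra hne
  exact (h.servesII t (.inr m) l).demand_ne_zero hne rfl

theorem sendII_inl_none {t g l a} (hne : e.sendII t (.inl g) l none a ≠ 0) :
    T ∣ t ∧ ∃ m, (pos (t / T) m).1 = g ∧ e.pickIdx (t / T) m = l := by
  have := (h.servesII t (.inl g) l).demand_ne_zero hne
  unfold Network.demandII at this
  simp only at this
  split_ifs at this with h1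
  · obtain ⟨h1, m, h2, h3, -⟩ := h1
    exact ⟨h1, m, h2, h3⟩
  · exact absurd rfl this

theorem sendII_inr_none {t m l a} (hne : e.sendII t (.inr m) l none a ≠ 0) :
    T ∣ t ∧ e.dropIdx (t / T) m = l := by
  have := (h.servesII t (.inr m) l).demand_ne_zero hne
  unfold Network.demandII at this
  simp only at this
  split_ifs at this with h1
  · exact h1
  · exact absurd rfl this

theorem sendII_none_gateway {t n l a} (hne : e.sendII t n l none a ≠ 0) : N.IsGateway l := by
  rcases n with g | m
  · obtain ⟨-, m, -, rfl⟩ := h.sendII_inl_none hne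
    exact (h.choices.2.2 _ m).1
  · obtain ⟨-, rfl⟩ := h.sendII_inr_none hne
    exact (h.choices.2.1 _ m).1

theorem regulated_ne_zero {t g l} (hne : N.regulated x T δ e t g l ≠ 0) :
    N.IsGateway g ∧ l ≠ g ∧ (¬ N.IsGateway l → N.cl l = N.cl g) := by
  unfold Network.regulated at hne
  have hne := right_ne_zero_of_mul hne
  split_ifs at hne with hl
  · obtain ⟨s, -, hs⟩ := Finset.exists_ne_zero_of_sum_ne_zero hne
    obtain ⟨d, -, hd⟩ := Finset.exists_ne_zero_of_sum_ne_zero hs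
    split_ifs at hd with h1
    · obtain ⟨h1, h2, h3⟩ := h1
      have hr := h.routing (t / T) s d h1
      rw [h2, h3] at hr
      refine ⟨hr.1.1, fun hlg => h1 ?_, fun h => absurd hl h⟩
      rw [← hr.1.2, ← hr.2.1.2, hlg]
    · exact absurd rfl hd
  · obtain ⟨s, -, hs⟩ := Finset.exists_ne_zero_of_sum_ne_zero hne
    split_ifs at hs with h1
    · obtain ⟨h1, h2⟩ := h1
      have hr := h.routing (t / T) s l h1
      rw [h2] at hr
      exact ⟨hr.2.1.1, fun hlg => hl (hlg ▸ hr.2.1.1), fun _ => hr.2.1.2.symm⟩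
    · exact absurd rfl hs

theorem regulated_of_release {t g l a} (hne : e.release t g l a ≠ 0) :
    N.IsGateway g ∧ l ≠ g ∧ (¬ N.IsGateway l → N.cl l = N.cl g) :=
  h.regulated_ne_zero ((h.servesW t g l).demand_ne_zero (k := ()) hne)

end projections

/-! ### Which packets each queue can hold -/

/-- Packets with header `a` may be stored at `n`. -/
def _root_.ICN.Network.ValidAt (N : Network ι V J) (x : V → V → ℝ) (n : V ⊕ J) (a : Header V) :
    Prop :=
  x a.1 a.2.1 ≠ 0 ∧ N.cl a.1 ≠ N.cl a.2.1 ∧ N.IsGateway a.2.2 ∧ N.cl a.2.2 = N.cl a.2.1 ∧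
    N.Conn n a.2.2

theorem _root_.ICN.Network.ValidAt.step {n n' : V ⊕ J} {a : Header V} (hv : N.ValidAt x n a)
    (hn : N.CLink n n') : N.ValidAt x n' a :=
  ⟨hv.1, hv.2.1, hv.2.2.1, hv.2.2.2.1, hv.2.2.2.2.step hn⟩

variable (N x e) in
/-- Which packets the queues can hold in slot `t`. -/
structure Contents (t : ℕ) : Prop where
  q_cl : ∀ n b a, e.q t n b a ≠ 0 → N.cl n = N.cl b
  q_valid : ∀ n b k a, e.q t n b (k, a) ≠ 0 → k ≠ .intra → N.ValidAt x (.inl n) a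
  q_gateway : ∀ n b k a, e.q t n b (k, a) ≠ 0 → k = .uplink ∨ k = .relay → N.IsGateway b
  u_valid : ∀ n l a, e.u t n l a ≠ 0 → N.ValidAt x n a
  u_internal : ∀ n l a, e.u t (.inl n) l a ≠ 0 → ¬ N.IsGateway n →
    N.IsGateway l ∧ N.cl n = N.cl l
  u_gateway : ∀ n l a, e.u t (.inl n) l a ≠ 0 → N.IsGateway n →
    l ≠ n ∧ (N.IsGateway l → a.2.2 = l) ∧ (¬ N.IsGateway l → N.cl n = N.cl l)
  u_mobile : ∀ m l a, e.u t (.inr m) l a ≠ 0 → N.IsGateway l ∧ a.2.2 = l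
  w_valid : ∀ g l a, e.w t g l a ≠ 0 → N.ValidAt x (.inl g) a
  w_header : ∀ g l a, e.w t g l a ≠ 0 → N.IsGateway l → a.2.2 = l

variable (h : Run N x T R η δ pos e)
include h

theorem fromGateway_ne_zero {t g a} (hne : Network.fromGateway e t g a ≠ 0) :
    ∃ n, e.sendI t n g g (.relay, a) ≠ 0 := by
  obtain ⟨n, -, hn⟩ := Finset.exists_ne_zero_of_sum_ne_zero hne
  exact ⟨n, hn⟩

theorem fromMobile_ne_zero {t g l a} (hne : N.fromMobile T pos e t g l a ≠ 0) :
    ∃ m, (pos (t / T) m).1 = g ∧ e.sendII t (.inr m) l none a ≠ 0 := by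
  obtain ⟨m, -, hm⟩ := Finset.exists_ne_zero_of_sum_ne_zero hne
  split_ifs at hm with h1
  · exact ⟨m, h1, hm⟩
  · exact absurd rfl hm

theorem contents_q_cases {t n b a} (hne : e.q (t + 1) n b a ≠ 0) :
    e.q t n b a ≠ 0 ∨ (∃ n', e.sendI t n' b n a ≠ 0) ∨ N.injectI x e t n b a ≠ 0 := by
  by_contra! hcon
  obtain ⟨h1, h2, h3⟩ := hcon
  refine hne ?_
  rw [h.q_succ]
  split_ifs
  · rfl
  · have h4 : ∀ n', e.sendI t n b n' a = 0 := fun n' => by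
      by_contra h'
      exact h.q_of_sendI h' h1
    simp [h1, h2, h3, h4]

theorem injectI_cases {t n b k a} (hne : N.injectI x e t n b (k, a) ≠ 0) :
    (k = .intra ∧ N.cl n = N.cl b) ∨
    (k = .uplink ∧ ¬ N.IsGateway n ∧ e.sendII t (.inl n) b (some b) a ≠ 0) ∨
    (k = .relay ∧ N.IsGateway n ∧ N.IsGateway b ∧ ∃ l, e.sendII t (.inl n) l (some b) a ≠ 0) ∨
    (k = .downlink ∧ N.IsGateway n ∧ ¬ N.IsGateway b ∧ e.sendII t (.inl n) b (some b) a ≠ 0) := by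
  cases k <;> simp only [Network.injectI, ne_eq, ite_eq_right_iff, Classical.not_imp] at hne
  · exact .inl ⟨rfl, hne.1.1⟩
  · exact .inr (.inl ⟨rfl, hne.1, hne.2⟩)
  · obtain ⟨l, -, hl⟩ := Finset.exists_ne_zero_of_sum_ne_zero hne.2
    exact .inr (.inr (.inl ⟨rfl, hne.1.1, hne.1.2, l, hl⟩))
  · exact .inr (.inr (.inr ⟨rfl, hne.1.1, hne.1.2, hne.2⟩))

theorem contents_u_inl_cases {t n l a} (hne : e.u (t + 1) (.inl n) l a ≠ 0) :
    e.u t (.inl n) l a ≠ 0 ∨ N.newInter x T e t n l a ≠ 0 ∨ e.release t n l a ≠ 0 ∨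
    (l ≠ n ∧ a.2.2 = l ∧ ∃ n', e.sendI t n' n n (.relay, a) ≠ 0) ∨
    (l ≠ n ∧ ∃ m, (pos (t / T) m).1 = n ∧ e.sendII t (.inr m) l none a ≠ 0) := by
  by_contra! hcon
  obtain ⟨h1, h2, h3, h4, h5⟩ := hcon
  refine hne ?_
  have h6 : ∀ c, e.sendII t (.inl n) l c a = 0 := fun c => by
    by_contra h'
    exact h.u_of_sendII h' h1
  rw [h.u_succ_inl]
  simp only [h1, h2, h3, h6, Finset.sum_const_zero, sub_zero, add_zero, zero_add]
  split_ifs with h7 h8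
  · rfl
  · rw [show Network.fromGateway e t n a = 0 from ?_, zero_add]
    · by_contra h'
      obtain ⟨m, hm1, hm2⟩ := h.fromMobile_ne_zero h'
      exact hm2 (h5 h7 m hm1)
    · by_contra h'
      obtain ⟨m, hm1⟩ := h.fromGateway_ne_zero h'
      exact hm1 (h4 h7 h8 m)
  · rw [zero_add]
    by_contra h'
    obtain ⟨m, hm1, hm2⟩ := h.fromMobile_ne_zero h'
    exact hm2 (h5 h7 m hm1)

theorem contents_u_inr_cases {t m l a} (hne : e.u (t + 1) (.inr m) l a ≠ 0) :
    e.u t (.inr m) l a ≠ 0 ∨ e.sendII t (.inl (pos (t / T) m).1) l none a ≠ 0 := by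
  by_contra! hcon
  obtain ⟨h1, h2⟩ := hcon
  refine hne ?_
  have h6 : ∀ c, e.sendII t (.inr m) l c a = 0 := fun c => by
    by_contra h'
    exact h.u_of_sendII h' h1
  rw [h.u_succ_inr]
  simp [h1, h2, h6]

theorem contents_w_cases {t g l a} (hne : e.w (t + 1) g l a ≠ 0) :
    e.w t g l a ≠ 0 ∨ (N.IsGateway g ∧ a.2.2 = l ∧ ∃ n, e.sendI t n g g (.uplink, a) ≠ 0) ∨
    (a.2.2 = g ∧ a.2.1 = l ∧ ((∃ n, e.sendI t n g g (.relay, a) ≠ 0) ∨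
      ∃ m, (pos (t / T) m).1 = g ∧ e.sendII t (.inr m) g none a ≠ 0)) := by
  by_contra! hcon
  obtain ⟨h1, h2, h3⟩ := hcon
  refine hne ?_
  have h6 : e.release t g l a = 0 := by
    by_contra h'
    exact h.w_of_release h' h1
  rw [h.w_succ]
  simp only [h1, h6, sub_zero, zero_add]
  have e1 : (if N.IsGateway g ∧ a.2.2 = l then ∑ n, e.sendI t n g g (.uplink, a) else 0) = 0 := by
    split_ifs with h7
    · exact Finset.sum_eq_zero fun n _ => h2 h7.1 h7.2 n
    · rfl
  rw [e1, zero_add]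
  split_ifs with h7
  · obtain ⟨h8, h9⟩ := h3 h7.1 h7.2
    have : Network.fromGateway e t g a = 0 := Finset.sum_eq_zero fun n _ => h8 n
    rw [this, zero_add]
    by_contra h'
    obtain ⟨m, hm1, hm2⟩ := h.fromMobile_ne_zero h'
    exact hm2 (h9 m hm1)
  · rfl

theorem newInter_ne_zero {t n l a} (hne : N.newInter x T e t n l a ≠ 0) :
    N.ValidAt x (.inl n) a ∧ ¬ N.IsGateway n ∧ N.IsGateway l ∧ N.cl n = N.cl l := by
  simp only [Network.newInter, ne_eq, ite_eq_right_iff, Classical.not_imp] at hne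
  obtain ⟨⟨rfl, h2, h3, h4⟩, h5⟩ := hne
  have hr := h.routing (t / T) a.1 a.2.1 h2
  have htr := h.traffic.2 _ _ h5
  rw [h3, h4] at hr
  exact ⟨⟨h5, h2, hr.2.1.1, hr.2.1.2, (h.conn _ _ h5).target hr.2.1.2.symm⟩, htr.2.1,
    hr.1.1, hr.1.2.symm⟩

/-- All clauses are proved in one induction, since a packet found at `t + 1` was in that queue, has
just been generated, or was sent from a queue of another kind at `t`. They confine backlogs to the
queues that the weighted service controls. -/
theorem contents (t : ℕ) : Contents N x e t := by
  induction t with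
  | zero => constructor <;> intros <;> simp_all [h.q_zero, h.u_zero, h.w_zero]
  | succ t ih =>
    have hpos : ∀ m, N.access (pos (t / T) m).1 = some m := fun m => (pos (t / T) m).2
    constructor
    · intro n b a hne
      obtain ⟨k, a⟩ := a
      rcases h.contents_q_cases hne with h1 | ⟨n', h1⟩ | h1
      · exact ih.q_cl _ _ _ h1
      · exact (N.link_cl _ _ (h.link_of_sendI h1).1).symm.trans (ih.q_cl _ _ _ (h.q_of_sendI h1))
      · rcases h.injectI_cases h1 with ⟨-, h2⟩ | ⟨-, -, h2⟩ | ⟨-, -, -, l, h2⟩ | ⟨-, -, -, h2⟩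
        · exact h2
        · exact (h.sendII_some h2).1.symm
        · exact (h.sendII_some h2).1.symm
        · exact (h.sendII_some h2).1.symm
    · intro n b k a hne hk
      rcases h.contents_q_cases hne with h1 | ⟨n', h1⟩ | h1
      · exact ih.q_valid _ _ _ _ h1 hk
      · exact (ih.q_valid _ _ _ _ (h.q_of_sendI h1) hk).step (N.link_cl _ _ (h.link_of_sendI h1).1)
      · rcases h.injectI_cases h1 with ⟨h0, -⟩ | ⟨-, -, h2⟩ | ⟨-, -, -, l, h2⟩ | ⟨-, -, -, h2⟩
        · exact absurd h0 hk
        · exact ih.u_valid _ _ _ (h.u_of_sendII h2)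
        · exact ih.u_valid _ _ _ (h.u_of_sendII h2)
        · exact ih.u_valid _ _ _ (h.u_of_sendII h2)
    · intro n b k a hne hk
      rcases h.contents_q_cases hne with h1 | ⟨n', h1⟩ | h1
      · exact ih.q_gateway _ _ _ _ h1 hk
      · exact ih.q_gateway _ _ _ _ (h.q_of_sendI h1) hk
      · rcases h.injectI_cases h1 with ⟨rfl, -⟩ | ⟨-, h3, h2⟩ | ⟨-, -, h2, -⟩ | ⟨rfl, -⟩
        · simp at hk
        · exact (ih.u_internal _ _ _ (h.u_of_sendII h2) h3).1
        · exact h2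
        · simp at hk
    · intro n l a hne
      rcases n with n | m
      · rcases h.contents_u_inl_cases hne with h1 | h1 | h1 | ⟨-, -, n', h1⟩ | ⟨-, m, h2, h1⟩
        · exact ih.u_valid _ _ _ h1
        · exact (h.newInter_ne_zero h1).1
        · exact ih.w_valid _ _ _ (h.w_of_release h1)
        · exact (ih.q_valid _ _ _ _ (h.q_of_sendI h1) (by simp)).step
            (N.link_cl _ _ (h.link_of_sendI h1).1)
        · refine (ih.u_valid _ _ _ (h.u_of_sendII h1)).step ?_
          rw [← h2]
          exact hpos m
      · rcases h.contents_u_inr_cases hne with h1 | h1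
        · exact ih.u_valid _ _ _ h1
        · exact (ih.u_valid _ _ _ (h.u_of_sendII h1)).step (hpos m)
    · intro n l a hne hn
      rcases h.contents_u_inl_cases hne with h1 | h1 | h1 | ⟨-, -, n', h1⟩ | ⟨-, m, h2, h1⟩
      · exact ih.u_internal _ _ _ h1 hn
      · exact (h.newInter_ne_zero h1).2.2
      · exact absurd (h.regulated_of_release h1).1 hn
      · exact absurd (ih.q_gateway _ _ _ _ (h.q_of_sendI h1) (.inr rfl)) hn
      · exact absurd (h2 ▸ h.pos_gateway _ m) hn
    · intro n l a hne hn
      rcases h.contents_u_inl_cases hne with h1 | h1 | h1 | ⟨h0, h3, n', h1⟩ | ⟨h0, m, h2, h1⟩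
      · exact ih.u_gateway _ _ _ h1 hn
      · exact absurd hn (h.newInter_ne_zero h1).2.1
      · have h2 := h.regulated_of_release h1
        exact ⟨h2.2.1, ih.w_header _ _ _ (h.w_of_release h1), fun hl => (h2.2.2 hl).symm⟩
      · refine ⟨h0, fun _ => h3, fun hl => absurd ?_ hl⟩
        rw [← h3]
        exact (ih.q_valid _ _ _ _ (h.q_of_sendI h1) (by simp)).2.2.1
      · have h4 := ih.u_mobile _ _ _ (h.u_of_sendII h1)
        exact ⟨h0, fun _ => h4.2, fun hl => absurd h4.1 hl⟩
    · intro m l a hne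
      rcases h.contents_u_inr_cases hne with h1 | h1
      · exact ih.u_mobile _ _ _ h1
      · have hl := h.sendII_none_gateway h1
        exact ⟨hl, (ih.u_gateway _ _ _ (h.u_of_sendII h1) (h.pos_gateway _ _)).2.1 hl⟩
    · intro g l a hne
      rcases h.contents_w_cases hne with h1 | ⟨-, -, n, h1⟩ | ⟨-, -, ⟨n, h1⟩ | ⟨m, h2, h1⟩⟩
      · exact ih.w_valid _ _ _ h1
      · exact (ih.q_valid _ _ _ _ (h.q_of_sendI h1) (by simp)).step
          (N.link_cl _ _ (h.link_of_sendI h1).1)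
      · exact (ih.q_valid _ _ _ _ (h.q_of_sendI h1) (by simp)).step
          (N.link_cl _ _ (h.link_of_sendI h1).1)
      · refine (ih.u_valid _ _ _ (h.u_of_sendII h1)).step ?_
        rw [← h2]
        exact hpos m
    · intro g l a hne hl
      -- Final destinations are internal, so packets that have reached their destination gateway
      -- never enter a queue kept for a gateway.
      have hx : x a.1 a.2.1 ≠ 0 → a.2.1 ≠ l := fun hx hal => (h.traffic.2 _ _ hx).2.2 (hal ▸ hl)
      rcases h.contents_w_cases hne with h1 | ⟨-, h0, n, h1⟩ | ⟨-, h0, ⟨n, h1⟩ | ⟨m, h2, h1⟩⟩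
      · exact ih.w_header _ _ _ h1 hl
      · exact h0
      · exact absurd h0 (hx (ih.q_valid _ _ _ _ (h.q_of_sendI h1) (by simp)).1)
      · exact absurd h0 (hx (ih.u_valid _ _ _ (h.u_of_sendII h1)).1)

/-- Only the queues prescribed by the algorithm are ever used. -/
theorem uLen_eq_zero (t n l) (hn : ¬ N.Used n l) : e.uLen t n l = 0 := by
  refine Finset.sum_eq_zero fun a _ => ?_
  by_contra hne
  have hc := h.contents t
  refine hn ?_
  rcases n with n | m
  · by_cases hg : N.IsGateway n
    · obtain ⟨-, h2, h3⟩ := hc.u_gateway _ _ _ hne hg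
      by_cases hl : N.IsGateway l
      · refine .inr ⟨hl, ?_, fun a ha => by cases ha; exact hg⟩
        rw [← h2 hl]
        exact (hc.u_valid _ _ _ hne).2.2.2.2
      · exact .inl ⟨n, rfl, h3 hl, by simp [hg, hl]⟩
    · obtain ⟨h1, h2⟩ := hc.u_internal _ _ _ hne hg
      exact .inl ⟨n, rfl, h2, by simp [hg, h1]⟩
  · obtain ⟨h1, h2⟩ := hc.u_mobile _ _ _ hne
    refine .inr ⟨h1, ?_, fun a ha => by cases ha⟩
    rw [← h2]
    exact (hc.u_valid _ _ _ hne).2.2.2.2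

theorem qLen_eq_zero (t n b) (hn : N.cl n ≠ N.cl b) : e.qLen t n b = 0 := by
  refine Finset.sum_eq_zero fun a _ => ?_
  by_contra hne
  exact hn ((h.contents t).q_cl _ _ _ hne)

theorem q_self (t n a) : e.q t n n a = 0 := by
  cases t with
  | zero => exact h.q_zero _ _ _
  | succ t => rw [h.q_succ, if_pos rfl]

theorem qLen_self (t n) : e.qLen t n n = 0 := Finset.sum_eq_zero fun a _ => h.q_self t n a

theorem uLen_self (t n) : e.uLen t (.inl n) n = 0 := by
  refine Finset.sum_eq_zero fun a _ => ?_
  by_contra hne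
  by_cases hn : N.IsGateway n
  · exact ((h.contents t).u_gateway _ _ _ hne hn).1 rfl
  · exact hn ((h.contents t).u_internal _ _ _ hne hn).1

end Run

/-! ### Evolution of queue lengths, with relayed packets counted in transit -/

theorem sum_leg (f : Leg → ℝ) : ∑ k, f k = f .intra + f .uplink + f .relay + f .downlink := by
  rw [show (Finset.univ : Finset Leg) = {.intra, .uplink, .relay, .downlink} from rfl]
  simp [add_assoc]

namespace Execution

/-- Amount sent in slot `t` from type-I queue `(n,b)` to `n'`. -/
def outI (e : Execution ι V J) (t : ℕ) (n b n' : V) : ℝ := ∑ a, e.sendI t n b n' a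

/-- Amount given in slot `t` by type-II queue `(n,l)` to channel `c`. -/
def outII (e : Execution ι V J) (t : ℕ) (n : V ⊕ J) (l : V) (c : Option V) : ℝ :=
  ∑ a, e.sendII t n l c a

/-- Amount released in slot `t` to the regulated queue `(g,l)`. -/
def rel (e : Execution ι V J) (t : ℕ) (g l : V) : ℝ := ∑ a, e.release t g l a

/-- Relayed packets on their way, in type-I queues, to the type-II queue `(b,l)`. -/
noncomputable def transit (e : Execution ι V J) (t : ℕ) (b l : V) : ℝ :=
  if l = b then 0 else ∑ n, ∑ a : Header V, if a.2.2 = l then e.q t n b (.relay, a) else 0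

/-- Type-II queue including the packets that are being relayed to it. -/
noncomputable def vLen (e : Execution ι V J) (t : ℕ) (n : V ⊕ J) (l : V) : ℝ :=
  e.uLen t n l + Sum.elim (fun b => e.transit t b l) (fun _ => 0) n

end Execution

namespace Run

variable [Fintype J] {N : Network ι V J} {x : V → V → ℝ} {T : ℕ} {R η δ : ℝ} {pos : N.Path}
  {e : Execution ι V J} (h : Run N x T R η δ pos e)
include h

/-- Summed over all nodes, the link transfers cancel except those into `b`, where the packets leave
the type-I layer. -/
theorem sum_q_succ (t b a) : ∑ n, e.q (t + 1) n b a =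
    ∑ n, e.q t n b a - ∑ n, e.sendI t n b b a + ∑ n, N.injectI x e t n b a
      - N.injectI x e t b b a := by
  have hs : ∀ n', e.sendI t b b n' a = 0 := fun n' => by
    by_contra h'
    exact h.q_of_sendI h' (h.q_self t b a)
  -- The subtracted term is what the reset of the queue `(b,b)` discards.
  have h1 : ∀ n, e.q (t + 1) n b a =
      (e.q t n b a - ∑ n', e.sendI t n b n' a + ∑ n', e.sendI t n' b n a + N.injectI x e t n b a)
        - if n = b then ∑ n', e.sendI t n' b b a + N.injectI x e t b b a else 0 := by
    intro n
    rw [h.q_succ]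
    split_ifs with hn
    · subst hn
      simp [h.q_self, hs]
    · rw [sub_zero]
  rw [Finset.sum_congr rfl fun n _ => h1 n]
  simp only [Finset.sum_sub_distrib, Finset.sum_add_distrib, Finset.sum_ite_eq', Finset.mem_univ,
    if_true]
  rw [Finset.sum_comm (f := fun n n' => e.sendI t n b n' a)]
  ring

theorem sendII_self (t n l a) : e.sendII t (.inl n) l (some n) a = 0 := by
  by_contra hne
  have h1 := (h.sendII_some hne).2
  rcases h1 with h1 | ⟨rfl, h1⟩
  · exact h1.2.2.2.1 rfl
  · by_cases hn : N.IsGateway n <;> simp [hn] at h1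

theorem injectI_self (t b k a) (hk : k = .uplink ∨ k = .relay) :
    N.injectI x e t b b (k, a) = 0 := by
  by_contra hne
  rcases h.injectI_cases hne with ⟨rfl, -⟩ | ⟨-, -, h2⟩ | ⟨-, -, -, l, h2⟩ | ⟨rfl, -⟩
  · simp at hk
  · exact h2 (h.sendII_self _ _ _ _)
  · exact h2 (h.sendII_self _ _ _ _)
  · simp at hk

theorem sum_injectI (t n b) : ∑ a, N.injectI x e t n b a =
    (if N.cl n = N.cl b then x n b else 0) + ∑ l, e.outII t (.inl n) l (some b) := by
  rw [Fintype.sum_prod_type, sum_leg]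
  simp only [Network.injectI]
  have h1 : ∑ a : Header V, (if N.cl n = N.cl b ∧ a = (n, b, b) then x n b else 0)
      = if N.cl n = N.cl b then x n b else 0 := by
    split_ifs with hc
    · simp [hc]
    · simp [hc]
  rw [h1, add_assoc, add_assoc]
  congr 1
  unfold Execution.outII
  by_cases hn : N.IsGateway n
  · by_cases hb : N.IsGateway b
    · simp only [hn, hb, not_true, if_false, and_self, if_true, and_false, Finset.sum_const_zero,
        zero_add, add_zero]
      exact Finset.sum_comm
    · simp only [hn, hb, not_true, not_false_eq_true, if_false, and_self, if_true, and_false, Finset.sum_const_zero,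
        zero_add]
      rw [Finset.sum_eq_single b]
      · intro l _ hl
        refine Finset.sum_eq_zero fun a _ => ?_
        by_contra hne
        rcases (h.sendII_some hne).2 with h2 | h2
        · exact hb h2.2.2.1
        · exact hl h2.1.symm
      · simp
  · simp only [hn, not_false_eq_true, if_true, false_and, if_false, Finset.sum_const_zero, add_zero]
    rw [Finset.sum_eq_single b]
    · intro l _ hl
      refine Finset.sum_eq_zero fun a _ => ?_
      by_contra hne
      rcases (h.sendII_some hne).2 with h2 | h2
      · exact hn h2.1
      · exact hl h2.1.symm
    · simp

theorem qLen_succ (t n b) (hnb : n ≠ b) : e.qLen (t + 1) n b = e.qLen t n b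
    - ∑ n', e.outI t n b n' + ∑ n', e.outI t n' b n
    + (if N.cl n = N.cl b then x n b else 0) + ∑ l, e.outII t (.inl n) l (some b) := by
  rw [add_assoc, ← h.sum_injectI]
  unfold Execution.qLen Execution.outI
  rw [Finset.sum_comm (f := fun n' a => e.sendI t n b n' a),
    Finset.sum_comm (f := fun n' a => e.sendI t n' b n a), ← Finset.sum_sub_distrib,
    ← Finset.sum_add_distrib, ← Finset.sum_add_distrib]
  exact Finset.sum_congr rfl fun a _ => by rw [h.q_succ, if_neg hnb]

/-- Packets that gateway `n` hands over to be relayed to the type-II queue `(b,l)`. -/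
noncomputable def _root_.ICN.Network.relayIn (N : Network ι V J) (e : Execution ι V J) (t : ℕ)
    (n b l : V) : ℝ :=
  if N.IsGateway n ∧ N.IsGateway b ∧ N.IsGateway l then e.outII t (.inl n) l (some b) else 0

/-- At a gateway, the type-II queue kept for a gateway holds only headers with that destination
gateway, so the header of an injected packet reveals the queue it came from. -/
theorem sum_injectI_relay (t n b l) :
    (∑ a : Header V, if a.2.2 = l then N.injectI x e t n b (.relay, a) else 0)
      = N.relayIn e t n b l := by
  unfold Network.relayIn Execution.outII
  simp only [Network.injectI]
  by_cases hnb : N.IsGateway n ∧ N.IsGateway b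
  swap
  · rw [if_neg (fun h' => hnb ⟨h'.1, h'.2.1⟩)]
    simp [hnb]
  simp only [hnb, and_self, true_and, if_true]
  have hz : ∀ l' (a : Header V), e.sendII t (.inl n) l' (some b) a ≠ 0 →
      N.IsGateway l' ∧ a.2.2 = l' := by
    intro l' a hne
    have hl' : N.IsGateway l' := by
      rcases (h.sendII_some hne).2 with h2 | ⟨rfl, h2⟩
      · exact h2.2.1
      · exact hnb.2
    exact ⟨hl', ((h.contents t).u_gateway _ _ _ (h.u_of_sendII hne) hnb.1).2.1 hl'⟩
  have h1 : ∀ a : Header V, (if a.2.2 = l then ∑ l', e.sendII t (.inl n) l' (some b) a else 0)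
      = e.sendII t (.inl n) l (some b) a := by
    intro a
    split_ifs with hal
    · rw [Finset.sum_eq_single l]
      · intro l' _ hl'
        by_contra hne
        exact hl' ((hz _ _ hne).2.symm.trans hal)
      · simp
    · by_contra hne
      exact hal (hz _ _ (Ne.symm hne)).2
  rw [Finset.sum_congr rfl fun a _ => h1 a]
  split_ifs with hl
  · rfl
  · refine Finset.sum_eq_zero fun a _ => ?_
    by_contra hne
    exact hl (hz _ _ hne).1

theorem transit_succ (t b l) (hlb : l ≠ b) : e.transit (t + 1) b l = e.transit t b l
    + ∑ n, N.relayIn e t n b l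
    - ∑ a : Header V, if a.2.2 = l then Network.fromGateway e t b a else 0 := by
  have hz : ∀ a : Header V, N.injectI x e t b b (.relay, a) = 0 := fun a =>
    h.injectI_self t b .relay a (.inr rfl)
  unfold Execution.transit
  simp only [if_neg hlb]
  rw [Finset.sum_comm, Finset.sum_comm (f := fun n a => if a.2.2 = l then e.q t n b (.relay, a) else 0),
    Finset.sum_congr rfl fun n _ => (h.sum_injectI_relay t n b l).symm,
    Finset.sum_comm (f := fun n (a : Header V) => if a.2.2 = l then N.injectI x e t n b (.relay, a) else 0),
    ← Finset.sum_add_distrib, ← Finset.sum_sub_distrib]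
  refine Finset.sum_congr rfl fun a _ => ?_
  split_ifs
  · rw [h.sum_q_succ, hz]
    unfold Network.fromGateway
    ring
  · simp

theorem uLen_succ_inl (t n l) (hl : l ≠ n) : e.uLen (t + 1) (.inl n) l = e.uLen t (.inl n) l
    - ∑ c, e.outII t (.inl n) l c + ∑ a, N.newInter x T e t n l a + e.rel t n l
    + (∑ a : Header V, if a.2.2 = l then Network.fromGateway e t n a else 0)
    + ∑ m, if (pos (t / T) m).1 = n then e.outII t (.inr m) l none else 0 := by
  have h1 : (∑ m, if (pos (t / T) m).1 = n then e.outII t (.inr m) l none else 0)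
      = ∑ a, N.fromMobile T pos e t n l a := by
    unfold Network.fromMobile Execution.outII
    rw [Finset.sum_comm]
    refine Finset.sum_congr rfl fun m _ => ?_
    split_ifs
    · rfl
    · simp
  rw [h1]
  unfold Execution.uLen Execution.outII Execution.rel
  rw [Finset.sum_comm (f := fun c a => e.sendII t (.inl n) l c a), ← Finset.sum_sub_distrib,
    ← Finset.sum_add_distrib, ← Finset.sum_add_distrib, ← Finset.sum_add_distrib,
    ← Finset.sum_add_distrib]
  refine Finset.sum_congr rfl fun a _ => ?_
  rw [h.u_succ_inl, if_neg hl]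
  ring

/-- The arrival of a relayed packet moves it from `transit` to the type-II queue and cancels. Hence
`vLen` grows already when another gateway hands the packet over, in the slot in which that gateway's
own queue shrinks. -/
theorem vLen_succ_inl (t n l) (hl : l ≠ n) : e.vLen (t + 1) (.inl n) l = e.vLen t (.inl n) l
    - ∑ c, e.outII t (.inl n) l c + ∑ a, N.newInter x T e t n l a + e.rel t n l
    + ∑ n', N.relayIn e t n' n l
    + ∑ m, if (pos (t / T) m).1 = n then e.outII t (.inr m) l none else 0 := by
  unfold Execution.vLen
  simp only [Sum.elim_inl]
  rw [h.uLen_succ_inl t n l hl, h.transit_succ t n l hl]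
  ring

theorem outII_inr_some (t m l b) : e.outII t (.inr m) l (some b) = 0 :=
  Finset.sum_eq_zero fun _ _ => h.sendII_inr_some

theorem uLen_succ_inr (t m l) : e.uLen (t + 1) (.inr m) l = e.uLen t (.inr m) l
    - e.outII t (.inr m) l none + e.outII t (.inl (pos (t / T) m).1) l none := by
  have h0 := h.outII_inr_some t m l
  unfold Execution.outII at h0
  unfold Execution.uLen Execution.outII
  rw [← Finset.sum_sub_distrib, ← Finset.sum_add_distrib]
  refine Finset.sum_congr rfl fun a _ => ?_
  rw [h.u_succ_inr, Fintype.sum_option]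
  simp [h.sendII_inr_some]

theorem vLen_succ_inr (t m l) : e.vLen (t + 1) (.inr m) l = e.vLen t (.inr m) l
    - e.outII t (.inr m) l none + e.outII t (.inl (pos (t / T) m).1) l none := by
  unfold Execution.vLen
  simp only [Sum.elim_inr, add_zero]
  exact h.uLen_succ_inr t m l

theorem vLen_self (t n) : e.vLen t (.inl n) n = 0 := by
  unfold Execution.vLen Execution.transit
  simp [h.uLen_self]

theorem transit_nonneg (t b l) : 0 ≤ e.transit t b l := by
  unfold Execution.transit
  split_ifs
  · exact le_rfl
  · refine Finset.sum_nonneg fun n _ => Finset.sum_nonneg fun a _ => ?_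
    split_ifs
    · exact h.q_nonneg _ _ _ _
    · exact le_rfl

theorem uLen_le_vLen (t n l) : e.uLen t n l ≤ e.vLen t n l := by
  unfold Execution.vLen
  rcases n with n | m
  · simpa using h.transit_nonneg t n l
  · simp

theorem sum_transit_le (t) : ∑ b, ∑ l, e.transit t b l ≤ ∑ n, ∑ b, e.qLen t n b := by
  rw [Finset.sum_comm (f := fun n b => e.qLen t n b)]
  refine Finset.sum_le_sum fun b _ => ?_
  have h1 : ∀ l, e.transit t b l ≤
      ∑ n, ∑ a : Header V, if a.2.2 = l then e.q t n b (.relay, a) else 0 := by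
    intro l
    unfold Execution.transit
    split_ifs
    · refine Finset.sum_nonneg fun n _ => Finset.sum_nonneg fun a _ => ?_
      split_ifs
      · exact h.q_nonneg _ _ _ _
      · exact le_rfl
    · exact le_rfl
  refine (Finset.sum_le_sum fun l _ => h1 l).trans ?_
  rw [Finset.sum_comm]
  refine Finset.sum_le_sum fun n _ => ?_
  rw [Finset.sum_comm]
  simp only [Finset.sum_ite_eq, Finset.mem_univ, if_true]
  unfold Execution.qLen
  rw [Fintype.sum_prod_type (fun a : Leg × Header V => e.q t n b a), sum_leg]
  have h2 : ∀ k, 0 ≤ ∑ a, e.q t n b (k, a) := fun k => Finset.sum_nonneg fun a _ => h.q_nonneg _ _ _ _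
  have := h2 .intra
  have := h2 .uplink
  have := h2 .downlink
  linarith

/-! ### Rates of change -/

theorem outI_nonneg (t n b n') : 0 ≤ e.outI t n b n' :=
  Finset.sum_nonneg fun a _ => (h.servesI t n b).nonneg n' a

theorem outII_nonneg (t n l c) : 0 ≤ e.outII t n l c :=
  Finset.sum_nonneg fun a _ => (h.servesII t n l).nonneg c a

theorem rel_nonneg (t g l) : 0 ≤ e.rel t g l :=
  Finset.sum_nonneg fun a _ => (h.servesW t g l).nonneg () a

theorem outI_le_demandI (t n b n') : e.outI t n b n' ≤ N.demandI e t n b n' :=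
  (h.servesI t n b).sum_le_demand n'

theorem outII_le_demandII (t n l c) : e.outII t n l c ≤ N.demandII T R η pos e t n l c :=
  (h.servesII t n l).sum_le_demand c

theorem sched_nonneg (t i a b) : 0 ≤ e.sched t i a b := N.gam_nonneg (h.intra.2 t i).1 a b

theorem sum_sched_le (t i a) : ∑ b, e.sched t i a b ≤ η := (h.rates.2 i _ (h.intra.2 t i).1 a).le

theorem sched_le (t i a b) : e.sched t i a b ≤ η :=
  (Finset.single_le_sum (f := fun b => e.sched t i a b) (fun b _ => h.sched_nonneg t i a b)
    (Finset.mem_univ b)).trans (h.sum_sched_le t i a)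

theorem demandI_le (t n b n') : N.demandI e t n b n' ≤ e.sched t (N.cl n) n n' := by
  unfold Network.demandI
  split_ifs
  · exact le_rfl
  · exact h.sched_nonneg _ _ _ _

theorem outI_le (t n b n') : e.outI t n b n' ≤ η :=
  (h.outI_le_demandI t n b n').trans ((h.demandI_le t n b n').trans (h.sched_le _ _ _ _))

theorem demandII_some_le (t n l b) : N.demandII T R η pos e t (.inl n) l (some b) ≤ η := by
  unfold Network.demandII
  have := h.η_pos.le
  simp only
  split_ifs <;> first | exact le_rfl | exact this

theorem outII_some_le (t n l b) : e.outII t n l (some b) ≤ η := by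
  rcases n with n | m
  · exact (h.outII_le_demandII _ _ _ _).trans (h.demandII_some_le t n l b)
  · rw [h.outII_inr_some]
    exact h.η_pos.le

theorem demandII_none_le (t n l) :
    N.demandII T R η pos e t n l none ≤ if T ∣ t then R else 0 := by
  unfold Network.demandII
  have := h.R_nonneg
  rcases n with n | m
  · simp only
    split_ifs with h1 h2 h2
    · exact le_rfl
    · exact absurd h1.1 h2
    · exact this
    · exact le_rfl
  · simp only
    split_ifs with h1 h2 h2
    · exact le_rfl
    · exact absurd h1.1 h2
    · exact this
    · exact le_rfl

theorem outII_none_le (t n l) : e.outII t n l none ≤ if T ∣ t then R else 0 :=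
  (h.outII_le_demandII _ _ _ _).trans (h.demandII_none_le t n l)

theorem x_le_sum (s d) : x s d ≤ ∑ s, ∑ d, x s d :=
  (Finset.single_le_sum (f := fun d => x s d) (fun d _ => h.traffic.1 s d) (Finset.mem_univ d)).trans
    (Finset.single_le_sum (f := fun s => ∑ d, x s d)
      (fun s _ => Finset.sum_nonneg fun d _ => h.traffic.1 s d) (Finset.mem_univ s))

theorem sum_x_nonneg : 0 ≤ ∑ s, ∑ d, x s d :=
  Finset.sum_nonneg fun s _ => Finset.sum_nonneg fun d _ => h.traffic.1 s d

theorem newInter_nonneg (t n l a) : 0 ≤ N.newInter x T e t n l a := by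
  unfold Network.newInter
  split_ifs
  · exact h.traffic.1 _ _
  · exact le_rfl

theorem sum_newInter (t n l) : ∑ a, N.newInter x T e t n l a
    = ∑ d, if N.cl n ≠ N.cl d ∧ e.srcGate (t / T) n d = l then x n d else 0 := by
  rw [Fintype.sum_prod_type, Finset.sum_eq_single n]
  · rw [Fintype.sum_prod_type]
    refine Finset.sum_congr rfl fun d _ => ?_
    rw [Finset.sum_eq_single (e.dstGate (t / T) n d)]
    · simp only [Network.newInter, true_and, and_true]
    · intro b _ hb
      simp only [Network.newInter]
      exact if_neg fun h' => hb h'.2.2.2.symm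
    · simp
  · intro s _ hs
    refine Finset.sum_eq_zero fun a _ => ?_
    simp only [Network.newInter]
    exact if_neg fun h' => hs h'.1
  · simp

theorem sum_newInter_le (t n l) : ∑ a, N.newInter x T e t n l a ≤ ∑ s, ∑ d, x s d := by
  rw [h.sum_newInter]
  refine le_trans (Finset.sum_le_sum fun d _ => ?_) (Finset.single_le_sum (f := fun s => ∑ d, x s d)
      (fun s _ => Finset.sum_nonneg fun d _ => h.traffic.1 s d) (Finset.mem_univ n))
  split_ifs
  · exact le_rfl
  · exact h.traffic.1 _ _

theorem regulated_le (t g l) : N.regulated x T δ e t g l ≤ (1 + δ) * ∑ s, ∑ d, x s d := by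
  unfold Network.regulated
  refine mul_le_mul_of_nonneg_left ?_ (by linarith [h.δ_nonneg])
  split_ifs
  · refine Finset.sum_le_sum fun s _ => Finset.sum_le_sum fun d _ => ?_
    split_ifs
    · exact le_rfl
    · exact h.traffic.1 _ _
  · refine Finset.sum_le_sum fun s _ => ?_
    split_ifs
    · exact (Finset.single_le_sum (f := fun d => x s d) (fun d _ => h.traffic.1 s d)
        (Finset.mem_univ l))
    · exact Finset.sum_nonneg fun d _ => h.traffic.1 s d

theorem rel_le_regulated (t g l) : e.rel t g l ≤ N.regulated x T δ e t g l :=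
  (h.servesW t g l).sum_le_demand ()

theorem rel_le (t g l) : e.rel t g l ≤ (1 + δ) * ∑ s, ∑ d, x s d :=
  (h.rel_le_regulated t g l).trans (h.regulated_le t g l)

theorem relayIn_nonneg (t n b l) : 0 ≤ N.relayIn e t n b l := by
  unfold Network.relayIn
  split_ifs
  · exact h.outII_nonneg _ _ _ _
  · exact le_rfl

theorem relayIn_le (t n b l) : N.relayIn e t n b l ≤ η := by
  unfold Network.relayIn
  split_ifs
  · exact h.outII_some_le _ _ _ _
  · exact h.η_pos.le

omit h [Fintype J] in
theorem sum_le_card_mul {κ : Type*} [Fintype κ] (f : κ → ℝ) (c : ℝ) (hf : ∀ i, f i ≤ c) :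
    ∑ i, f i ≤ Fintype.card κ * c := by
  refine (Finset.sum_le_card_nsmul _ _ _ fun i _ => hf i).trans ?_
  simp

/-- Bound for the change of a queue in slot `t`. -/
noncomputable def _root_.ICN.stepBound (x : V → V → ℝ) (T : ℕ) (R η δ : ℝ) (t : ℕ) : ℝ :=
  ((2 + δ) * ∑ s, ∑ d, x s d + 2 * (Fintype.card V * η))
    + (Fintype.card J + 1) * if T ∣ t then R else 0

theorem ite_R_nonneg (t : ℕ) : 0 ≤ if T ∣ t then R else 0 := by
  split_ifs
  · exact h.R_nonneg
  · exact le_rfl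

theorem abs_qLen_succ_sub (t n b) :
    |e.qLen (t + 1) n b - e.qLen t n b| ≤ stepBound (J := J) x T R η δ t := by
  have hR := h.ite_R_nonneg t
  have hx := h.sum_x_nonneg
  have hη := h.η_pos
  have hδ := h.δ_nonneg
  have hJ : (0 : ℝ) ≤ Fintype.card J := Nat.cast_nonneg _
  have hV : (0 : ℝ) ≤ Fintype.card V * η := mul_nonneg (Nat.cast_nonneg _) hη.le
  have hb := mul_nonneg hδ hx
  have hc := mul_nonneg hJ hR
  unfold stepBound
  by_cases hnb : n = b
  · subst hnb
    rw [h.qLen_self, h.qLen_self, sub_zero, abs_zero]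
    linarith
  rw [h.qLen_succ t n b hnb]
  have e1 := sum_le_card_mul (fun n' => e.outI t n b n') η fun n' => h.outI_le _ _ _ _
  have e2 := sum_le_card_mul (fun n' => e.outI t n' b n) η fun n' => h.outI_le _ _ _ _
  have e3 := sum_le_card_mul (fun l => e.outII t (.inl n) l (some b)) η fun n' =>
    h.outII_some_le _ _ _ _
  have f1 : 0 ≤ ∑ n', e.outI t n b n' := Finset.sum_nonneg fun _ _ => h.outI_nonneg _ _ _ _
  have f2 : 0 ≤ ∑ n', e.outI t n' b n := Finset.sum_nonneg fun _ _ => h.outI_nonneg _ _ _ _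
  have f3 : 0 ≤ ∑ l, e.outII t (.inl n) l (some b) :=
    Finset.sum_nonneg fun _ _ => h.outII_nonneg _ _ _ _
  have f4 : 0 ≤ (if N.cl n = N.cl b then x n b else 0) := by
    split_ifs
    · exact h.traffic.1 _ _
    · exact le_rfl
  have e4 : (if N.cl n = N.cl b then x n b else 0) ≤ ∑ s, ∑ d, x s d := by
    split_ifs
    · exact h.x_le_sum _ _
    · exact hx
  rw [abs_le]
  constructor <;> linarith

/-- `A` stands for the arrivals of relayed packets in the case of `uLen`, and for the hand-overs by
other gateways in the case of `vLen`. -/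
theorem abs_add_bounds {t n l} {A : ℝ} (hA0 : 0 ≤ A) (hA : A ≤ Fintype.card V * η) :
    |-∑ c, e.outII t (.inl n) l c + ∑ a, N.newInter x T e t n l a + e.rel t n l + A
      + ∑ m, if (pos (t / T) m).1 = n then e.outII t (.inr m) l none else 0|
      ≤ stepBound (J := J) x T R η δ t := by
  have hR := h.ite_R_nonneg t
  have hx := h.sum_x_nonneg
  have hδ := h.δ_nonneg
  have hJ : (0 : ℝ) ≤ Fintype.card J := Nat.cast_nonneg _
  have hV : (0 : ℝ) ≤ Fintype.card V * η := mul_nonneg (Nat.cast_nonneg _) h.η_pos.le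
  have hb := mul_nonneg hδ hx
  have hc := mul_nonneg hJ hR
  have e1 := sum_le_card_mul (fun b => e.outII t (.inl n) l (some b)) η fun n' =>
    h.outII_some_le _ _ _ _
  have e2 := h.outII_none_le t (.inl n) l
  have e3 := sum_le_card_mul (fun m => if (pos (t / T) m).1 = n then e.outII t (.inr m) l none else 0)
    (if T ∣ t then R else 0) fun m => by
      split_ifs
      · exact (h.outII_none_le _ _ _).trans (by simp [*])
      · exact (h.outII_none_le _ _ _).trans (by simp [*])
      · exact h.R_nonneg
      · exact le_rfl
  have e4 := h.sum_newInter_le t n l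
  have e5 := h.rel_le t n l
  have f1 : 0 ≤ ∑ b, e.outII t (.inl n) l (some b) :=
    Finset.sum_nonneg fun _ _ => h.outII_nonneg _ _ _ _
  have f2 := h.outII_nonneg t (.inl n) l none
  have f3 : 0 ≤ ∑ m, if (pos (t / T) m).1 = n then e.outII t (.inr m) l none else 0 := by
    refine Finset.sum_nonneg fun m _ => ?_
    split_ifs
    · exact h.outII_nonneg _ _ _ _
    · exact le_rfl
  have f4 : 0 ≤ ∑ a, N.newInter x T e t n l a :=
    Finset.sum_nonneg fun _ _ => h.newInter_nonneg _ _ _ _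
  have f5 := h.rel_nonneg t n l
  rw [Fintype.sum_option]
  unfold stepBound
  rw [abs_le]
  constructor <;> linarith

theorem abs_inr_bounds (t m l) :
    |- e.outII t (.inr m) l none + e.outII t (.inl (pos (t / T) m).1) l none|
      ≤ stepBound (J := J) x T R η δ t := by
  have hR := h.ite_R_nonneg t
  have hx := h.sum_x_nonneg
  have hJ : (0 : ℝ) ≤ Fintype.card J := Nat.cast_nonneg _
  have hV : (0 : ℝ) ≤ Fintype.card V * η := mul_nonneg (Nat.cast_nonneg _) h.η_pos.le
  have hb := mul_nonneg h.δ_nonneg hx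
  have hc := mul_nonneg hJ hR
  have e1 := h.outII_none_le t (.inr m) l
  have e2 := h.outII_none_le t (.inl (pos (t / T) m).1) l
  have f1 := h.outII_nonneg t (.inr m) l none
  have f2 := h.outII_nonneg t (.inl (pos (t / T) m).1) l none
  unfold stepBound
  rw [abs_le]
  constructor <;> linarith

theorem sum_fromGateway_le (t n l) :
    (∑ a : Header V, if a.2.2 = l then Network.fromGateway e t n a else 0)
      ≤ Fintype.card V * η := by
  have h1 : ∀ a : Header V, (if a.2.2 = l then Network.fromGateway e t n a else 0)
      ≤ Network.fromGateway e t n a := fun a => by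
    have : 0 ≤ Network.fromGateway e t n a := Finset.sum_nonneg fun _ _ => (h.servesI _ _ _).nonneg _ _
    split_ifs
    · exact le_rfl
    · exact this
  refine (Finset.sum_le_sum fun a _ => h1 a).trans ?_
  unfold Network.fromGateway
  rw [Finset.sum_comm]
  refine sum_le_card_mul _ _ fun n' => le_trans ?_ (h.outI_le t n' n n)
  unfold Execution.outI
  rw [Fintype.sum_prod_type (fun a : Leg × Header V => e.sendI t n' n n a)]
  exact Finset.single_le_sum (f := fun k => ∑ a, e.sendI t n' n n (k, a))
    (fun k _ => Finset.sum_nonneg fun a _ => (h.servesI _ _ _).nonneg _ _) (Finset.mem_univ Leg.relay)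

theorem abs_uLen_succ_sub (t n l) :
    |e.uLen (t + 1) n l - e.uLen t n l| ≤ stepBound (J := J) x T R η δ t := by
  have hs := h.abs_inr_bounds t
  rcases n with n | m
  · by_cases hl : l = n
    · subst hl
      rw [h.uLen_self, h.uLen_self, sub_zero, abs_zero]
      simpa [h.qLen_self] using h.abs_qLen_succ_sub t l l
    · rw [h.uLen_succ_inl t n l hl]
      convert h.abs_add_bounds (t := t) (n := n) (l := l) (A := _) ?_ (h.sum_fromGateway_le t n l) using 2
      · ring
      · refine Finset.sum_nonneg fun a _ => ?_
        split_ifs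
        · exact Finset.sum_nonneg fun _ _ => (h.servesI _ _ _).nonneg _ _
        · exact le_rfl
  · rw [h.uLen_succ_inr]
    convert hs m l using 2
    ring

theorem abs_vLen_succ_sub (t n l) :
    |e.vLen (t + 1) n l - e.vLen t n l| ≤ stepBound (J := J) x T R η δ t := by
  have hs := h.abs_inr_bounds t
  rcases n with n | m
  · by_cases hl : l = n
    · subst hl
      rw [h.vLen_self, h.vLen_self, sub_zero, abs_zero]
      simpa [h.qLen_self] using h.abs_qLen_succ_sub t l l
    · rw [h.vLen_succ_inl t n l hl]
      convert h.abs_add_bounds (t := t) (n := n) (l := l) (A := ∑ n', N.relayIn e t n' n l)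
        (Finset.sum_nonneg fun _ _ => h.relayIn_nonneg _ _ _ _)
        (sum_le_card_mul _ _ fun n' => h.relayIn_le _ _ _ _) using 2
      ring
  · rw [h.vLen_succ_inr]
    convert hs m l using 2
    ring

end Run

/-! ### Scaled backlogs, weighted work and the drift identity -/

namespace Network

/-- The scale `K_n` between type-II and type-I queues at `n`. -/
noncomputable def scale (N : Network ι V J) (T : ℕ) (n : V) : ℝ := (T : ℝ) / N.clusterSize n

variable (N : Network ι V J) {T : ℕ}

theorem clusterSize_pos (n : V) : 0 < N.clusterSize n :=
  Finset.card_pos.2 ⟨n, by simp⟩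

theorem scale_pos (hT : 0 < T) (n : V) : 0 < N.scale T n :=
  div_pos (Nat.cast_pos.2 hT) (Nat.cast_pos.2 (N.clusterSize_pos n))

theorem scale_congr {a b : V} (h : N.cl a = N.cl b) : N.scale T a = N.scale T b := by
  unfold scale clusterSize
  rw [h]

theorem scale_le (n : V) : N.scale T n ≤ T :=
  div_le_self (Nat.cast_nonneg _) (Nat.one_le_cast.2 (N.clusterSize_pos n))

theorem le_scale (n : V) : (T : ℝ) / Fintype.card V ≤ N.scale T n :=
  div_le_div_of_nonneg_left (Nat.cast_nonneg _) (Nat.cast_pos.2 (N.clusterSize_pos n))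
    (Nat.cast_le.2 (Finset.card_filter_le _ _))

theorem lt_theta_iff (hT : 0 < T) (n : V) (D c : ℝ) :
    c < N.theta T n D ↔ 0 < D - N.scale T n * c := by
  change c < D / N.scale T n ↔ _
  rw [lt_div_iff₀ (N.scale_pos hT n), sub_pos, mul_comm]

/-- Type-I backlog in units of the type-II backlog. -/
noncomputable def scaledQ (N : Network ι V J) (T : ℕ) (e : Execution ι V J) (t : ℕ) (n b : V) : ℝ :=
  N.scale T n * e.qLen t n b

/-- Weighted transfer, in slot `t`, from the type-II queues of `n` to the type-I queue `(n,b)`. -/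
noncomputable def injectWork (N : Network ι V J) (T : ℕ) (e : Execution ι V J) (t₀ t : ℕ) (n b : V) :
    ℝ :=
  ∑ l, e.outII t (.inl n) l (some b) * (e.uLen t₀ (.inl n) l
    - (if N.IsGateway n ∧ N.IsGateway b ∧ N.IsGateway l then e.uLen t₀ (.inl b) l else 0)
    - N.scaledQ T e t₀ n b)

/-- Weighted service, in slot `t`, of the link `(n,n')`. -/
noncomputable def linkWork (N : Network ι V J) (T : ℕ) (e : Execution ι V J) (t₀ t : ℕ) (n n' : V) :
    ℝ :=
  ∑ b, e.outI t n b n' * (N.scaledQ T e t₀ n b - N.scaledQ T e t₀ n' b)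

/-- Weighted exchange, in slot `t`, of the mobile `m`. -/
noncomputable def contactWork (N : Network ι V J) (T : ℕ) (pos : N.Path) (e : Execution ι V J)
    (t₀ t : ℕ) (m : J) : ℝ :=
  ∑ l, (e.outII t (.inl (pos (t / T) m).1) l none *
        Network.diffII e t₀ (.inl (pos (t / T) m).1) (.inr m) l
      + e.outII t (.inr m) l none * Network.diffII e t₀ (.inr m) (.inl (pos (t / T) m).1) l)

/-- Weighted arrivals in slot `t`. -/
noncomputable def arrivalWork (N : Network ι V J) (x : V → V → ℝ) (T : ℕ) (e : Execution ι V J)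
    (t₀ t : ℕ) : ℝ :=
  ∑ n, ∑ l, e.uLen t₀ (.inl n) l * (∑ a, N.newInter x T e t n l a + e.rel t n l)
    + ∑ n, ∑ b, N.scaledQ T e t₀ n b * (if N.cl n = N.cl b then x n b else 0)

end Network

namespace Run

variable [Fintype J] {N : Network ι V J} {x : V → V → ℝ} {T : ℕ} {R η δ : ℝ} {pos : N.Path}
  {e : Execution ι V J} (h : Run N x T R η δ pos e)
include h

theorem outII_inl_none (t n l) (hne : e.outII t (.inl n) l none ≠ 0) :
    T ∣ t ∧ ∃ m, (pos (t / T) m).1 = n ∧ e.pickIdx (t / T) m = l := by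
  obtain ⟨a, -, ha⟩ := Finset.exists_ne_zero_of_sum_ne_zero hne
  exact h.sendII_inl_none ha

omit h in
theorem pos_injective (pos : N.Path) (τ : ℕ) : Function.Injective fun m => (pos τ m).1 := by
  intro m m' hm
  have h1 := (pos τ m).2
  have h2 := (pos τ m').2
  simp only at hm
  rw [hm, h2] at h1
  exact (Option.some.inj h1).symm

omit h in
/-- A sum over nodes that only sees the gateways in contact with a mobile. -/
theorem sum_contacts (pos : N.Path) (τ : ℕ) (f : V → ℝ)
    (hf : ∀ n, f n ≠ 0 → ∃ m, (pos τ m).1 = n) : ∑ n, f n = ∑ m, f (pos τ m).1 := by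
  symm
  refine Finset.sum_of_injOn (fun m => (pos τ m).1) ((pos_injective pos τ).injOn) (by simp) ?_
    (fun _ _ => rfl)
  intro n _ hn
  by_contra hne
  obtain ⟨m, hm⟩ := hf n hne
  exact hn ⟨m, by simp, hm⟩

theorem drift_inl (t₀ t) : ∑ n, ∑ l, e.uLen t₀ (.inl n) l * (e.vLen (t + 1) (.inl n) l - e.vLen t (.inl n) l)
    = ∑ n, ∑ l, e.uLen t₀ (.inl n) l * (∑ a, N.newInter x T e t n l a + e.rel t n l)
      - ∑ n, ∑ l, ∑ b, e.uLen t₀ (.inl n) l * e.outII t (.inl n) l (some b)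
      + ∑ n, ∑ l, ∑ n', e.uLen t₀ (.inl n) l * N.relayIn e t n' n l
      - ∑ m, ∑ l, e.uLen t₀ (.inl (pos (t / T) m).1) l * e.outII t (.inl (pos (t / T) m).1) l none
      + ∑ m, ∑ l, e.uLen t₀ (.inl (pos (t / T) m).1) l * e.outII t (.inr m) l none := by
  have h1 : ∑ m, ∑ l, e.uLen t₀ (.inl (pos (t / T) m).1) l * e.outII t (.inl (pos (t / T) m).1) l none
      = ∑ n, ∑ l, e.uLen t₀ (.inl n) l * e.outII t (.inl n) l none := by
    refine (sum_contacts pos (t / T)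
      (fun n => ∑ l, e.uLen t₀ (.inl n) l * e.outII t (.inl n) l none) fun n hn => ?_).symm
    obtain ⟨l, -, hl⟩ := Finset.exists_ne_zero_of_sum_ne_zero hn
    obtain ⟨-, m, hm, -⟩ := h.outII_inl_none t n l (right_ne_zero_of_mul hl)
    exact ⟨m, hm⟩
  have h2 : ∑ m, ∑ l, e.uLen t₀ (.inl (pos (t / T) m).1) l * e.outII t (.inr m) l none
      = ∑ n, ∑ l, e.uLen t₀ (.inl n) l *
        ∑ m, if (pos (t / T) m).1 = n then e.outII t (.inr m) l none else 0 := by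
    simp only [Finset.mul_sum, mul_ite, mul_zero]
    rw [Finset.sum_comm (s := (Finset.univ : Finset J))]
    symm
    calc ∑ n, ∑ l, ∑ m, (if (pos (t / T) m).1 = n then e.uLen t₀ (.inl n) l * e.outII t (.inr m) l none else 0)
        = ∑ l, ∑ n, ∑ m, (if (pos (t / T) m).1 = n then e.uLen t₀ (.inl n) l * e.outII t (.inr m) l none else 0) :=
          Finset.sum_comm
      _ = ∑ l, ∑ m, ∑ n, (if (pos (t / T) m).1 = n then e.uLen t₀ (.inl n) l * e.outII t (.inr m) l none else 0) :=
          Finset.sum_congr rfl fun l _ => Finset.sum_comm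
      _ = _ := Finset.sum_congr rfl fun l _ => Finset.sum_congr rfl fun m _ => by simp
  rw [h1, h2]
  simp only [← Finset.sum_sub_distrib, ← Finset.sum_add_distrib, ← Finset.mul_sum]
  refine Finset.sum_congr rfl fun n _ => Finset.sum_congr rfl fun l _ => ?_
  by_cases hl : l = n
  · subst hl
    simp [h.uLen_self]
  · rw [h.vLen_succ_inl t n l hl, Fintype.sum_option]
    ring

theorem drift_inr (t₀ t) : ∑ m, ∑ l, e.uLen t₀ (.inr m) l * (e.vLen (t + 1) (.inr m) l - e.vLen t (.inr m) l)
    = ∑ m, ∑ l, e.uLen t₀ (.inr m) l * e.outII t (.inl (pos (t / T) m).1) l none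
      - ∑ m, ∑ l, e.uLen t₀ (.inr m) l * e.outII t (.inr m) l none := by
  simp only [← Finset.sum_sub_distrib]
  refine Finset.sum_congr rfl fun n _ => Finset.sum_congr rfl fun l _ => ?_
  rw [h.vLen_succ_inr]
  ring

theorem drift_q (t₀ t) : ∑ n, ∑ b, N.scaledQ T e t₀ n b * (e.qLen (t + 1) n b - e.qLen t n b)
    = ∑ n, ∑ b, N.scaledQ T e t₀ n b * (if N.cl n = N.cl b then x n b else 0)
      + ∑ n, ∑ b, ∑ l, N.scaledQ T e t₀ n b * e.outII t (.inl n) l (some b)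
      - ∑ n, ∑ n', N.linkWork T e t₀ t n n' := by
  have h1 : ∑ n, ∑ n', N.linkWork T e t₀ t n n'
      = ∑ n, ∑ b, N.scaledQ T e t₀ n b * (∑ n', e.outI t n b n' - ∑ n', e.outI t n' b n) := by
    unfold Network.linkWork
    simp only [mul_sub, Finset.sum_sub_distrib, Finset.mul_sum]
    congr 1
    · refine Finset.sum_congr rfl fun n _ => ?_
      rw [Finset.sum_comm]
      exact Finset.sum_congr rfl fun _ _ => Finset.sum_congr rfl fun _ _ => mul_comm _ _
    · rw [Finset.sum_comm]
      refine Finset.sum_congr rfl fun n _ => ?_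
      rw [Finset.sum_comm]
      exact Finset.sum_congr rfl fun _ _ => Finset.sum_congr rfl fun _ _ => mul_comm _ _
  rw [h1]
  simp only [← Finset.sum_sub_distrib, ← Finset.sum_add_distrib, ← Finset.mul_sum]
  refine Finset.sum_congr rfl fun n _ => Finset.sum_congr rfl fun b _ => ?_
  by_cases hb : n = b
  · subst hb
    simp [Network.scaledQ, h.qLen_self]
  · rw [h.qLen_succ t n b hb, Finset.sum_sub_distrib]
    ring

/-- Summation by parts: each transfer lowers one queue and raises another in the same slot, so
grouping by transfers instead of queues leaves differences of the frozen weights. For relays this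
requires `vLen`, since `uLen` would grow only on arrival. -/
theorem drift_eq (t₀ t) :
    ∑ n, ∑ l, e.uLen t₀ n l * (e.vLen (t + 1) n l - e.vLen t n l)
      + ∑ n, ∑ b, N.scaledQ T e t₀ n b * (e.qLen (t + 1) n b - e.qLen t n b)
    = N.arrivalWork x T e t₀ t
      - (∑ n, ∑ b, N.injectWork T e t₀ t n b + ∑ n, ∑ n', N.linkWork T e t₀ t n n')
      - ∑ m, N.contactWork T pos e t₀ t m := by
  rw [Fintype.sum_sum_type, h.drift_inl, h.drift_inr, h.drift_q]
  have h1 : ∑ n, ∑ b, N.injectWork T e t₀ t n b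
      = ∑ n, ∑ l, ∑ b, e.uLen t₀ (.inl n) l * e.outII t (.inl n) l (some b)
        - ∑ n, ∑ l, ∑ n', e.uLen t₀ (.inl n) l * N.relayIn e t n' n l
        - ∑ n, ∑ b, ∑ l, N.scaledQ T e t₀ n b * e.outII t (.inl n) l (some b) := by
    unfold Network.injectWork
    simp only [mul_sub, Finset.sum_sub_distrib]
    congr 1
    · congr 1
      · refine Finset.sum_congr rfl fun n _ => ?_
        rw [Finset.sum_comm]
        exact Finset.sum_congr rfl fun _ _ => Finset.sum_congr rfl fun _ _ => mul_comm _ _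
      · rw [Finset.sum_comm]
        refine Finset.sum_congr rfl fun b _ => ?_
        rw [Finset.sum_comm]
        refine Finset.sum_congr rfl fun l _ => Finset.sum_congr rfl fun n _ => ?_
        unfold Network.relayIn
        split_ifs
        · exact mul_comm _ _
        · simp
    · exact Finset.sum_congr rfl fun _ _ => Finset.sum_congr rfl fun _ _ =>
        Finset.sum_congr rfl fun _ _ => mul_comm _ _
  have h2 : ∑ m, N.contactWork T pos e t₀ t m
      = ∑ m, ∑ l, e.uLen t₀ (.inl (pos (t / T) m).1) l * e.outII t (.inl (pos (t / T) m).1) l none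
        - ∑ m, ∑ l, e.uLen t₀ (.inl (pos (t / T) m).1) l * e.outII t (.inr m) l none
        - (∑ m, ∑ l, e.uLen t₀ (.inr m) l * e.outII t (.inl (pos (t / T) m).1) l none
        - ∑ m, ∑ l, e.uLen t₀ (.inr m) l * e.outII t (.inr m) l none) := by
    unfold Network.contactWork Network.diffII
    simp only [← Finset.sum_sub_distrib]
    refine Finset.sum_congr rfl fun n _ => Finset.sum_congr rfl fun l _ => ?_
    ring
  rw [h1, h2]
  unfold Network.arrivalWork
  ring

end Run

/-! ### Decisions on slightly outdated backlogs are nearly optimal -/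

/-- A transfer decided on an observed weight `X'` that is close to `X`, and only short of `c` when
the observed weight is small, does almost the work of the best transfer. -/
theorem le_work_of_decision {F c X X' E E' : ℝ} (hF : 0 ≤ F) (hFc : F ≤ c) (hE : 0 ≤ E)
    (hE' : 0 ≤ E') (hX : |X - X'| ≤ E) (hpos : 0 ≤ X' → F = c ∨ X' ≤ E') (hneg : X' < 0 → F = 0) :
    c * max X 0 - c * (2 * E + E') ≤ F * X := by
  have hc : 0 ≤ c := hF.trans hFc
  obtain ⟨h1, h2⟩ := abs_le.1 hX
  have hcE := mul_nonneg hc hE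
  have hcE' := mul_nonneg hc hE'
  have hmax : c * max X 0 ≤ c * (max X' 0 + E) :=
    mul_le_mul_of_nonneg_left (max_le (by linarith [le_max_left X' 0])
      (by linarith [le_max_right X' 0])) hc
  rcases lt_or_ge X' 0 with hX' | hX'
  · rw [hneg hX', zero_mul]
    rw [max_eq_right hX'.le] at hmax
    nlinarith
  · rw [max_eq_left hX'] at hmax
    rcases hpos hX' with rfl | h3
    · have : F * (X' - E) ≤ F * X := mul_le_mul_of_nonneg_left (by linarith) hF
      nlinarith
    · have h4 : F * (-E) ≤ F * X := mul_le_mul_of_nonneg_left (by linarith) hF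
      have h5 : F * E ≤ c * E := mul_le_mul_of_nonneg_right hFc hE
      have h6 : c * X' ≤ c * E' := mul_le_mul_of_nonneg_left h3 hc
      nlinarith

variable (T : ℕ) in
/-- In slot `t` and at the beginning of its super slot all queues are close to those of `t₀`. -/
structure Close (e : Execution ι V J) (t₀ t : ℕ) (A : ℝ) : Prop where
  nonneg : 0 ≤ A
  u : ∀ n l, |e.uLen t n l - e.uLen t₀ n l| ≤ A
  u_super : ∀ n l, |e.uLen (t / T * T) n l - e.uLen t₀ n l| ≤ A
  q : ∀ n b, |e.qLen t n b - e.qLen t₀ n b| ≤ A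

namespace Network

variable (N : Network ι V J)

/-- Largest differential backlog at `t₀` from gateway `g` to its mobile. -/
noncomputable def upWeight (e : Execution ι V J) (t₀ : ℕ) (g : V) : ℝ :=
  match N.access g with
  | none => 0
  | some m => ⨆ l : {l : V // N.IsGateway l}, max (diffII e t₀ (.inl g) (.inr m) l.1) 0

/-- Largest differential backlog at `t₀` from the mobile of gateway `g` to `g`. -/
noncomputable def downWeight (e : Execution ι V J) (t₀ : ℕ) (g : V) : ℝ :=
  match N.access g with
  | none => 0
  | some m => ⨆ l : {l : V // N.IsGateway l}, max (diffII e t₀ (.inr m) (.inl g) l.1) 0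

theorem upWeight_nonneg (e : Execution ι V J) (t₀ : ℕ) (g : V) : 0 ≤ N.upWeight e t₀ g := by
  unfold upWeight
  split
  · exact le_rfl
  · exact Real.iSup_nonneg fun l => le_max_right _ _

theorem downWeight_nonneg (e : Execution ι V J) (t₀ : ℕ) (g : V) : 0 ≤ N.downWeight e t₀ g := by
  unfold downWeight
  split
  · exact le_rfl
  · exact Real.iSup_nonneg fun l => le_max_right _ _

variable {N}

theorem le_upWeight (e : Execution ι V J) (t₀ : ℕ) {g l : V} {m : J} (hg : N.access g = some m)
    (hl : N.IsGateway l) : diffII e t₀ (.inl g) (.inr m) l ≤ N.upWeight e t₀ g := by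
  unfold upWeight
  rw [hg]
  exact (le_max_left _ 0).trans (le_ciSup (f := fun l : {l : V // N.IsGateway l} =>
    max (diffII e t₀ (.inl g) (.inr m) l.1) 0) (Set.finite_range _).bddAbove ⟨l, hl⟩)

theorem le_downWeight (e : Execution ι V J) (t₀ : ℕ) {g l : V} {m : J} (hg : N.access g = some m)
    (hl : N.IsGateway l) : diffII e t₀ (.inr m) (.inl g) l ≤ N.downWeight e t₀ g := by
  unfold downWeight
  rw [hg]
  exact (le_max_left _ 0).trans (le_ciSup (f := fun l : {l : V // N.IsGateway l} =>
    max (diffII e t₀ (.inr m) (.inl g) l.1) 0) (Set.finite_range _).bddAbove ⟨l, hl⟩)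

theorem upWeight_le (e : Execution ι V J) (t₀ : ℕ) {g : V} {m : J} (hg : N.access g = some m)
    {B : ℝ} (hB : 0 ≤ B)
    (h : ∀ l, N.IsGateway l → diffII e t₀ (.inl g) (.inr m) l ≤ B) : N.upWeight e t₀ g ≤ B := by
  unfold upWeight
  rw [hg]
  exact Real.iSup_le (fun l => max_le (h l.1 l.2) hB) hB

theorem downWeight_le (e : Execution ι V J) (t₀ : ℕ) {g : V} {m : J} (hg : N.access g = some m)
    {B : ℝ} (hB : 0 ≤ B)
    (h : ∀ l, N.IsGateway l → diffII e t₀ (.inr m) (.inl g) l ≤ B) : N.downWeight e t₀ g ≤ B := by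
  unfold downWeight
  rw [hg]
  exact Real.iSup_le (fun l => max_le (h l.1 l.2) hB) hB

end Network

namespace Run

variable [Fintype J] {N : Network ι V J} {x : V → V → ℝ} {T : ℕ} {R η δ : ℝ} {pos : N.Path}
  {e : Execution ι V J} (h : Run N x T R η δ pos e)
include h

theorem card_mul_η_nonneg : (0 : ℝ) ≤ Fintype.card V * η := mul_nonneg (Nat.cast_nonneg _) h.η_pos.le

theorem sum_demandII_le (t n l) :
    ∑ c, N.demandII T R η pos e t n l c ≤ Fintype.card V * η + R := by
  rw [Fintype.sum_option]
  have h1 := h.demandII_none_le t n l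
  have h2 : (if T ∣ t then R else 0) ≤ R := by
    split_ifs
    · exact le_rfl
    · exact h.R_nonneg
  have h3 : ∑ b, N.demandII T R η pos e t n l (some b) ≤ Fintype.card V * η := by
    refine sum_le_card_mul _ _ fun b => ?_
    rcases n with n | m
    · exact h.demandII_some_le t n l b
    · exact h.η_pos.le
  linarith

/-- Work conservation: if the content covers the sum of all demands, which is at most the bound on
the right, every channel receives its full demand. -/
theorem outII_eq_demand_or (t n l c) : e.outII t n l c = N.demandII T R η pos e t n l c ∨
    e.uLen t n l ≤ Fintype.card V * η + R := by
  rcases le_total (Fintype.card V * η + R) (e.uLen t n l) with h1 | h1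
  · exact .inl ((h.servesII t n l).sum_eq_demand ((h.sum_demandII_le t n l).trans h1) c)
  · exact .inr h1

theorem outII_eq_zero {t n l b} (hne : ¬ (N.cl b = N.cl n ∧
      ((N.IsGateway n ∧ N.IsGateway l ∧ N.IsGateway b ∧ b ≠ n ∧ e.relayIdx (t / T) n b = l) ∨
        (b = l ∧ (N.IsGateway n ↔ ¬ N.IsGateway l))))) : e.outII t (.inl n) l (some b) = 0 := by
  refine Finset.sum_eq_zero fun a _ => ?_
  by_contra h'
  exact hne (h.sendII_some h')

variable (V) in
omit h in
/-- Error of a transfer decision from a type-II to a type-I queue. -/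
noncomputable def _root_.ICN.injectError (T : ℕ) (R η A : ℝ) : ℝ :=
  (10 + 2 * T) * A + Fintype.card V * η + R

theorem injectError_nonneg {A : ℝ} (hA : 0 ≤ A) : 0 ≤ injectError V T R η A := by
  have := h.card_mul_η_nonneg
  have := h.R_nonneg
  unfold injectError
  positivity

theorem abs_scaledQ_sub {t₀ t A} (hc : Close T e t₀ t A) (n b) :
    |N.scaledQ T e t₀ n b - N.scaledQ T e t n b| ≤ T * A := by
  unfold Network.scaledQ
  rw [← mul_sub, abs_mul, abs_of_pos (N.scale_pos h.T_pos n), abs_sub_comm]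
  exact mul_le_mul (N.scale_le n) (hc.q n b) (abs_nonneg _) (Nat.cast_nonneg _)

theorem injectWork_direct {t₀ t A} (hc : Close T e t₀ t A) {n b} (hcl : N.cl n = N.cl b)
    (hg : N.IsGateway n ↔ ¬ N.IsGateway b) :
    η * max (e.uLen t₀ (.inl n) b - N.scaledQ T e t₀ n b) 0 - η * injectError V T R η A
      ≤ N.injectWork T e t₀ t n b := by
  have hη := h.η_pos
  have hA := hc.nonneg
  have hgg : ¬ (N.IsGateway n ∧ N.IsGateway b) := fun h' => (hg.1 h'.1) h'.2
  have hW : N.injectWork T e t₀ t n b = e.outII t (.inl n) b (some b) *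
      (e.uLen t₀ (.inl n) b - N.scaledQ T e t₀ n b) := by
    unfold Network.injectWork
    rw [Finset.sum_eq_single b]
    · rw [if_neg (fun h' => hgg ⟨h'.1, h'.2.1⟩), sub_zero]
    · intro l _ hl
      rw [h.outII_eq_zero, zero_mul]
      rintro ⟨-, h1 | h1⟩
      · exact hgg ⟨h1.1, h1.2.2.1⟩
      · exact hl h1.1.symm
    · simp
  rw [hW]
  have hdem : N.demandII T R η pos e t (.inl n) b (some b) =
      if 0 < e.uLen (t / T * T) (.inl n) b - N.scaledQ T e t n b then η else 0 := by
    unfold Network.demandII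
    simp only
    rw [if_neg (not_not.2 hcl.symm), if_neg hgg]
    simp only [true_and, hg, N.lt_theta_iff h.T_pos]
    rfl
  have h1 := abs_le.1 (hc.u_super (.inl n) b)
  have h2 := abs_le.1 (hc.u (.inl n) b)
  have h3 := abs_le.1 (h.abs_scaledQ_sub hc n b)
  have h4 : 0 ≤ N.scaledQ T e t n b := mul_nonneg (N.scale_pos h.T_pos n).le (h.qLen_nonneg _ _ _)
  have h5 := h.card_mul_η_nonneg
  have h6 := h.R_nonneg
  have hTA : 0 ≤ T * A := mul_nonneg (Nat.cast_nonneg _) hA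
  -- `E` compares the weight at `t₀` with the one on which the decision was based. `E'` covers a
  -- queue too short to meet its demands: at the beginning of the super slot it was longer than now
  -- by at most `2 * A`.
  have key := le_work_of_decision (F := e.outII t (.inl n) b (some b)) (c := η)
    (X := e.uLen t₀ (.inl n) b - N.scaledQ T e t₀ n b)
    (X' := e.uLen (t / T * T) (.inl n) b - N.scaledQ T e t n b) (E := A + T * A)
    (E' := Fintype.card V * η + R + 2 * A) (h.outII_nonneg _ _ _ _) (h.outII_some_le _ _ _ _)
    (by linarith) (by linarith) (by rw [abs_le]; constructor <;> linarith)
    (fun hX => by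
      rcases h.outII_eq_demand_or t (.inl n) b (some b) with h7 | h7
      · rcases hX.lt_or_eq with h8 | h8
        · left; rw [h7, hdem, if_pos h8]
        · right; rw [← h8]; linarith
      · right; linarith)
    (fun hX => by
      refine le_antisymm ?_ (h.outII_nonneg _ _ _ _)
      refine (h.outII_le_demandII _ _ _ _).trans ?_
      rw [hdem, if_neg (not_lt.2 hX.le)])
  refine le_trans ?_ key
  have : η * (2 * (A + T * A) + (Fintype.card V * η + R + 2 * A)) ≤ η * injectError V T R η A := by
    refine mul_le_mul_of_nonneg_left ?_ hη.le
    unfold injectError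
    linarith
  linarith

theorem injectWork_relay {t₀ t A} (hc : Close T e t₀ t A) {n b} (hcl : N.cl n = N.cl b)
    (hn : N.IsGateway n) (hb : N.IsGateway b) (hnb : n ≠ b) :
    -(η * injectError V T R η A) ≤ N.injectWork T e t₀ t n b ∧ ∀ l, N.IsGateway l →
    η * (e.uLen t₀ (.inl n) l - e.uLen t₀ (.inl b) l - N.scaledQ T e t₀ n b)
      - η * injectError V T R η A ≤ N.injectWork T e t₀ t n b := by
  have hη := h.η_pos
  have hA := hc.nonneg
  obtain ⟨hL, hmax⟩ := h.choices.1 (t / T) n b hn hb hcl hnb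
  set L := e.relayIdx (t / T) n b with hLdef
  have hW : N.injectWork T e t₀ t n b = e.outII t (.inl n) L (some b) *
      (e.uLen t₀ (.inl n) L - e.uLen t₀ (.inl b) L - N.scaledQ T e t₀ n b) := by
    unfold Network.injectWork
    rw [Finset.sum_eq_single L]
    · rw [if_pos ⟨hn, hb, hL⟩]
    · intro l _ hl
      rw [h.outII_eq_zero, zero_mul]
      rintro ⟨-, h1 | h1⟩
      · exact hl h1.2.2.2.2.symm
      · exact (h1.2.1 hn) (h1.1 ▸ hb)
    · simp
  rw [hW]
  have hdem : N.demandII T R η pos e t (.inl n) L (some b) =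
      if 0 < Network.diffII e (t / T * T) (.inl n) (.inl b) L - N.scaledQ T e t n b then η else 0 := by
    unfold Network.demandII
    simp only
    rw [if_neg (not_not.2 hcl.symm), if_pos ⟨hn, hL⟩]
    simp only [hb, true_and, hnb.symm, ne_eq, not_false_eq_true, ← hLdef, N.lt_theta_iff h.T_pos]
    rfl
  have h1 := fun l => abs_le.1 (hc.u_super (.inl n) l)
  have h1' := fun l => abs_le.1 (hc.u_super (.inl b) l)
  have h2 := abs_le.1 (hc.u (.inl n) L)
  have h3 := abs_le.1 (h.abs_scaledQ_sub hc n b)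
  have h4 : 0 ≤ N.scaledQ T e t n b := mul_nonneg (N.scale_pos h.T_pos n).le (h.qLen_nonneg _ _ _)
  have h5 := h.card_mul_η_nonneg
  have h6 := h.R_nonneg
  have h7 := h.uLen_nonneg (t / T * T) (.inl b) L
  have hTA : 0 ≤ T * A := mul_nonneg (Nat.cast_nonneg _) hA
  have hL1 := h1 L
  have hL1' := h1' L
  unfold Network.diffII at hdem hmax
  have key := le_work_of_decision (F := e.outII t (.inl n) L (some b)) (c := η)
    (X := e.uLen t₀ (.inl n) L - e.uLen t₀ (.inl b) L - N.scaledQ T e t₀ n b)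
    (X' := e.uLen (t / T * T) (.inl n) L - e.uLen (t / T * T) (.inl b) L - N.scaledQ T e t n b)
    (E := 2 * A + T * A)
    (E' := Fintype.card V * η + R + 2 * A) (h.outII_nonneg _ _ _ _) (h.outII_some_le _ _ _ _)
    (by linarith) (by linarith) (by rw [abs_le]; constructor <;> linarith)
    (fun hX => by
      rcases h.outII_eq_demand_or t (.inl n) L (some b) with h7 | h7
      · rcases hX.lt_or_eq with h8 | h8
        · left; rw [h7, hdem, if_pos h8]
        · right; rw [← h8]; linarith
      · right; linarith)
    (fun hX => by
      refine le_antisymm ?_ (h.outII_nonneg _ _ _ _)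
      refine (h.outII_le_demandII _ _ _ _).trans ?_
      rw [hdem, if_neg (not_lt.2 hX.le)])
  -- The extra `4 * A` pays for comparing an arbitrary `l` at `t₀` with `L`, which was optimal at
  -- the beginning of the super slot: two backlogs for each commodity.
  have hE : η * (2 * (2 * A + T * A) + (Fintype.card V * η + R + 2 * A)) + η * (4 * A)
      ≤ η * injectError V T R η A := by
    rw [← mul_add]
    refine mul_le_mul_of_nonneg_left ?_ hη.le
    unfold injectError
    linarith
  have hηA : 0 ≤ η * (4 * A) := by positivity
  constructor
  · have := mul_nonneg hη.le (le_max_right (e.uLen t₀ (.inl n) L - e.uLen t₀ (.inl b) L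
      - N.scaledQ T e t₀ n b) 0)
    linarith
  · intro l hl
    have h8 := hmax l hl
    have h9 := h1 l
    have h10 := h1' l
    have h11 := le_max_left (e.uLen t₀ (.inl n) L - e.uLen t₀ (.inl b) L - N.scaledQ T e t₀ n b) 0
    have h12 : η * (e.uLen t₀ (.inl n) l - e.uLen t₀ (.inl b) l - N.scaledQ T e t₀ n b)
        ≤ η * (max (e.uLen t₀ (.inl n) L - e.uLen t₀ (.inl b) L - N.scaledQ T e t₀ n b) 0 + 4 * A) :=
      mul_le_mul_of_nonneg_left (by linarith) hη.le
    rw [mul_add] at h12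
    linarith

theorem injectWork_ge {t₀ t A} (hc : Close T e t₀ t A) (n b) :
    -(η * injectError V T R η A) ≤ N.injectWork T e t₀ t n b := by
  have hη := h.η_pos
  have hE := mul_nonneg hη.le (h.injectError_nonneg hc.nonneg)
  have hzero : (∀ l, e.outII t (.inl n) l (some b) = 0) →
      -(η * injectError V T R η A) ≤ N.injectWork T e t₀ t n b := by
    intro h0
    unfold Network.injectWork
    simp only [h0, zero_mul, Finset.sum_const_zero]
    linarith
  by_cases hcl : N.cl n = N.cl b
  swap
  · exact hzero fun l => h.outII_eq_zero fun h' => hcl h'.1.symm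
  by_cases hg : N.IsGateway n ↔ ¬ N.IsGateway b
  · have := h.injectWork_direct hc hcl hg
    have := mul_nonneg hη.le (le_max_right (e.uLen t₀ (.inl n) b - N.scaledQ T e t₀ n b) 0)
    linarith
  by_cases hr : N.IsGateway n ∧ N.IsGateway b ∧ n ≠ b
  · exact (h.injectWork_relay hc hcl hr.1 hr.2.1 hr.2.2).1
  · refine hzero fun l => h.outII_eq_zero ?_
    rintro ⟨-, h1 | ⟨rfl, h1⟩⟩
    · exact hr ⟨h1.1, h1.2.2.1, h1.2.2.2.1.symm⟩
    · exact hg h1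

/-! ### Links -/

/-- The commodity `b` competes in the maximum, and the queue kept at `b` for `b` is empty. -/
theorem diffI_linkIdx_nonneg (t) {a b} (hab : N.Link a b) :
    0 ≤ Network.diffI e t a b (e.linkIdx t a b) := by
  have h1 := (h.intra.1 t a b hab).2 b (N.link_cl a b hab).symm
  unfold Network.diffI at h1 ⊢
  rw [h.qLen_self, sub_zero] at h1
  exact (h.qLen_nonneg _ _ _).trans h1

theorem sched_eq_zero (t) {i a b} (hab : ¬ (N.Link a b ∧ N.cl a = i)) : e.sched t i a b = 0 :=
  N.gam_eq_zero (h.intra.2 t i).1 hab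

variable (V) in
omit h in
/-- Error of the service of a link. -/
noncomputable def _root_.ICN.linkError (T : ℕ) (η A : ℝ) : ℝ :=
  η * (6 * (T * A) + T * (Fintype.card V * η))

theorem linkError_nonneg {A : ℝ} (hA : 0 ≤ A) : 0 ≤ linkError V T η A := by
  have := h.η_pos
  unfold linkError
  positivity

/-- The scheduled rate is used in full unless the queue is shorter than `|V| η`. In that case the
differential backlog is equally small and little work is lost. -/
theorem linkWork_ge {t₀ t A} (hc : Close T e t₀ t A) (n n') :
    e.sched t (N.cl n) n n' * (N.scale T n * Network.diffI e t n n' (e.linkIdx t n n'))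
      - linkError V T η A ≤ N.linkWork T e t₀ t n n' := by
  have hA := hc.nonneg
  have hE := h.linkError_nonneg hA
  by_cases hl : N.Link n n'
  swap
  · have h1 : ∀ b, e.outI t n b n' = 0 := fun b => Finset.sum_eq_zero fun a _ => by
      by_contra h'
      exact hl (h.link_of_sendI h').1
    unfold Network.linkWork
    simp only [h1, zero_mul, Finset.sum_const_zero]
    rw [h.sched_eq_zero t (fun h' => hl h'.1), zero_mul]
    linarith
  set L := e.linkIdx t n n' with hL
  have hcl := N.link_cl n n' hl
  have hW : N.linkWork T e t₀ t n n' = e.outI t n L n' *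
      (N.scaledQ T e t₀ n L - N.scaledQ T e t₀ n' L) := by
    unfold Network.linkWork
    refine Finset.sum_eq_single L (fun b _ hb => ?_) (by simp)
    have : e.outI t n b n' = 0 := Finset.sum_eq_zero fun a _ => by
      by_contra h'
      exact hb (h.link_of_sendI h').2.symm
    rw [this, zero_mul]
  rw [hW]
  have hdem : N.demandI e t n L n' = e.sched t (N.cl n) n n' := by
    unfold Network.demandI
    rw [if_pos ⟨hl, rfl⟩]
  have hsη := h.sched_le t (N.cl n) n n'
  have hs0 := h.sched_nonneg t (N.cl n) n n'
  have hd := h.diffI_linkIdx_nonneg t hl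
  have hK := N.scale_pos h.T_pos n
  have hKT := N.scale_le (T := T) n
  have hTA : 0 ≤ T * A := mul_nonneg (Nat.cast_nonneg _) hA
  have hη := h.η_pos
  have h1 := abs_le.1 (h.abs_scaledQ_sub hc n L)
  have h2 := abs_le.1 (h.abs_scaledQ_sub hc n' L)
  have hX' : N.scale T n * Network.diffI e t n n' L = N.scaledQ T e t n L - N.scaledQ T e t n' L := by
    unfold Network.diffI Network.scaledQ
    rw [← N.scale_congr (T := T) hcl]
    ring
  have key := le_work_of_decision (F := e.outI t n L n') (c := e.sched t (N.cl n) n n')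
    (X := N.scaledQ T e t₀ n L - N.scaledQ T e t₀ n' L)
    (X' := N.scale T n * Network.diffI e t n n' L)
    (E := 2 * (T * A)) (E' := T * (Fintype.card V * η)) (h.outI_nonneg _ _ _ _)
    ((h.outI_le_demandI _ _ _ _).trans_eq hdem)
    (by linarith) (mul_nonneg (Nat.cast_nonneg _) h.card_mul_η_nonneg)
    (by rw [hX', abs_le]; constructor <;> linarith)
    (fun _ => by
      rcases le_total (Fintype.card V * η) (e.qLen t n L) with h7 | h7
      · left
        rw [← hdem]
        refine (h.servesI t n L).sum_eq_demand (le_trans ?_ h7) n'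
        exact sum_le_card_mul _ _ fun n'' => (h.demandI_le t n L n'').trans (h.sched_le _ _ _ _)
      · right
        have h8 : Network.diffI e t n n' L ≤ Fintype.card V * η := by
          have := h.qLen_nonneg t n' L
          unfold Network.diffI
          linarith
        exact mul_le_mul hKT h8 hd (Nat.cast_nonneg _))
    (fun hX => absurd (mul_nonneg hK.le hd) (not_le.2 hX))
  have h3 : e.sched t (N.cl n) n n' * (N.scale T n * Network.diffI e t n n' L)
      ≤ e.sched t (N.cl n) n n' *
        (max (N.scaledQ T e t₀ n L - N.scaledQ T e t₀ n' L) 0 + 2 * (T * A)) := by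
    refine mul_le_mul_of_nonneg_left ?_ hs0
    rw [hX']
    have := le_max_left (N.scaledQ T e t₀ n L - N.scaledQ T e t₀ n' L) 0
    linarith
  have h4 : e.sched t (N.cl n) n n' * (2 * (T * A) + (2 * (2 * (T * A)) + T * (Fintype.card V * η)))
      ≤ linkError V T η A := by
    unfold linkError
    refine (mul_le_mul_of_nonneg_right hsη ?_).trans_eq (by ring)
    have := mul_nonneg (Nat.cast_nonneg (α := ℝ) T) h.card_mul_η_nonneg
    linarith
  rw [mul_add] at h3 h4
  linarith

/-- The scale is constant on a cluster, so it factors out of the cluster's share of the sum, and the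
clusters optimize separately. -/
theorem sum_sched_opt (t) (μ : ι → V → V → ℝ) (hμ : ∀ i, μ i ∈ N.Gam i) :
    ∑ a, ∑ b, μ (N.cl a) a b * (N.scale T a * Network.diffI e t a b (e.linkIdx t a b))
      ≤ ∑ a, ∑ b, e.sched t (N.cl a) a b * (N.scale T a * Network.diffI e t a b (e.linkIdx t a b)) := by
  have : Fintype ι := Fintype.ofSurjective N.cl N.cl_surjective
  choose rep hrep using N.cl_surjective
  have conv : ∀ ν : ι → V → V → ℝ, (∀ i, ν i ∈ N.Gam i) →
      ∑ a, ∑ b, ν (N.cl a) a b * (N.scale T a * Network.diffI e t a b (e.linkIdx t a b))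
        = ∑ i, N.scale T (rep i) * ∑ a, ∑ b, ν i a b * Network.diffI e t a b (e.linkIdx t a b) := by
    intro ν hν
    simp only [Finset.mul_sum]
    rw [Finset.sum_comm (s := (Finset.univ : Finset ι))]
    refine Finset.sum_congr rfl fun a _ => ?_
    rw [Finset.sum_comm (s := (Finset.univ : Finset ι))]
    refine Finset.sum_congr rfl fun b _ => ?_
    rw [Finset.sum_eq_single (N.cl a)]
    · rw [N.scale_congr (T := T) (hrep (N.cl a))]
      ring
    · intro i _ hi
      rw [N.gam_eq_zero (hν i) (fun h' => hi h'.2.symm)]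
      ring
    · simp
  rw [conv μ hμ, conv _ fun i => (h.intra.2 t i).1]
  exact Finset.sum_le_sum fun i _ =>
    mul_le_mul_of_nonneg_left ((h.intra.2 t i).2 _ (hμ i)) (N.scale_pos h.T_pos _).le

/-- The backlogs at `t₀` with the weights of slot `t`. -/
noncomputable def backlog {t₀ t A} (hc : Close T e t₀ t A) : Backlog N where
  U := e.uLen t₀
  Q := N.scaledQ T e t₀
  -- `Q` is taken at `t₀` but links choose by the queues of slot `t`; the padding `2 * (T * A)`
  -- covers the change of the two scaled queues. The other paddings likewise make the inequalities
  -- of `Backlog` hold exactly.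
  D a b := if N.Link a b then
    N.scale T a * Network.diffI e t a b (e.linkIdx t a b) + 2 * (T * A) else 0
  I n b := N.injectWork T e t₀ t n b / η + injectError V T R η A
  up := N.upWeight e t₀
  dn := N.downWeight e t₀
  S := ∑ n, ∑ n', N.linkWork T e t₀ t n n' + Fintype.card V * (Fintype.card V *
    (linkError V T η A + η * (2 * (T * A))))
  U_nonneg := h.uLen_nonneg t₀
  U_self := h.uLen_self t₀
  Q_nonneg n b := mul_nonneg (N.scale_pos h.T_pos n).le (h.qLen_nonneg _ _ _)
  Q_self n := by simp [Network.scaledQ, h.qLen_self]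
  D_nonneg a b := by
    have := hc.nonneg
    split_ifs with hab
    · exact add_nonneg (mul_nonneg (N.scale_pos h.T_pos a).le (h.diffI_linkIdx_nonneg t hab))
        (by positivity)
    · exact le_rfl
  I_nonneg n b := by
    have := h.injectWork_ge hc n b
    have hη := h.η_pos
    rw [← sub_le_iff_le_add, zero_sub, le_div_iff₀ hη]
    linarith
  up_nonneg := N.upWeight_nonneg e t₀
  dn_nonneg := N.downWeight_nonneg e t₀
  D_ge a b j hab hj := by
    rw [if_pos hab]
    have h1 := (h.intra.1 t a b hab).2 j hj
    have h2 := abs_le.1 (h.abs_scaledQ_sub hc a j)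
    have h3 := abs_le.1 (h.abs_scaledQ_sub hc b j)
    have h4 := mul_le_mul_of_nonneg_left h1 (N.scale_pos h.T_pos a).le
    have h5 : N.scale T a * Network.diffI e t a b j = N.scaledQ T e t a j - N.scaledQ T e t b j := by
      unfold Network.diffI Network.scaledQ
      rw [← N.scale_congr (T := T) (N.link_cl a b hab)]
      ring
    linarith
  I_ge n b hcl hg := by
    have h1 := h.injectWork_direct hc hcl hg
    have hη := h.η_pos
    have h2 := le_max_left (e.uLen t₀ (.inl n) b - N.scaledQ T e t₀ n b) 0
    rw [← sub_le_iff_le_add, le_div_iff₀ hη]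
    have h3 := mul_le_mul_of_nonneg_left h2 hη.le
    linarith
  I_ge_relay n b l hnb hcl hn hb hl := by
    have h1 := (h.injectWork_relay hc hcl hn hb hnb).2 l hl
    have hη := h.η_pos
    rw [← sub_le_iff_le_add, le_div_iff₀ hη]
    linarith
  up_ge g m l hg hl := Network.le_upWeight e t₀ hg hl
  dn_ge g m l hg hl := Network.le_downWeight e t₀ hg hl
  S_ge μ hμ := by
    have hTA : 0 ≤ T * A := mul_nonneg (Nat.cast_nonneg _) hc.nonneg
    have h1 := h.sum_sched_opt t μ hμ
    have h2 : ∀ a b, μ (N.cl a) a b * (if N.Link a b then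
        N.scale T a * Network.diffI e t a b (e.linkIdx t a b) + 2 * (T * A) else 0)
        ≤ μ (N.cl a) a b * (N.scale T a * Network.diffI e t a b (e.linkIdx t a b))
          + η * (2 * (T * A)) := by
      intro a b
      split_ifs with hab
      · have h3 : μ (N.cl a) a b ≤ η :=
          (Finset.single_le_sum (f := fun b => μ (N.cl a) a b)
            (fun b _ => N.gam_nonneg (hμ _) a b) (Finset.mem_univ b)).trans
            (h.rates.2 _ _ (hμ _) a).le
        rw [mul_add]
        have := mul_le_mul_of_nonneg_right h3 (by linarith : 0 ≤ 2 * (T * A))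
        linarith
      · rw [N.gam_eq_zero (hμ _) (fun h' => hab h'.1)]
        have := h.η_pos
        simp only [zero_mul, zero_add]
        positivity
    have h3 : ∑ a, ∑ b, μ (N.cl a) a b * (if N.Link a b then
        N.scale T a * Network.diffI e t a b (e.linkIdx t a b) + 2 * (T * A) else 0)
        ≤ ∑ a, ∑ b, (μ (N.cl a) a b * (N.scale T a * Network.diffI e t a b (e.linkIdx t a b))
          + η * (2 * (T * A))) :=
      Finset.sum_le_sum fun a _ => Finset.sum_le_sum fun b _ => h2 a b
    have h4 : ∑ n, ∑ n', (e.sched t (N.cl n) n n' *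
        (N.scale T n * Network.diffI e t n n' (e.linkIdx t n n')) - linkError V T η A)
        ≤ ∑ n, ∑ n', N.linkWork T e t₀ t n n' :=
      Finset.sum_le_sum fun a _ => Finset.sum_le_sum fun b _ => h.linkWork_ge hc a b
    simp only [Finset.sum_add_distrib, Finset.sum_sub_distrib, Finset.sum_const, Finset.card_univ,
      nsmul_eq_mul] at h3 h4
    linarith

end Run

/-! ### Work of the contacts -/

namespace Run

variable [Fintype J] {N : Network ι V J} {x : V → V → ℝ} {T : ℕ} {R η δ : ℝ} {pos : N.Path}
  {e : Execution ι V J} (h : Run N x T R η δ pos e)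
include h

variable (V) in
omit h in
/-- Error of the work done in a contact. -/
noncomputable def _root_.ICN.contactError (R η A : ℝ) : ℝ := 2 * (R * (8 * A + Fintype.card V * η + R))

theorem contactWork_eq_zero (t₀ : ℕ) {t : ℕ} (ht : ¬ T ∣ t) (m : J) :
    N.contactWork T pos e t₀ t m = 0 := by
  have h1 : ∀ n l, e.outII t n l none = 0 := fun n l =>
    le_antisymm ((h.outII_none_le t n l).trans_eq (if_neg ht)) (h.outII_nonneg _ _ _ _)
  unfold Network.contactWork
  simp [h1]

/-- In each direction the commodity with the largest differential backlog at `t` moves at the full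
amount `R`, unless its queue is short or the weight is negative. Evaluating the maximum at `t₀`
instead of `t` costs another `4 * A`. -/
theorem le_contactWork {t₀ t A} (hc : Close T e t₀ t A) (ht : T ∣ t) (m : J) :
    R * (N.upWeight e t₀ (pos (t / T) m).1 + N.downWeight e t₀ (pos (t / T) m).1)
      - contactError V R η A ≤ N.contactWork T pos e t₀ t m := by
  have hR := h.R_nonneg
  have hA := hc.nonneg
  have hV := h.card_mul_η_nonneg
  have htT : t / T * T = t := Nat.div_mul_cancel ht
  set g := (pos (t / T) m).1 with hg
  have hacc : N.access g = some m := (pos (t / T) m).2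
  have hgg : N.IsGateway g := ⟨m, hacc⟩
  obtain ⟨hP, hPmax⟩ := h.choices.2.2 (t / T) m
  obtain ⟨hD, hDmax⟩ := h.choices.2.1 (t / T) m
  rw [htT, ← hg] at hPmax hDmax
  set P := e.pickIdx (t / T) m with hPdef
  set D := e.dropIdx (t / T) m with hDdef
  have hW : N.contactWork T pos e t₀ t m =
      e.outII t (.inl g) P none * Network.diffII e t₀ (.inl g) (.inr m) P
      + e.outII t (.inr m) D none * Network.diffII e t₀ (.inr m) (.inl g) D := by
    unfold Network.contactWork
    rw [Finset.sum_add_distrib, ← hg]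
    congr 1
    · refine Finset.sum_eq_single P (fun l _ hl => ?_) (by simp)
      have : e.outII t (.inl g) l none = 0 := by
        by_contra hne
        obtain ⟨-, m', h1, h2⟩ := h.outII_inl_none t g l hne
        -- A gateway has access to a single mobile, so no other mobile can trigger an upload from
        -- `g`.
        have : m' = m := pos_injective pos (t / T) h1
        subst this
        exact hl h2.symm
      rw [this, zero_mul]
    · refine Finset.sum_eq_single D (fun l _ hl => ?_) (by simp)
      have : e.outII t (.inr m) l none = 0 := Finset.sum_eq_zero fun a _ => by
        by_contra hne
        exact hl (h.sendII_inr_none hne).2.symm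
      rw [this, zero_mul]
  have hdP : N.demandII T R η pos e t (.inl g) P none =
      if 0 ≤ Network.diffII e t (.inl g) (.inr m) P then R else 0 := by
    unfold Network.demandII
    simp only
    by_cases hX : 0 ≤ Network.diffII e t (.inl g) (.inr m) P
    · rw [if_pos hX]
      exact if_pos ⟨ht, m, rfl, rfl, hX⟩
    · rw [if_neg hX]
      refine if_neg ?_
      rintro ⟨-, m', h1, -, h2⟩
      have : m' = m := pos_injective pos (t / T) h1
      rw [this] at h2
      exact hX h2
  have hdD : N.demandII T R η pos e t (.inr m) D none = R := by
    unfold Network.demandII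
    simp only
    exact if_pos ⟨ht, rfl⟩
  have hu := fun n l => abs_le.1 (hc.u n l)
  have hnn := h.uLen_nonneg t
  have hRle : ∀ n l, e.outII t n l none ≤ R := fun n l =>
    (h.outII_none_le t n l).trans_eq (if_pos ht)
  -- Downloads need no sign test: the commodity `g` competes in the maximum, and `g` keeps no
  -- packets for itself.
  have hD0 : 0 ≤ Network.diffII e t (.inr m) (.inl g) D := by
    refine le_trans ?_ (hDmax g hgg)
    unfold Network.diffII
    rw [h.uLen_self, sub_zero]
    exact hnn _ _
  unfold Network.diffII at hPmax hDmax hdP hD0 hW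
  have keyP := le_work_of_decision (F := e.outII t (.inl g) P none) (c := R)
    (X := e.uLen t₀ (.inl g) P - e.uLen t₀ (.inr m) P) (X' := e.uLen t (.inl g) P - e.uLen t (.inr m) P)
    (E := 2 * A) (E' := Fintype.card V * η + R) (h.outII_nonneg _ _ _ _) (hRle _ _)
    (by linarith) (by linarith)
    (by have := hu (.inl g) P; have := hu (.inr m) P; rw [abs_le]; constructor <;> linarith)
    (fun hX => by
      rcases h.outII_eq_demand_or t (.inl g) P none with h7 | h7
      · left; rw [h7, hdP, if_pos hX]
      · right; have := hnn (.inr m) P; linarith)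
    (fun hX => by
      refine le_antisymm ?_ (h.outII_nonneg _ _ _ _)
      refine (h.outII_le_demandII _ _ _ _).trans ?_
      rw [hdP, if_neg (not_le.2 hX)])
  have keyD := le_work_of_decision (F := e.outII t (.inr m) D none) (c := R)
    (X := e.uLen t₀ (.inr m) D - e.uLen t₀ (.inl g) D) (X' := e.uLen t (.inr m) D - e.uLen t (.inl g) D)
    (E := 2 * A) (E' := Fintype.card V * η + R) (h.outII_nonneg _ _ _ _) (hRle _ _)
    (by linarith) (by linarith)
    (by have := hu (.inl g) D; have := hu (.inr m) D; rw [abs_le]; constructor <;> linarith)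
    (fun hX => by
      rcases h.outII_eq_demand_or t (.inr m) D none with h7 | h7
      · left; rw [h7, hdD]
      · right; have := hnn (.inl g) D; linarith)
    (fun hX => absurd hD0 (not_le.2 hX))
  have hup : N.upWeight e t₀ g ≤ max (e.uLen t₀ (.inl g) P - e.uLen t₀ (.inr m) P) 0 + 4 * A := by
    have h1 := le_max_left (e.uLen t₀ (.inl g) P - e.uLen t₀ (.inr m) P) 0
    have h2 := le_max_right (e.uLen t₀ (.inl g) P - e.uLen t₀ (.inr m) P) 0
    refine Network.upWeight_le e t₀ hacc (by linarith) fun l hl => ?_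
    have := hPmax l hl
    have := hu (.inl g) P
    have := hu (.inr m) P
    have := hu (.inl g) l
    have := hu (.inr m) l
    unfold Network.diffII
    linarith
  have hdn : N.downWeight e t₀ g ≤ max (e.uLen t₀ (.inr m) D - e.uLen t₀ (.inl g) D) 0 + 4 * A := by
    have h1 := le_max_left (e.uLen t₀ (.inr m) D - e.uLen t₀ (.inl g) D) 0
    have h2 := le_max_right (e.uLen t₀ (.inr m) D - e.uLen t₀ (.inl g) D) 0
    refine Network.downWeight_le e t₀ hacc (by linarith) fun l hl => ?_
    have := hDmax l hl
    have := hu (.inl g) D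
    have := hu (.inr m) D
    have := hu (.inl g) l
    have := hu (.inr m) l
    unfold Network.diffII
    linarith
  have h1 := mul_le_mul_of_nonneg_left hup hR
  have h2 := mul_le_mul_of_nonneg_left hdn hR
  rw [hW]
  unfold contactError
  nlinarith

/-! ### Arrivals -/

theorem sum_newInter_work (t₀ t) : ∑ n, ∑ l, e.uLen t₀ (.inl n) l * ∑ a, N.newInter x T e t n l a
    = ∑ s, ∑ d, if N.cl s ≠ N.cl d then x s d * e.uLen t₀ (.inl s) (e.srcGate (t / T) s d) else 0 := by
  refine Finset.sum_congr rfl fun s _ => ?_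
  simp only [h.sum_newInter, Finset.mul_sum]
  rw [Finset.sum_comm]
  refine Finset.sum_congr rfl fun d _ => ?_
  rw [Finset.sum_eq_single (e.srcGate (t / T) s d)]
  · simp only [and_true, mul_ite, mul_zero]
    simp only [mul_comm]
  · intro l _ hl
    rw [if_neg (fun h' => hl h'.2.symm), mul_zero]
  · simp

theorem sum_regulated_work (t₀ t) :
    ∑ g, ∑ l, e.uLen t₀ (.inl g) l * N.regulated x T δ e t g l
    ≤ (1 + δ) * ∑ s, ∑ d, if N.cl s ≠ N.cl d then
        x s d * (e.uLen t₀ (.inl (e.srcGate (t / T) s d)) (e.dstGate (t / T) s d)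
          + e.uLen t₀ (.inl (e.dstGate (t / T) s d)) d) else 0 := by
  have hδ : 0 ≤ 1 + δ := by linarith [h.δ_nonneg]
  have hu := h.uLen_nonneg t₀
  have hx := h.traffic.1
  -- Only one of the two sums occurs, according to the kind of `l`. Keeping both, which are
  -- nonnegative, removes the case distinction before the sums are exchanged.
  have h1 : ∀ g l, e.uLen t₀ (.inl g) l * N.regulated x T δ e t g l ≤ (1 + δ) *
      (∑ s, ∑ d, (if N.cl s ≠ N.cl d ∧ e.srcGate (t / T) s d = g ∧ e.dstGate (t / T) s d = l
          then x s d * e.uLen t₀ (.inl g) l else 0)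
        + ∑ s, if N.cl s ≠ N.cl l ∧ e.dstGate (t / T) s l = g then x s l * e.uLen t₀ (.inl g) l
          else 0) := by
    intro g l
    have p1 : 0 ≤ ∑ s, ∑ d, (if N.cl s ≠ N.cl d ∧ e.srcGate (t / T) s d = g ∧ e.dstGate (t / T) s d = l
          then x s d * e.uLen t₀ (.inl g) l else 0) :=
      Finset.sum_nonneg fun s _ => Finset.sum_nonneg fun d _ => by
        split_ifs
        · exact mul_nonneg (hx _ _) (hu _ _)
        · exact le_rfl
    have p2 : 0 ≤ ∑ s, if N.cl s ≠ N.cl l ∧ e.dstGate (t / T) s l = g then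
        x s l * e.uLen t₀ (.inl g) l else 0 :=
      Finset.sum_nonneg fun s _ => by
        split_ifs
        · exact mul_nonneg (hx _ _) (hu _ _)
        · exact le_rfl
    unfold Network.regulated
    rw [mul_left_comm]
    refine mul_le_mul_of_nonneg_left ?_ hδ
    split_ifs with hl
    · refine le_add_of_le_of_nonneg (le_of_eq ?_) p2
      simp only [Finset.mul_sum, mul_ite, mul_zero]
      simp only [mul_comm]
    · refine le_add_of_nonneg_of_le p1 (le_of_eq ?_)
      simp only [Finset.mul_sum, mul_ite, mul_zero]
      simp only [mul_comm]
  refine (Finset.sum_le_sum fun g _ => Finset.sum_le_sum fun l _ => h1 g l).trans (le_of_eq ?_)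
  simp only [← Finset.mul_sum, Finset.sum_add_distrib]
  congr 1
  have e1 : ∑ g, ∑ l, ∑ s, ∑ d, (if N.cl s ≠ N.cl d ∧ e.srcGate (t / T) s d = g ∧
      e.dstGate (t / T) s d = l then x s d * e.uLen t₀ (.inl g) l else 0)
      = ∑ s, ∑ d, if N.cl s ≠ N.cl d then
        x s d * e.uLen t₀ (.inl (e.srcGate (t / T) s d)) (e.dstGate (t / T) s d) else 0 := by
    calc _ = ∑ p : V × V, ∑ k : V × V, (if N.cl k.1 ≠ N.cl k.2 ∧ e.srcGate (t / T) k.1 k.2 = p.1 ∧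
          e.dstGate (t / T) k.1 k.2 = p.2 then x k.1 k.2 * e.uLen t₀ (.inl p.1) p.2 else 0) := by
          simp only [Fintype.sum_prod_type]
      _ = ∑ k : V × V, ∑ p : V × V, _ := Finset.sum_comm
      _ = _ := by
          rw [Fintype.sum_prod_type]
          refine Finset.sum_congr rfl fun s _ => Finset.sum_congr rfl fun d _ => ?_
          rw [Finset.sum_eq_single (e.srcGate (t / T) s d, e.dstGate (t / T) s d)]
          · simp only [and_true]
          · intro p _ hp
            exact if_neg fun h' => hp (Prod.ext h'.2.1.symm h'.2.2.symm)
          · simp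
  have e2 : ∑ g, ∑ l, ∑ s, (if N.cl s ≠ N.cl l ∧ e.dstGate (t / T) s l = g then
        x s l * e.uLen t₀ (.inl g) l else 0)
      = ∑ s, ∑ d, if N.cl s ≠ N.cl d then x s d * e.uLen t₀ (.inl (e.dstGate (t / T) s d)) d
          else 0 := by
    calc _ = ∑ g, ∑ k : V × V, (if N.cl k.2 ≠ N.cl k.1 ∧ e.dstGate (t / T) k.2 k.1 = g then
          x k.2 k.1 * e.uLen t₀ (.inl g) k.1 else 0) := by
          simp only [Fintype.sum_prod_type]
      _ = ∑ k : V × V, ∑ g, _ := Finset.sum_comm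
      _ = ∑ d, ∑ s, _ := Fintype.sum_prod_type _
      _ = ∑ s, ∑ d, _ := Finset.sum_comm
      _ = _ := by
          refine Finset.sum_congr rfl fun s _ => Finset.sum_congr rfl fun d _ => ?_
          rw [Finset.sum_eq_single (e.dstGate (t / T) s d)]
          · simp only [and_true]
          · intro p _ hp
            exact if_neg fun h' => hp h'.2.symm
          · simp
  rw [e1, e2]
  simp only [← Finset.sum_add_distrib]
  refine Finset.sum_congr rfl fun s _ => Finset.sum_congr rfl fun d _ => ?_
  split_ifs
  · ring
  · simp

/-- Cost at `t₀` of the route that the flow `[s,d]` uses in slot `t`. -/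
noncomputable def _root_.ICN.Network.usedRouteCost (T : ℕ) (e : Execution ι V J) (t₀ t : ℕ)
    (s d : V) : ℝ :=
  Network.routeCost e t₀ s d (e.srcGate (t / T) s d) (e.dstGate (t / T) s d)

/-- The route in use was cheapest at the beginning of the super slot. Comparing it with another
route at `t₀` changes three backlogs on either side by at most `A`. -/
theorem usedRouteCost_le {t₀ t A} (hc : Close T e t₀ t A) {s d : V} (hsd : N.cl s ≠ N.cl d) {a b : V}
    (ha : N.IsGateway a) (has : N.cl a = N.cl s) (hb : N.IsGateway b) (hbd : N.cl b = N.cl d) :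
    Network.usedRouteCost T e t₀ t s d - 6 * A ≤ Network.routeCost e t₀ s d a b := by
  have h1 := (h.routing (t / T) s d hsd).2.2 a b ha has hb hbd
  have hu := fun n l => abs_le.1 (hc.u_super n l)
  unfold Network.usedRouteCost
  unfold Network.routeCost at *
  have := hu (.inl s) a
  have := hu (.inl a) b
  have := hu (.inl b) d
  have := hu (.inl s) (e.srcGate (t / T) s d)
  have := hu (.inl (e.srcGate (t / T) s d)) (e.dstGate (t / T) s d)
  have := hu (.inl (e.dstGate (t / T) s d)) d
  linarith

/-- Each flow charges its source queue at rate `x` and the two gateway queues of its route at rate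
at most `(1+δ) x`. The shift by `6 * A` makes the route cost a lower bound over all routes, the form
that the duality requires. -/
theorem arrivalWork_le {t₀ t A} (hc : Close T e t₀ t A) :
    N.arrivalWork x T e t₀ t ≤ (1 + δ) * ∑ s, ∑ d, x s d *
      (if N.cl s = N.cl d then N.scaledQ T e t₀ s d else Network.usedRouteCost T e t₀ t s d - 6 * A)
      + (1 + δ) * (6 * A) * ∑ s, ∑ d, x s d := by
  have hδ := h.δ_nonneg
  have hx := h.traffic.1
  have hu := h.uLen_nonneg t₀
  have hA := hc.nonneg
  unfold Network.arrivalWork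
  simp only [mul_add, Finset.sum_add_distrib]
  rw [h.sum_newInter_work]
  have h1 : ∑ g, ∑ l, e.uLen t₀ (.inl g) l * e.rel t g l
      ≤ ∑ g, ∑ l, e.uLen t₀ (.inl g) l * N.regulated x T δ e t g l :=
    Finset.sum_le_sum fun g _ => Finset.sum_le_sum fun l _ =>
      mul_le_mul_of_nonneg_left (h.rel_le_regulated t g l) (hu _ _)
  have h2 := h1.trans (h.sum_regulated_work t₀ t)
  simp only [Finset.mul_sum] at h2 ⊢
  have h3 : ∀ s d, (if N.cl s ≠ N.cl d then x s d * e.uLen t₀ (.inl s) (e.srcGate (t / T) s d) else 0)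
      + (1 + δ) * (if N.cl s ≠ N.cl d then
        x s d * (e.uLen t₀ (.inl (e.srcGate (t / T) s d)) (e.dstGate (t / T) s d)
          + e.uLen t₀ (.inl (e.dstGate (t / T) s d)) d) else 0)
      + N.scaledQ T e t₀ s d * (if N.cl s = N.cl d then x s d else 0)
      ≤ (1 + δ) * (x s d * (if N.cl s = N.cl d then N.scaledQ T e t₀ s d
          else Network.usedRouteCost T e t₀ t s d - 6 * A)) + (1 + δ) * (6 * A) * x s d := by
    intro s d
    have hxs := hx s d
    by_cases hsd : N.cl s = N.cl d
    · have hq : 0 ≤ N.scaledQ T e t₀ s d := mul_nonneg (N.scale_pos h.T_pos s).le (h.qLen_nonneg _ _ _)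
      simp only [hsd, ne_eq, not_true, if_false, if_true, mul_zero, zero_add]
      have h4 := mul_nonneg hδ (mul_nonneg hxs hq)
      have h5 := mul_nonneg hxs hA
      have h6 := mul_nonneg hδ h5
      nlinarith
    · simp only [hsd, ne_eq, not_false_eq_true, if_false, if_true, mul_zero, add_zero]
      unfold Network.usedRouteCost Network.routeCost
      have h4 := mul_nonneg hδ (mul_nonneg hxs (hu (.inl s) (e.srcGate (t / T) s d)))
      nlinarith
  have h4 := Finset.sum_le_sum fun s (_ : s ∈ Finset.univ) =>
    Finset.sum_le_sum fun d (_ : d ∈ Finset.univ) => h3 s d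
  simp only [Finset.sum_add_distrib] at h4
  linarith

/-! ### Balance of a slot -/

/-- Weighted work done in slot `t` inside the clusters. -/
noncomputable def _root_.ICN.Network.clusterWork (N : Network ι V J) (T : ℕ) (e : Execution ι V J)
    (t₀ t : ℕ) : ℝ :=
  ∑ n, ∑ b, N.injectWork T e t₀ t n b + ∑ n, ∑ n', N.linkWork T e t₀ t n n'

variable (V) in
omit h in
/-- Error of the work done in the clusters. -/
noncomputable def _root_.ICN.clusterError (T : ℕ) (R η A : ℝ) : ℝ :=
  Fintype.card V * (Fintype.card V * (linkError V T η A + η * (2 * (T * A))))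
    + Fintype.card V * (Fintype.card V * (η * injectError V T R η A))

/-- Work at `t₀` that the mobiles offer per slot, on average. -/
noncomputable def _root_.ICN.Network.meanContactWork (N : Network ι V J) (r : ℝ)
    (e : Execution ι V J) (t₀ : ℕ) : ℝ :=
  r * ∑ j, ∑ g : N.Port j, N.stat j g * (N.upWeight e t₀ g.1 + N.downWeight e t₀ g.1)

theorem total_backlog {t₀ t A} (hc : Close T e t₀ t A) (r : ℝ) :
    (h.backlog hc).total r η = N.clusterWork T e t₀ t + clusterError V T R η A
      + N.meanContactWork r e t₀ := by
  have hη := h.η_pos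
  have h1 : ∑ n, ∑ b, (N.injectWork T e t₀ t n b / η + injectError V T R η A)
      = (∑ n, ∑ b, N.injectWork T e t₀ t n b) / η
        + Fintype.card V * (Fintype.card V * injectError V T R η A) := by
    simp only [Finset.sum_add_distrib, Finset.sum_div, Finset.sum_const, Finset.card_univ,
      nsmul_eq_mul]
  unfold Backlog.total Backlog.mobileService Network.clusterWork clusterError Network.meanContactWork
  simp only [backlog]
  have h2 : η * ((∑ n, ∑ b, N.injectWork T e t₀ t n b) / η) = ∑ n, ∑ b, N.injectWork T e t₀ t n b :=
    mul_div_cancel₀ _ hη.ne'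
  rw [h1]
  linear_combination h2

/-- With `r = 0` the total service reduces to the padded work of the clusters. -/
theorem clusterWork_add_nonneg (hne : ∀ i, (N.Gam i).Nonempty) {t₀ t A} (hc : Close T e t₀ t A) :
    0 ≤ N.clusterWork T e t₀ t + clusterError V T R η A := by
  have h1 := (h.backlog hc).total_nonneg hne le_rfl h.η_pos.le (r := 0)
  rw [h.total_backlog] at h1
  simpa [Network.meanContactWork] using h1

/-- The duality applied to the supportable traffic `(1+δ+ε) x`; the arrivals account for only the
share `1+δ` of it. -/
theorem arrivalWork_le_total {r ε : ℝ} (hε : 0 ≤ ε)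
    (hsup : N.Supportable r fun s d => (1 + δ + ε) * x s d) {t₀ t A} (hc : Close T e t₀ t A) :
    (1 + δ + ε) * N.arrivalWork x T e t₀ t ≤ (1 + δ) *
      (N.clusterWork T e t₀ t + clusterError V T R η A + N.meanContactWork r e t₀)
      + (1 + δ + ε) * ((1 + δ) * (6 * A) * ∑ s, ∑ d, x s d) := by
  have hδ := h.δ_nonneg
  have hpos : 0 ≤ 1 + δ + ε := by linarith
  have h1 := (h.backlog hc).traffic_le_total (r := r) h.rates hsup
    ⟨fun s d => mul_nonneg hpos (h.traffic.1 s d), fun s d hne => h.traffic.2 s d (right_ne_zero_of_mul hne)⟩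
    (fun s d => Network.usedRouteCost T e t₀ t s d - 6 * A)
    (fun s d hsd a b ha has hb hbd => h.usedRouteCost_le hc hsd ha has hb hbd)
  rw [h.total_backlog] at h1
  have h2 := h.arrivalWork_le hc
  have h3 : ∑ s, ∑ d, (1 + δ + ε) * x s d *
      (if N.cl s = N.cl d then (h.backlog hc).Q s d else Network.usedRouteCost T e t₀ t s d - 6 * A)
      = (1 + δ + ε) * ∑ s, ∑ d, x s d *
      (if N.cl s = N.cl d then N.scaledQ T e t₀ s d else Network.usedRouteCost T e t₀ t s d - 6 * A) := by
    simp only [Finset.mul_sum, mul_assoc]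
    rfl
  rw [h3] at h1
  have h4 := mul_le_mul_of_nonneg_left h2 hpos
  have h5 := mul_le_mul_of_nonneg_left h1 (by linarith : 0 ≤ 1 + δ)
  linarith

theorem sum_queues_le_total {r : ℝ} {C : ℝ}
    (hC : ∀ B : Backlog N, (∀ n l, ¬ N.Used n l → B.U n l = 0) →
      (∀ n b, N.cl n ≠ N.cl b → B.Q n b = 0) →
      ∑ n, ∑ l, B.U n l + ∑ n, ∑ b, B.Q n b ≤ C * B.total r η) {t₀ t A} (hc : Close T e t₀ t A) :
    ∑ n, ∑ l, e.uLen t₀ n l + ∑ n, ∑ b, N.scaledQ T e t₀ n b ≤ C *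
      (N.clusterWork T e t₀ t + clusterError V T R η A + N.meanContactWork r e t₀) := by
  have h1 := hC (h.backlog hc) (fun n l hn => h.uLen_eq_zero t₀ n l hn) fun n b hn => by
    change N.scaledQ T e t₀ n b = 0
    rw [Network.scaledQ, h.qLen_eq_zero t₀ n b hn, mul_zero]
  rw [h.total_backlog] at h1
  exact h1

end Run

/-! ### The Lyapunov function and its comparison with the queues -/

theorem sqrt_sum_sq_add_le {I : Type*} [Fintype I] (a b : I → ℝ) :
    √(∑ i, (a i + b i) ^ 2) ≤ √(∑ i, a i ^ 2) + √(∑ i, b i ^ 2) := by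
  have := norm_add_le (WithLp.toLp 2 a : EuclideanSpace ℝ I) (WithLp.toLp 2 b)
  simpa [EuclideanSpace.norm_eq] using this

theorem sqrt_sum_sq_le_sum_abs {I : Type*} [Fintype I] (a : I → ℝ) :
    √(∑ i, a i ^ 2) ≤ ∑ i, |a i| := by
  have h0 : 0 ≤ ∑ i, |a i| := Finset.sum_nonneg fun i _ => abs_nonneg _
  rw [Real.sqrt_le_left h0, pow_two, Finset.sum_mul]
  refine Finset.sum_le_sum fun i hi => ?_
  rw [← sq_abs, pow_two]
  exact mul_le_mul_of_nonneg_left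
    (Finset.single_le_sum (f := fun i => |a i|) (fun i _ => abs_nonneg _) hi) (abs_nonneg _)

theorem abs_sub_le_sum_of_step {f β : ℕ → ℝ} (hf : ∀ t, |f (t + 1) - f t| ≤ β t) {s t : ℕ}
    (hst : s ≤ t) : |f t - f s| ≤ ∑ i ∈ Finset.Ico s t, β i := by
  induction t, hst using Nat.le_induction with
  | base => simp
  | succ t hst ih =>
    rw [Finset.sum_Ico_succ_top hst]
    have := abs_sub_le (f (t + 1)) (f t) (f s)
    have := hf t
    linarith

theorem sum_Ico_mul (f : ℕ → ℝ) (T a b : ℕ) (hab : a ≤ b) :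
    ∑ t ∈ Finset.Ico (a * T) (b * T), f t
      = ∑ τ ∈ Finset.Ico a b, ∑ i ∈ Finset.range T, f (τ * T + i) := by
  induction b, hab using Nat.le_induction with
  | base => simp
  | succ b hab ih =>
    rw [Finset.sum_Ico_succ_top hab, ← ih, ← Finset.sum_Ico_consecutive f
      (Nat.mul_le_mul_right T hab) (Nat.mul_le_mul_right T (Nat.le_succ b))]
    congr 1
    rw [Finset.sum_Ico_eq_sum_range, Nat.succ_mul, Nat.add_sub_cancel_left]

theorem dvd_mul_add_iff {T τ i : ℕ} (hi : i < T) : T ∣ τ * T + i ↔ i = 0 := by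
  rw [Nat.dvd_add_right (Nat.dvd_mul_left T τ)]
  exact ⟨fun h => Nat.eq_zero_of_dvd_of_lt h hi, fun h => h ▸ dvd_zero T⟩

theorem sum_range_dvd (T τ : ℕ) (hT : 0 < T) (f : ℕ → ℝ) (hf : ∀ t, ¬ T ∣ t → f t = 0) :
    ∑ i ∈ Finset.range T, f (τ * T + i) = f (τ * T) := by
  rw [Finset.sum_eq_single 0]
  · simp
  · intro i hi hne
    exact hf _ fun h => hne ((dvd_mul_add_iff (Finset.mem_range.1 hi)).1 h)
  · intro h
    exact absurd (Finset.mem_range.2 hT) h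

namespace Network

variable (N : Network ι V J)

/-- Coordinates of the state of the network: type-II queues including packets in transit, and
scaled type-I queues. -/
noncomputable def coord (T : ℕ) (e : Execution ι V J) (t : ℕ) : ((V ⊕ J) × V) ⊕ (V × V) → ℝ
  | .inl (n, l) => e.vLen t n l
  | .inr (n, b) => √(N.scale T n) * e.qLen t n b

/-- The Lyapunov function of BP+SR. -/
noncomputable def potential [Fintype J] (T : ℕ) (e : Execution ι V J) (t : ℕ) : ℝ :=
  √(∑ i, N.coord T e t i ^ 2)

/-- In the block `k` of `T'` super time slots every mobile `j` contacts each of its gateways `g` at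
least `(1+γ)⁻¹ π_j(g) T'` times. -/
def RegularBlock (γ : ℝ) (T' : ℕ) (pos : N.Path) (k : ℕ) : Prop :=
  ∀ j g, (1 + γ)⁻¹ * N.stat j g * T' ≤
    ((Finset.Ico (k * T') ((k + 1) * T')).filter fun τ => pos τ j = g).card

end Network

/-- Bound, per slot, for the average change of a queue. -/
noncomputable def meanStep (J : Type uJ) [Fintype J] (x : V → V → ℝ) (r η δ : ℝ) : ℝ :=
  (2 + δ) * ∑ s, ∑ d, x s d + 2 * (Fintype.card V * η) + (Fintype.card J + 1) * r

theorem sum_stepBound [Fintype J] (x : V → V → ℝ) {T : ℕ} (hT : 0 < T) (r η δ : ℝ) (a n : ℕ) :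
    ∑ t ∈ Finset.Ico (a * T) ((a + n) * T), stepBound (J := J) x T (r * T) η δ t
      = n * (T * meanStep J x r η δ) := by
  rw [sum_Ico_mul _ _ _ _ (Nat.le_add_right a n)]
  have h1 : ∀ τ, ∑ i ∈ Finset.range T, stepBound (J := J) x T (r * T) η δ (τ * T + i)
      = T * meanStep J x r η δ := by
    intro τ
    have h2 := sum_range_dvd T τ hT (fun t => if T ∣ t then r * T else 0) fun t ht => if_neg ht
    unfold stepBound meanStep
    rw [Finset.sum_add_distrib, ← Finset.mul_sum, h2, if_pos (Nat.dvd_mul_left T τ)]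
    simp only [Finset.sum_const, Finset.card_range, nsmul_eq_mul]
    ring
  simp [h1]

namespace Run

variable [Fintype J] {N : Network ι V J} {x : V → V → ℝ} {T : ℕ} {R η δ : ℝ} {pos : N.Path}
  {e : Execution ι V J}

section fixed

variable {r : ℝ} (h : Run N x T (r * T) η δ pos e)
include h

theorem stepBound_nonneg (t : ℕ) : 0 ≤ stepBound (J := J) x T (r * T) η δ t := by
  have h1 := h.ite_R_nonneg t
  have h2 := h.sum_x_nonneg
  have h3 := h.card_mul_η_nonneg
  have h4 := h.δ_nonneg
  unfold stepBound
  positivity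

theorem sum_stepBound_le {a n s t : ℕ} (hs : a * T ≤ s) (ht : t ≤ (a + n) * T) :
    ∑ i ∈ Finset.Ico s t, stepBound (J := J) x T (r * T) η δ i ≤ n * (T * meanStep J x r η δ) := by
  rw [← sum_stepBound x h.T_pos r η δ a n]
  exact Finset.sum_le_sum_of_subset_of_nonneg (Finset.Ico_subset_Ico hs ht)
    fun i _ _ => h.stepBound_nonneg i

theorem block_error_nonneg (n : ℕ) : 0 ≤ n * (T * meanStep J x r η δ) := by
  rw [← sum_stepBound x h.T_pos r η δ 0 n]
  exact Finset.sum_nonneg fun i _ => h.stepBound_nonneg i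

theorem close {a n t : ℕ} (hs : a * T ≤ t) (ht : t ≤ (a + n) * T) :
    Close T e (a * T) t (n * (T * meanStep J x r η δ)) where
  nonneg := h.block_error_nonneg n
  u n' l := (abs_sub_le_sum_of_step (f := fun t => e.uLen t n' l) (fun t => h.abs_uLen_succ_sub t n' l) hs).trans
    (h.sum_stepBound_le le_rfl ht)
  u_super n' l := by
    have h1 : a * T ≤ t / T * T := Nat.mul_le_mul_right T ((Nat.le_div_iff_mul_le h.T_pos).2 hs)
    exact (abs_sub_le_sum_of_step (f := fun t => e.uLen t n' l) (fun t => h.abs_uLen_succ_sub t n' l) h1).trans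
      (h.sum_stepBound_le le_rfl ((Nat.div_mul_le_self t T).trans ht))
  q n' l := (abs_sub_le_sum_of_step (f := fun t => e.qLen t n' l) (fun t => h.abs_qLen_succ_sub t n' l) hs).trans
    (h.sum_stepBound_le le_rfl ht)

theorem abs_vLen_sub {a n t : ℕ} (hs : a * T ≤ t) (ht : t ≤ (a + n) * T) (n' l) :
    |e.vLen t n' l - e.vLen (a * T) n' l| ≤ n * (T * meanStep J x r η δ) :=
  (abs_sub_le_sum_of_step (f := fun t => e.vLen t n' l) (fun t => h.abs_vLen_succ_sub t n' l) hs).trans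
    (h.sum_stepBound_le le_rfl ht)

theorem sqrt_scale_le (n : V) : √(N.scale T n) ≤ T := by
  rw [Real.sqrt_le_left (Nat.cast_nonneg _)]
  have h1 : (1 : ℝ) ≤ T := Nat.one_le_cast.2 h.T_pos
  have := N.scale_le (T := T) n
  nlinarith

theorem abs_coord_sub {a n t : ℕ} (hs : a * T ≤ t) (ht : t ≤ (a + n) * T) (i) :
    |N.coord T e t i - N.coord T e (a * T) i| ≤ T * (n * (T * meanStep J x r η δ)) := by
  have h1 : (1 : ℝ) ≤ T := Nat.one_le_cast.2 h.T_pos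
  have h0 := h.block_error_nonneg n
  rcases i with ⟨n', l⟩ | ⟨n', b⟩
  · exact (h.abs_vLen_sub hs ht n' l).trans (le_mul_of_one_le_left h0 h1)
  · simp only [Network.coord]
    rw [← mul_sub, abs_mul, abs_of_nonneg (Real.sqrt_nonneg _)]
    exact mul_le_mul (h.sqrt_scale_le n') ((h.close hs ht).q n' b) (abs_nonneg _) (Nat.cast_nonneg _)

theorem potential_le_add {a n t : ℕ} (hs : a * T ≤ t) (ht : t ≤ (a + n) * T) :
    N.potential T e t ≤ N.potential T e (a * T) +
      Fintype.card (((V ⊕ J) × V) ⊕ (V × V)) * (T * (n * (T * meanStep J x r η δ))) := by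
  have h1 := sqrt_sum_sq_add_le (N.coord T e (a * T))
    fun i => N.coord T e t i - N.coord T e (a * T) i
  simp only [add_sub_cancel] at h1
  refine h1.trans (add_le_add le_rfl ((sqrt_sum_sq_le_sum_abs _).trans ?_))
  exact sum_le_card_mul _ _ fun i => h.abs_coord_sub hs ht i

theorem vLen_nonneg (t n l) : 0 ≤ e.vLen t n l := (h.uLen_nonneg t n l).trans (h.uLen_le_vLen t n l)

theorem coord_nonneg (t i) : 0 ≤ N.coord T e t i := by
  rcases i with ⟨n', l⟩ | ⟨n', b⟩
  · exact h.vLen_nonneg _ _ _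
  · exact mul_nonneg (Real.sqrt_nonneg _) (h.qLen_nonneg _ _ _)

theorem coord_le_potential (t i) : N.coord T e t i ≤ N.potential T e t :=
  Real.le_sqrt_of_sq_le (Finset.single_le_sum (f := fun i => N.coord T e t i ^ 2)
    (fun _ _ => sq_nonneg _) (Finset.mem_univ i))

theorem uLen_le_potential (t n l) : e.uLen t n l ≤ N.potential T e t :=
  (h.uLen_le_vLen t n l).trans (h.coord_le_potential t (.inl (n, l)))

/-- If `T` is at least the number of nodes, the scale of every cluster is at least `1`. -/
theorem qLen_le_potential (hTV : Fintype.card V ≤ T) (t n b) : e.qLen t n b ≤ N.potential T e t := by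
  refine le_trans ?_ (h.coord_le_potential t (.inr (n, b)))
  refine le_mul_of_one_le_left (h.qLen_nonneg t n b) ?_
  rw [Real.one_le_sqrt]
  refine le_trans ?_ (N.le_scale n)
  have : 0 < Fintype.card V := Fintype.card_pos_iff.2 ⟨n⟩
  rw [one_le_div (Nat.cast_pos.2 this)]
  exact Nat.cast_le.2 hTV

/-- Sum of all queues at `t`, in units of the type-II queues. -/
noncomputable def _root_.ICN.Network.weight (N : Network ι V J) (T : ℕ) (e : Execution ι V J) (t : ℕ) :
    ℝ := ∑ n, ∑ l, e.uLen t n l + ∑ n, ∑ b, N.scaledQ T e t n b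

theorem mul_sum_qLen_le (t) : T * ∑ n, ∑ b, e.qLen t n b
    ≤ Fintype.card V * ∑ n, ∑ b, N.scaledQ T e t n b := by
  simp only [Finset.mul_sum]
  refine Finset.sum_le_sum fun n _ => Finset.sum_le_sum fun b _ => ?_
  unfold Network.scaledQ
  rw [← mul_assoc]
  refine mul_le_mul_of_nonneg_right ?_ (h.qLen_nonneg t n b)
  have h1 : 0 < Fintype.card V := Fintype.card_pos_iff.2 ⟨n⟩
  have h2 := N.le_scale (T := T) n
  rwa [div_le_iff₀ (Nat.cast_pos.2 h1), mul_comm] at h2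

theorem scaledQ_nonneg (t n b) : 0 ≤ N.scaledQ T e t n b :=
  mul_nonneg (N.scale_pos h.T_pos n).le (h.qLen_nonneg _ _ _)

theorem weight_nonneg (t) : 0 ≤ N.weight T e t :=
  add_nonneg (Finset.sum_nonneg fun _ _ => Finset.sum_nonneg fun _ _ => h.uLen_nonneg _ _ _)
    (Finset.sum_nonneg fun _ _ => Finset.sum_nonneg fun _ _ => h.scaledQ_nonneg _ _ _)

theorem mul_sum_qLen_le_weight (t) : T * ∑ n, ∑ b, e.qLen t n b ≤ Fintype.card V * N.weight T e t := by
  refine (h.mul_sum_qLen_le t).trans (mul_le_mul_of_nonneg_left ?_ (Nat.cast_nonneg _))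
  exact le_add_of_nonneg_left
    (Finset.sum_nonneg fun _ _ => Finset.sum_nonneg fun _ _ => h.uLen_nonneg _ _ _)

/-- The Euclidean norm is at most the sum of the coordinates. Packets in transit are type-I packets,
and unscaled type-I lengths, even multiplied by `T`, are controlled by the scaled ones. -/
theorem potential_le_weight (t) :
    N.potential T e t ≤ (1 + 2 * Fintype.card V) * N.weight T e t := by
  have hT1 : (1 : ℝ) ≤ T := Nat.one_le_cast.2 h.T_pos
  have hq0 : 0 ≤ ∑ n, ∑ b, e.qLen t n b :=
    Finset.sum_nonneg fun _ _ => Finset.sum_nonneg fun _ _ => h.qLen_nonneg _ _ _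
  refine (sqrt_sum_sq_le_sum_abs _).trans ?_
  rw [Fintype.sum_sum_type, Fintype.sum_prod_type, Fintype.sum_prod_type]
  have h1 : ∑ n, ∑ l, |N.coord T e t (.inl (n, l))| ≤ ∑ n, ∑ l, e.uLen t n l + ∑ n, ∑ b, e.qLen t n b := by
    have h2 : ∑ n, ∑ l, |N.coord T e t (.inl (n, l))|
        = ∑ n, ∑ l, e.uLen t n l + ∑ b, ∑ l, e.transit t b l := by
      simp only [Network.coord, abs_of_nonneg (h.vLen_nonneg t _ _)]
      unfold Execution.vLen
      simp only [Finset.sum_add_distrib]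
      congr 1
      rw [Fintype.sum_sum_type]
      simp
    rw [h2]
    exact add_le_add le_rfl (h.sum_transit_le t)
  have h3 : ∑ n, ∑ b, |N.coord T e t (.inr (n, b))| ≤ T * ∑ n, ∑ b, e.qLen t n b := by
    simp only [Finset.mul_sum]
    refine Finset.sum_le_sum fun n _ => Finset.sum_le_sum fun b _ => ?_
    rw [abs_of_nonneg (h.coord_nonneg t _)]
    exact mul_le_mul_of_nonneg_right (h.sqrt_scale_le n) (h.qLen_nonneg t n b)
  have h4 := h.mul_sum_qLen_le_weight t
  have h5 : ∑ n, ∑ l, e.uLen t n l ≤ N.weight T e t := le_add_of_nonneg_right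
    (Finset.sum_nonneg fun _ _ => Finset.sum_nonneg fun _ _ => h.scaledQ_nonneg _ _ _)
  nlinarith

/-- Contacts work only in the first slot of a super slot. Grouped by the gateway visited, the frozen
nonnegative weights are counted at least `(1+γ)⁻¹ π n` times. -/
theorem sum_contactWork {γ : ℝ} {a n : ℕ} (hr : 0 ≤ r)
    (hreg : ∀ j g, (1 + γ)⁻¹ * N.stat j g * n ≤
      ((Finset.Ico a (a + n)).filter fun τ => pos τ j = g).card) :
    (1 + γ)⁻¹ * (n * (T * N.meanContactWork r e (a * T)))
      - Fintype.card J * (n * contactError V (r * T) η (n * (T * meanStep J x r η δ)))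
    ≤ ∑ t ∈ Finset.Ico (a * T) ((a + n) * T), ∑ m, N.contactWork T pos e (a * T) t m := by
  set A := n * (T * meanStep J x r η δ) with hA
  set w : V → ℝ := fun g => N.upWeight e (a * T) g + N.downWeight e (a * T) g with hw
  have hw0 : ∀ g, 0 ≤ w g := fun g =>
    add_nonneg (N.upWeight_nonneg e _ g) (N.downWeight_nonneg e _ g)
  rw [Finset.sum_comm, Network.meanContactWork]
  have h1 : ∀ m, (1 + γ)⁻¹ * (n * (T * (r * ∑ g : N.Port m, N.stat m g * w g.1)))
      - n * contactError V (r * T) η A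
      ≤ ∑ t ∈ Finset.Ico (a * T) ((a + n) * T), N.contactWork T pos e (a * T) t m := by
    intro m
    rw [sum_Ico_mul _ _ _ _ (Nat.le_add_right a n),
      Finset.sum_congr rfl fun τ _ => sum_range_dvd T τ h.T_pos _ fun t ht =>
        h.contactWork_eq_zero (a * T) ht m]
    have h2 : ∀ τ ∈ Finset.Ico a (a + n), r * T * w (pos τ m).1 - contactError V (r * T) η A
        ≤ N.contactWork T pos e (a * T) (τ * T) m := by
      intro τ hτ
      obtain ⟨h3, h4⟩ := Finset.mem_Ico.1 hτ
      have := h.le_contactWork (h.close (n := n) (Nat.mul_le_mul_right T h3)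
        (Nat.mul_le_mul_right T h4.le)) (Nat.dvd_mul_left T τ) m
      rwa [Nat.mul_div_cancel _ h.T_pos] at this
    refine le_trans ?_ (Finset.sum_le_sum h2)
    rw [Finset.sum_sub_distrib, Finset.sum_const, Nat.card_Ico, Nat.add_sub_cancel_left, nsmul_eq_mul,
      ← Finset.mul_sum]
    refine sub_le_sub_right ?_ _
    have h5 : ∑ τ ∈ Finset.Ico a (a + n), w (pos τ m).1
        = ∑ g : N.Port m, ((Finset.Ico a (a + n)).filter fun τ => pos τ m = g).card * w g.1 := by
      rw [← Finset.sum_fiberwise (Finset.Ico a (a + n)) (fun τ => pos τ m)]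
      refine Finset.sum_congr rfl fun g _ => ?_
      rw [Finset.sum_congr rfl (g := fun _ => w g.1)]
      · simp
      · intro τ hτ
        rw [(Finset.mem_filter.1 hτ).2]
    have h6 : ∑ g : N.Port m, ((1 + γ)⁻¹ * N.stat m g * n) * w g.1
        ≤ ∑ τ ∈ Finset.Ico a (a + n), w (pos τ m).1 := by
      rw [h5]
      exact Finset.sum_le_sum fun g _ => mul_le_mul_of_nonneg_right (hreg m g) (hw0 _)
    have h7 := mul_le_mul_of_nonneg_left h6 (mul_nonneg hr (Nat.cast_nonneg (α := ℝ) T))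
    refine le_trans (le_of_eq ?_) h7
    simp only [Finset.mul_sum]
    exact Finset.sum_congr rfl fun g _ => by ring
  refine le_trans (le_of_eq ?_) (Finset.sum_le_sum fun m _ => h1 m)
  rw [Finset.sum_sub_distrib, Finset.sum_const, Finset.card_univ, nsmul_eq_mul]
  simp only [Finset.mul_sum]
  rfl

end fixed

end Run

/-! ### Drift of the squared potential over a block -/

theorem sum_Ico_mul_sub {α β : Type*} [Fintype α] [Fintype β] {t₀ t₁ : ℕ} (h : t₀ ≤ t₁)
    (c : α → β → ℝ) (f : ℕ → α → β → ℝ) :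
    ∑ t ∈ Finset.Ico t₀ t₁, ∑ n, ∑ l, c n l * (f (t + 1) n l - f t n l)
      = ∑ n, ∑ l, c n l * (f t₁ n l - f t₀ n l) := by
  rw [Finset.sum_comm (s := Finset.Ico t₀ t₁)]
  refine Finset.sum_congr rfl fun n _ => ?_
  rw [Finset.sum_comm (s := Finset.Ico t₀ t₁)]
  refine Finset.sum_congr rfl fun l _ => ?_
  rw [← Finset.mul_sum, Finset.sum_Ico_sub (fun t => f t n l) h]

namespace Run

variable [Fintype J] {N : Network ι V J} {x : V → V → ℝ} {T : ℕ} {r η δ : ℝ} {pos : N.Path}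
  {e : Execution ι V J}

/-- Drift of the squared potential over a stretch of `n` super slots, in terms of the weighted
work. -/
theorem potential_sq_le (h : Run N x T (r * T) η δ pos e) (a n : ℕ) :
    N.potential T e ((a + n) * T) ^ 2 ≤ N.potential T e (a * T) ^ 2
      + 2 * ∑ t ∈ Finset.Ico (a * T) ((a + n) * T),
        (N.arrivalWork x T e (a * T) t - N.clusterWork T e (a * T) t
          - ∑ m, N.contactWork T pos e (a * T) t m)
      + 2 * (n * (meanStep J x r η δ * (Fintype.card V * N.weight T e (a * T))))
      + Fintype.card (((V ⊕ J) × V) ⊕ (V × V)) * (T * (n * (T * meanStep J x r η δ))) ^ 2 := by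
  set t₀ := a * T with ht₀
  set t₁ := (a + n) * T with ht₁
  have h01 : t₀ ≤ t₁ := Nat.mul_le_mul_right T (Nat.le_add_right a n)
  set A := n * (T * meanStep J x r η δ) with hA
  have hA0 : 0 ≤ A := h.block_error_nonneg n
  have hsq : ∀ t, N.potential T e t ^ 2 = ∑ i, N.coord T e t i ^ 2 := fun t =>
    Real.sq_sqrt (Finset.sum_nonneg fun i _ => sq_nonneg _)
  rw [hsq, hsq]
  have h1 : ∀ i, N.coord T e t₁ i ^ 2 ≤ N.coord T e t₀ i ^ 2
      + 2 * (N.coord T e t₀ i * (N.coord T e t₁ i - N.coord T e t₀ i)) + (T * A) ^ 2 := by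
    intro i
    have h2 := h.abs_coord_sub (n := n) h01 le_rfl i
    have h3 : (N.coord T e t₁ i - N.coord T e t₀ i) ^ 2 ≤ (T * A) ^ 2 := by
      rw [← sq_abs]
      exact pow_le_pow_left₀ (abs_nonneg _) h2 2
    nlinarith
  refine (Finset.sum_le_sum fun i _ => h1 i).trans ?_
  rw [Finset.sum_add_distrib, Finset.sum_add_distrib, ← Finset.mul_sum, Finset.sum_const,
    Finset.card_univ, nsmul_eq_mul]
  -- The square has the weights `vLen` but the algorithm sees `uLen`. They differ by the packets in
  -- transit, which cost at most `A` each.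
  have h4 : ∑ i, N.coord T e t₀ i * (N.coord T e t₁ i - N.coord T e t₀ i)
      ≤ (∑ n, ∑ l, e.uLen t₀ n l * (e.vLen t₁ n l - e.vLen t₀ n l)
        + ∑ n, ∑ b, N.scaledQ T e t₀ n b * (e.qLen t₁ n b - e.qLen t₀ n b))
        + A * ∑ n, ∑ b, e.qLen t₀ n b := by
    rw [Fintype.sum_sum_type, Fintype.sum_prod_type, Fintype.sum_prod_type]
    have h5 : ∑ n, ∑ b, N.coord T e t₀ (.inr (n, b)) * (N.coord T e t₁ (.inr (n, b))
        - N.coord T e t₀ (.inr (n, b)))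
        = ∑ n, ∑ b, N.scaledQ T e t₀ n b * (e.qLen t₁ n b - e.qLen t₀ n b) := by
      refine Finset.sum_congr rfl fun n _ => Finset.sum_congr rfl fun b _ => ?_
      have := Real.mul_self_sqrt (N.scale_pos h.T_pos n).le
      simp only [Network.coord, Network.scaledQ]
      linear_combination (e.qLen t₀ n b * (e.qLen t₁ n b - e.qLen t₀ n b)) * this
    have h6 : ∑ n, ∑ l, N.coord T e t₀ (.inl (n, l)) * (N.coord T e t₁ (.inl (n, l))
        - N.coord T e t₀ (.inl (n, l)))
        ≤ ∑ n, ∑ l, e.uLen t₀ n l * (e.vLen t₁ n l - e.vLen t₀ n l)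
          + A * ∑ b, ∑ l, e.transit t₀ b l := by
      rw [Fintype.sum_sum_type, Fintype.sum_sum_type]
      simp only [Network.coord]
      have h7 : ∀ b l, e.vLen t₀ (.inl b) l * (e.vLen t₁ (.inl b) l - e.vLen t₀ (.inl b) l)
          ≤ e.uLen t₀ (.inl b) l * (e.vLen t₁ (.inl b) l - e.vLen t₀ (.inl b) l)
            + A * e.transit t₀ b l := by
        intro b l
        have h8 := (abs_le.1 (h.abs_vLen_sub (n := n) h01 le_rfl (.inl b) l)).2
        have h9 : e.vLen t₀ (.inl b) l = e.uLen t₀ (.inl b) l + e.transit t₀ b l := rfl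
        have h10 := mul_le_mul_of_nonneg_left h8 (h.transit_nonneg t₀ b l)
        nth_rewrite 1 [h9]
        rw [add_mul]
        linarith
      have h11 : ∑ m, ∑ l, e.vLen t₀ (.inr m) l * (e.vLen t₁ (.inr m) l - e.vLen t₀ (.inr m) l)
          = ∑ m, ∑ l, e.uLen t₀ (.inr m) l * (e.vLen t₁ (.inr m) l - e.vLen t₀ (.inr m) l) := by
        refine Finset.sum_congr rfl fun m _ => Finset.sum_congr rfl fun l _ => ?_
        have : e.vLen t₀ (.inr m) l = e.uLen t₀ (.inr m) l := add_zero _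
        nth_rewrite 1 [this]
        rfl
      rw [h11]
      have h12 := Finset.sum_le_sum fun b (_ : b ∈ Finset.univ) =>
        Finset.sum_le_sum fun l (_ : l ∈ Finset.univ) => h7 b l
      simp only [Finset.sum_add_distrib, ← Finset.mul_sum] at h12
      linarith
    rw [h5]
    have := mul_le_mul_of_nonneg_left (h.sum_transit_le t₀) hA0
    linarith
  have h13 : ∑ n, ∑ l, e.uLen t₀ n l * (e.vLen t₁ n l - e.vLen t₀ n l)
        + ∑ n, ∑ b, N.scaledQ T e t₀ n b * (e.qLen t₁ n b - e.qLen t₀ n b)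
      = ∑ t ∈ Finset.Ico t₀ t₁, (N.arrivalWork x T e t₀ t - N.clusterWork T e t₀ t
          - ∑ m, N.contactWork T pos e t₀ t m) := by
    have h14 : ∀ t, N.arrivalWork x T e t₀ t - N.clusterWork T e t₀ t
          - ∑ m, N.contactWork T pos e t₀ t m = _ := fun t => (h.drift_eq t₀ t).symm
    rw [Finset.sum_congr rfl fun t _ => h14 t, Finset.sum_add_distrib,
      ← sum_Ico_mul_sub h01 (fun n l => e.uLen t₀ n l) e.vLen, ← sum_Ico_mul_sub h01 (fun n b => N.scaledQ T e t₀ n b) e.qLen]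
  rw [h13] at h4
  -- The factor `T` in `A` is absorbed by the scale of the type-I queues, so this error is free of
  -- `T`, whereas the work gained over the block carries the factor `T`.
  have h15 : A * ∑ n, ∑ b, e.qLen t₀ n b
      ≤ n * (meanStep J x r η δ * (Fintype.card V * N.weight T e t₀)) := by
    have h16 := h.mul_sum_qLen_le_weight t₀
    have h17 : 0 ≤ n * meanStep J x r η δ := by
      have hT : (0 : ℝ) < T := Nat.cast_pos.2 h.T_pos
      have : 0 ≤ (T : ℝ) * (n * meanStep J x r η δ) := by rw [hA] at hA0; linarith
      exact nonneg_of_mul_nonneg_right this hT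
    have := mul_le_mul_of_nonneg_left h16 h17
    rw [hA]
    linarith
  linarith

variable (V J) in
/-- Error per slot in the balance of the weighted work. -/
noncomputable def _root_.ICN.balanceError (x : V → V → ℝ) (T : ℕ) (R η δ A : ℝ) : ℝ :=
  clusterError V T R η A + (1 + δ) * (6 * A) * ∑ s, ∑ d, x s d

/-- Up to errors, arrivals use the fraction `ρ₁` of the total work, clusters do all of their share,
and mobiles do at least `ρ₂` of theirs over the block. The surplus `ρ₂ - ρ₁` is positive by the
hypothesis on `γ`, and it acts on work that dominates the weight of all queues. -/
theorem sum_work_le {ε γ C : ℝ} (h : Run N x T (r * T) η δ pos e) (hr : 0 < r) (hε : 0 < ε) (hγ : 0 ≤ γ)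
    (hγε : (1 + γ) * (1 + δ) < 1 + δ + ε)
    (hsup : N.Supportable r fun s d => (1 + δ + ε) * x s d) (hC : 0 < C)
    (hCB : ∀ B : Backlog N, (∀ n l, ¬ N.Used n l → B.U n l = 0) →
      (∀ n b, N.cl n ≠ N.cl b → B.Q n b = 0) →
      ∑ n, ∑ l, B.U n l + ∑ n, ∑ b, B.Q n b ≤ C * B.total r η) (a n : ℕ)
    (hreg : ∀ j g, (1 + γ)⁻¹ * N.stat j g * n ≤
      ((Finset.Ico a (a + n)).filter fun τ => pos τ j = g).card) :
    ∑ t ∈ Finset.Ico (a * T) ((a + n) * T),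
        (N.arrivalWork x T e (a * T) t - N.clusterWork T e (a * T) t
          - ∑ m, N.contactWork T pos e (a * T) t m)
      ≤ n * T * (balanceError V x T (r * T) η δ (n * (T * meanStep J x r η δ))
          - ((1 + γ)⁻¹ - (1 + δ) / (1 + δ + ε)) / C * N.weight T e (a * T))
        + Fintype.card J * (n * contactError V (r * T) η (n * (T * meanStep J x r η δ))) := by
  set t₀ := a * T with ht₀
  set A := n * (T * meanStep J x r η δ) with hA
  have hδ := h.δ_nonneg
  have h1 := h.sum_contactWork hr.le hreg
  have hne : ∀ i, (N.Gam i).Nonempty := fun i => hsup.gam_nonempty i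
  have hpos : 0 < 1 + δ + ε := by linarith
  have hγ1 : 0 < 1 + γ := by linarith
  set ρ₁ := (1 + δ) / (1 + δ + ε) with hρ₁
  set ρ₂ := (1 + γ)⁻¹ with hρ₂
  have hρ : 0 < ρ₂ - ρ₁ := by
    rw [hρ₁, hρ₂, sub_pos, div_lt_iff₀ hpos, inv_mul_eq_div, lt_div_iff₀ hγ1]
    linarith
  have hρ2 : ρ₂ ≤ 1 := inv_le_one_of_one_le₀ (by linarith)
  have hslot : ∀ t ∈ Finset.Ico t₀ ((a + n) * T),
      N.arrivalWork x T e t₀ t - N.clusterWork T e t₀ t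
        ≤ balanceError V x T (r * T) η δ A - (ρ₂ - ρ₁) / C * N.weight T e t₀
          + ρ₂ * N.meanContactWork r e t₀ := by
    intro t ht
    obtain ⟨ht1, ht2⟩ := Finset.mem_Ico.1 ht
    have hc := h.close (n := n) ht1 ht2.le
    have e1 := h.arrivalWork_le_total hε.le hsup hc
    have e2 := h.sum_queues_le_total hCB hc
    have e3 := h.clusterWork_add_nonneg hne hc
    set c := N.clusterWork T e t₀ t + clusterError V T (r * T) η A with hcdef
    have e4 : N.arrivalWork x T e t₀ t ≤ ρ₁ * (c + N.meanContactWork r e t₀)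
        + (1 + δ) * (6 * A) * ∑ s, ∑ d, x s d := by
      rw [hρ₁, div_mul_eq_mul_div, ← sub_le_iff_le_add, le_div_iff₀ hpos]
      linarith
    have e5 : N.weight T e t₀ / C ≤ c + N.meanContactWork r e t₀ := by
      rw [div_le_iff₀ hC, mul_comm]
      exact e2
    -- The clusters' share is lowered from `1` to `ρ₂` so that the surplus `ρ₂ - ρ₁` multiplies the
    -- whole service `c + meanContactWork`; the term `ρ₂ * meanContactWork` left over is paid by the
    -- contacts of the block.
    have e6 := mul_le_mul_of_nonneg_left e5 hρ.le
    have e7 := mul_le_mul_of_nonneg_right hρ2 e3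
    have e8 : (ρ₂ - ρ₁) / C * N.weight T e t₀ = (ρ₂ - ρ₁) * (N.weight T e t₀ / C) := by ring
    rw [e8]
    unfold balanceError
    linarith
  rw [Finset.sum_sub_distrib]
  have h2 := Finset.sum_le_sum hslot
  have hcard : (Finset.Ico t₀ ((a + n) * T)).card = n * T := by
    rw [Nat.card_Ico, ht₀, ← Nat.sub_mul, Nat.add_sub_cancel_left]
  rw [Finset.sum_const (s := Finset.Ico t₀ ((a + n) * T)), hcard, nsmul_eq_mul] at h2
  push_cast at h2
  linarith

end Run

/-! ### From the squared potential to a linear drift -/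

theorem le_max_of_sq_le {V₀ V₁ c D E : ℝ} (hc : 0 < c) (hE : 0 ≤ E)
    (hD : V₁ ≤ V₀ + D) (h : V₁ ^ 2 ≤ V₀ ^ 2 - c * V₀ + E) :
    V₁ ≤ max (V₀ - c / 4) (2 * E / c + c / 4 + D) := by
  -- Above this threshold half of `c * V₀` absorbs `E`, and the other half yields the drop by `c /
  -- 4`, whose square would require less. Below it only the bounded growth `D` is used.
  rcases le_total (2 * E / c + c / 4) V₀ with h1 | h1
  · refine le_max_of_le_left ?_
    have hEc : 0 ≤ 2 * E / c := by positivity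
    have h2 : 2 * E ≤ c * V₀ := by
      have : 2 * E / c ≤ V₀ := by linarith
      rw [div_le_iff₀ hc] at this
      linarith
    refine abs_le_of_sq_le_sq' ?_ (by linarith) |>.2
    nlinarith [sq_nonneg c]
  · exact le_max_of_le_right (by linarith)

namespace Run

/-- Over blocks of `T'` super time slots the potential grows at most linearly in `T'`, and it
decreases linearly in `T'` when it is large and the contacts are regular. -/
theorem exists_drift [Fintype J] (N : Network ι V J) (x : V → V → ℝ) {r η δ ε γ : ℝ} (hr : 0 < r)
    (hη : 0 < η) (hδ : 0 ≤ δ) (hε : 0 < ε) (hγ : 0 ≤ γ) (hx : N.IsTraffic x)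
    (hγε : (1 + γ) * (1 + δ) < 1 + δ + ε)
    (hsup : N.Supportable r fun s d => (1 + δ + ε) * x s d) :
    ∃ T₀ : ℕ, 0 < T₀ ∧ ∀ T : ℕ, T₀ ≤ T → ∃ α ρ : ℝ, 0 < α ∧ 0 < ρ ∧ ∀ T' : ℕ, 0 < T' → ∃ B : ℝ, 0 ≤ B ∧
      ∀ (pos : N.Path) (e : Execution ι V J), Run N x T (r * T) η δ pos e → ∀ k : ℕ,
        N.potential T e ((k + 1) * T' * T) ≤ N.potential T e (k * T' * T) + α * T' ∧
        (N.RegularBlock γ T' pos k → N.potential T e ((k + 1) * T' * T)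
          ≤ max (N.potential T e (k * T' * T) - ρ * T') B) ∧
        ∀ t, k * T' * T ≤ t → t ≤ (k + 1) * T' * T →
          (∀ n b, e.qLen t n b ≤ N.potential T e (k * T' * T) + B) ∧
          ∀ n l, e.uLen t n l ≤ N.potential T e (k * T' * T) + B := by
  have hne : ∀ i, (N.Gam i).Nonempty := fun i => hsup.gam_nonempty i
  obtain ⟨C, hC, hCB⟩ := Backlog.exists_sum_le_total N hne hr hη
  set σ := meanStep J x r η δ with hσ
  have hxs : 0 ≤ ∑ s, ∑ d, x s d :=
    Finset.sum_nonneg fun s _ => Finset.sum_nonneg fun d _ => hx.1 s d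
  have hσ0 : 0 < σ := by
    have h1 : 0 ≤ (2 + δ) * ∑ s, ∑ d, x s d := by positivity
    have h2 : (0 : ℝ) ≤ 2 * (Fintype.card V * η) := by positivity
    have h3 : (0 : ℝ) < (Fintype.card J + 1) * r := by positivity
    rw [hσ]
    unfold meanStep
    linarith
  set κ := ((1 + γ)⁻¹ - (1 + δ) / (1 + δ + ε)) / C with hκ
  have hκ0 : 0 < κ := by
    refine div_pos ?_ hC
    rw [sub_pos, div_lt_iff₀ (by linarith), inv_mul_eq_div, lt_div_iff₀ (by linarith)]
    linarith
  -- Beyond `T₁` the error of the packets in transit takes at most half of the negative drift.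
  obtain ⟨T₁, hT₁⟩ := exists_nat_ge (2 * (σ * Fintype.card V) / κ)
  refine ⟨max (max 1 (Fintype.card V)) T₁, lt_of_lt_of_le Nat.one_pos
    ((le_max_left _ _).trans (le_max_left _ _)), fun T hT => ?_⟩
  have hT1 : 0 < T := lt_of_lt_of_le Nat.one_pos
    (((le_max_left _ _).trans (le_max_left _ _)).trans hT)
  have hTV : Fintype.card V ≤ T := ((le_max_right _ _).trans (le_max_left _ _)).trans hT
  have hTκ : 2 * (σ * Fintype.card V) ≤ κ * T := by
    have : 2 * (σ * Fintype.card V) / κ ≤ T :=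
      hT₁.trans (Nat.cast_le.2 ((le_max_right _ _).trans hT))
    rw [div_le_iff₀ hκ0] at this
    linarith
  have hTR : (0 : ℝ) < T := Nat.cast_pos.2 hT1
  set M : ℝ := ((Fintype.card (((V ⊕ J) × V) ⊕ (V × V)) : ℕ) : ℝ) with hM
  have hM0 : 0 ≤ M := Nat.cast_nonneg _
  set α := M * (T * (T * σ)) + 1 with hα
  have hα0 : 0 < α := by positivity
  set L : ℝ := 1 + 2 * Fintype.card V with hL
  have hL0 : 0 < L := by positivity
  set c := κ * T / L with hc
  have hc0 : 0 < c := by positivity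
  -- Both rates are fixed before the block length `T'`, and growth and decrease are linear in `T'`.
  -- The tail estimate relies on this to choose `T'` afterwards.
  refine ⟨α, c / 4, hα0, by positivity, fun T' hT' => ?_⟩
  have hT'R : (0 : ℝ) < T' := Nat.cast_pos.2 hT'
  set A := T' * (T * σ) with hA
  set E₀ := 2 * (T' * T * balanceError V x T (r * T) η δ A
    + Fintype.card J * (T' * contactError V (r * T) η A)) + M * (T * A) ^ 2 with hE₀
  set E := max E₀ 0 with hE
  -- The threshold of `le_max_of_sq_le` for the drift `c * T'` and the growth `α * T'`; it also
  -- covers the growth inside a block.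
  set B := max (2 * E / (c * T') + (c * T') / 4 + α * T') 0 with hB
  refine ⟨B, le_max_right _ _, fun pos e h k => ?_⟩
  have hk : (k + 1) * T' = k * T' + T' := by ring
  rw [hk]
  have hgrow : ∀ t, k * T' * T ≤ t → t ≤ (k * T' + T') * T →
      N.potential T e t ≤ N.potential T e (k * T' * T) + α * T' := by
    intro t h1 h2
    refine (h.potential_le_add h1 h2).trans (add_le_add le_rfl ?_)
    rw [← hσ, ← hM, hα]
    nlinarith
  have hαB : α * T' ≤ B := by
    refine le_trans ?_ (le_max_left _ _)
    have : 0 ≤ E := le_max_right _ _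
    have : 0 ≤ 2 * E / (c * T') := by positivity
    have : 0 ≤ c * T' / 4 := by positivity
    linarith
  refine ⟨hgrow _ (Nat.mul_le_mul_right T (Nat.le_add_right _ _)) le_rfl, fun hreg => ?_, fun t h1 h2 => ?_⟩
  · have hreg' : ∀ j g, (1 + γ)⁻¹ * N.stat j g * T' ≤
        ((Finset.Ico (k * T') (k * T' + T')).filter fun τ => pos τ j = g).card := fun j g => by
      have := hreg j g
      rwa [hk] at this
    have h1 := h.sum_work_le hr hε hγ hγε hsup hC hCB (k * T') T' hreg'
    have h2 := h.potential_sq_le (k * T') T'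
    rw [← hσ, ← hM, ← hA] at h2
    rw [← hσ, ← hκ, ← hA] at h1
    have hW := h.weight_nonneg (k * T' * T)
    have hpW := h.potential_le_weight (k * T' * T)
    have hV0 : 0 ≤ N.potential T e (k * T' * T) := Real.sqrt_nonneg _
    set W := N.weight T e (k * T' * T) with hWdef
    have h3 : 2 * (σ * Fintype.card V) * (T' * W) ≤ κ * T * (T' * W) :=
      mul_le_mul_of_nonneg_right hTκ (mul_nonneg hT'R.le hW)
    have h4 : c * T' * N.potential T e (k * T' * T) ≤ κ * T * (T' * W) := by
      rw [← hL] at hpW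
      have h5 := mul_le_mul_of_nonneg_left hpW (mul_nonneg hc0.le hT'R.le)
      refine h5.trans (le_of_eq ?_)
      rw [hc]
      field_simp
    have h6 : E₀ ≤ E := le_max_left _ _
    refine (le_max_of_sq_le (mul_pos hc0 hT'R) (le_max_right E₀ 0)
      (hgrow _ (Nat.mul_le_mul_right T (Nat.le_add_right _ _)) le_rfl) ?_).trans ?_
    · rw [← hE]
      linarith
    · refine max_le_max (le_of_eq (by ring)) (le_max_left _ _)
  · have h3 := hgrow t h1 h2
    exact ⟨fun n b => (h.qLen_le_potential hTV t n b).trans (by linarith),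
      fun n l => (h.uLen_le_potential t n l).trans (by linarith)⟩

end Run

/-! ### Real queues -/

/-- A queue that is served at rate at least that of its inflow cannot exceed what is upstream by
much. -/
theorem le_of_served {Y w a : ℕ → ℝ} {Z A δ : ℝ} {n : ℕ} (hδ : 0 ≤ δ) (hZ : 0 ≤ Z) (ha : ∀ t, 0 ≤ a t)
    (hA : ∀ t, a t ≤ A) (h0 : Y 0 = 0)
    (hstep : ∀ t, Y (t + 1) ≤ Y t + a t - min (w t) ((1 + δ) * a t))
    (hY : ∀ t ≤ n, Y t ≤ w t + Z) : ∀ t ≤ n, Y t ≤ Z + A := by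
  intro t
  induction t with
  | zero => intro _; linarith [ha 0, hA 0]
  | succ t ih =>
    intro ht
    have h1 := hstep t
    have h2 := ih (Nat.le_of_succ_le ht)
    have h3 := hY t (Nat.le_of_succ_le ht)
    have h4 := mul_nonneg hδ (ha t)
    -- Either the real queue is emptied, so that only the upstream part `Z` and the new inflow
    -- remain, or the service is at least the inflow and `Y` does not grow.
    rcases le_total (w t) ((1 + δ) * a t) with h5 | h5
    · rw [min_eq_left h5] at h1
      linarith [hA t]
    · rw [min_eq_right h5] at h1
      linarith

namespace Execution

/-- Packets with header `a` on their way from their source to gateway `g`. -/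
noncomputable def uplinkMass (N : Network ι V J) (e : Execution ι V J) (t : ℕ) (g : V) (a : Header V) : ℝ :=
  (∑ s, if N.IsGateway s then 0 else e.u t (.inl s) g a) + ∑ n, e.q t n g (.uplink, a)

/-- Packets with header `a` that have not yet reached their destination gateway. -/
noncomputable def headerMass [Fintype J] (N : Network ι V J) (e : Execution ι V J) (t : ℕ) (a : Header V) : ℝ :=
  (∑ l, if N.IsGateway l then ∑ n, e.u t n l a else 0)
    + (∑ b, ∑ n, e.q t n b (.uplink, a) + ∑ b, ∑ n, e.q t n b (.relay, a))
    + ∑ l, if N.IsGateway l then ∑ b, e.w t b l a else 0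

end Execution

namespace Run

variable [Fintype J] {N : Network ι V J} {x : V → V → ℝ} {T : ℕ} {R η δ : ℝ} {pos : N.Path}
  {e : Execution ι V J} (h : Run N x T R η δ pos e)
include h

theorem u_source {t n l a} (hne : e.u t (.inl n) l a ≠ 0) (hn : ¬ N.IsGateway n) : a.1 = n := by
  induction t with
  | zero => exact absurd (h.u_zero _ _ _) hne
  | succ t ih =>
    have hc := h.contents t
    rcases h.contents_u_inl_cases hne with h1 | h1 | h1 | ⟨-, -, n', h1⟩ | ⟨-, m, h2, h1⟩
    · exact ih h1
    · simp only [Network.newInter, ne_eq, ite_eq_right_iff, Classical.not_imp] at h1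
      exact h1.1.1
    · exact absurd (h.regulated_of_release h1).1 hn
    · exact absurd (hc.q_gateway _ _ _ _ (h.q_of_sendI h1) (.inr rfl)) hn
    · exact absurd (h2 ▸ h.pos_gateway _ m) hn

theorem q_uplink_cl {t n b a} (hne : e.q t n b (.uplink, a) ≠ 0) : N.cl n = N.cl a.1 := by
  induction t generalizing n with
  | zero => exact absurd (h.q_zero _ _ _) hne
  | succ t ih =>
    rcases h.contents_q_cases hne with h1 | ⟨n', h1⟩ | h1
    · exact ih h1
    · exact (N.link_cl _ _ (h.link_of_sendI h1).1).symm.trans (ih (h.q_of_sendI h1))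
    · rcases h.injectI_cases h1 with ⟨h0, -⟩ | ⟨-, h3, h2⟩ | ⟨h0, -⟩ | ⟨h0, -⟩
      · exact absurd h0 (by simp)
      · rw [h.u_source (h.u_of_sendII h2) h3]
      · exact absurd h0 (by simp)
      · exact absurd h0 (by simp)

theorem w_gateway {t g l a} (hne : e.w t g l a ≠ 0) :
    N.IsGateway g ∧ l ≠ g ∧ (¬ N.IsGateway l → a.2.2 = g ∧ a.2.1 = l) := by
  induction t with
  | zero => exact absurd (h.w_zero _ _ _) hne
  | succ t ih =>
    have hc := h.contents t
    have hfin : a.2.2 = g → a.2.1 = l → N.ValidAt x (.inl g) a →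
        N.IsGateway g ∧ l ≠ g ∧ (¬ N.IsGateway l → a.2.2 = g ∧ a.2.1 = l) := by
      intro h0 h3 h2
      have hg : N.IsGateway g := h0 ▸ h2.2.2.1
      refine ⟨hg, fun hlg => (h.traffic.2 _ _ h2.1).2.2 ?_, fun _ => ⟨h0, h3⟩⟩
      rw [h3, hlg]
      exact hg
    rcases h.contents_w_cases hne with h1 | ⟨hg, h0, n, h1⟩ | ⟨h0, h3, ⟨n, h1⟩ | ⟨m, h2, h1⟩⟩
    · exact ih h1
    · have hq := h.q_of_sendI h1
      have h2 := hc.q_valid _ _ _ _ hq (by simp)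
      -- An uplink packet whose destination gateway is the gateway just reached would have its
      -- source and its destination in one cluster.
      refine ⟨hg, fun hlg => h2.2.1 ?_, fun hl => absurd (h0 ▸ h2.2.2.1) hl⟩
      rw [← h2.2.2.2.1, h0, hlg, ← h.q_uplink_cl hq]
      exact hc.q_cl _ _ _ hq
    · exact hfin h0 h3 ((hc.q_valid _ _ _ _ (h.q_of_sendI h1) (by simp)).step
          (N.link_cl _ _ (h.link_of_sendI h1).1))
    · refine hfin h0 h3 ((hc.u_valid _ _ _ (h.u_of_sendII h1)).step ?_)
      rw [← h2]
      exact (pos (t / T) m).2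

theorem sendII_internal {t s l c a} (hs : ¬ N.IsGateway s) (hc : c ≠ some l) :
    e.sendII t (.inl s) l c a = 0 := by
  by_contra hne
  rcases c with _ | b
  · obtain ⟨-, m, hm, -⟩ := h.sendII_inl_none hne
    exact hs (hm ▸ h.pos_gateway _ m)
  · rcases (h.sendII_some hne).2 with h1 | h1
    · exact hs h1.1
    · exact hc (by rw [h1.1])

theorem fromGateway_internal {t g a} (hg : ¬ N.IsGateway g) : Network.fromGateway e t g a = 0 := by
  by_contra hne
  obtain ⟨n, hn⟩ := h.fromGateway_ne_zero hne
  exact hg ((h.contents t).q_gateway _ _ _ _ (h.q_of_sendI hn) (.inr rfl))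

theorem fromMobile_internal {t g l a} (hg : ¬ N.IsGateway g) : N.fromMobile T pos e t g l a = 0 := by
  by_contra hne
  obtain ⟨m, hm, -⟩ := h.fromMobile_ne_zero hne
  exact hg (hm ▸ h.pos_gateway _ m)

theorem release_internal {t g l a} (hg : ¬ N.IsGateway g) : e.release t g l a = 0 := by
  by_contra hne
  exact hg (h.regulated_of_release hne).1

theorem newInter_gateway {t s l a} (hs : N.IsGateway s) : N.newInter x T e t s l a = 0 := by
  by_contra hne
  exact (h.newInter_ne_zero hne).2.1 hs

/-- Uplink transfers, wireless hops and the arrival in the real queue move packets within the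
quantities counted. Only generation adds, and only the regulator removes. -/
theorem uplinkMass_succ (t : ℕ) {g l : V} {a : Header V} (hg : N.IsGateway g)
    (hgl : l ≠ g) (ha : a.2.2 = l) :
    e.uplinkMass N (t + 1) g a + e.w (t + 1) g l a
      = e.uplinkMass N t g a + e.w t g l a + ∑ s, N.newInter x T e t s g a - e.release t g l a := by
  have h1 : ∀ s, (if N.IsGateway s then 0 else e.u (t + 1) (.inl s) g a)
      = (if N.IsGateway s then 0 else e.u t (.inl s) g a) - N.injectI x e t s g (.uplink, a)
        + N.newInter x T e t s g a := by
    intro s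
    by_cases hs : N.IsGateway s
    · simp [hs, Network.injectI, h.newInter_gateway hs]
    · have hsg : g ≠ s := fun h' => hs (h' ▸ hg)
      have h2 : ∑ c, e.sendII t (.inl s) g c a = e.sendII t (.inl s) g (some g) a :=
        Finset.sum_eq_single _ (fun c _ hc => h.sendII_internal hs hc) (by simp)
      simp only [hs, if_false, Network.injectI, not_false_eq_true, if_true]
      rw [h.u_succ_inl, if_neg hsg, h.fromGateway_internal hs, h.fromMobile_internal hs,
        h.release_internal hs, h2]
      simp
  have h3 := h.sum_q_succ t g (.uplink, a)
  rw [h.injectI_self t g .uplink a (.inl rfl)] at h3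
  have h4 := h.w_succ t g l a
  rw [if_pos ⟨hg, ha⟩, if_neg (fun h' => hgl (ha.symm.trans h'.1))] at h4
  unfold Execution.uplinkMass
  rw [Finset.sum_congr rfl fun s _ => h1 s, h3, h4, Finset.sum_add_distrib, Finset.sum_sub_distrib]
  ring

theorem sum_pos_le (t : ℕ) (f : V → ℝ) (hf : ∀ n, 0 ≤ f n) :
    ∑ m, f (pos t m).1 ≤ ∑ n, f n := by
  rw [← Finset.sum_image (s := Finset.univ) (g := fun m => (pos t m).1) (f := f)
    (fun a _ b _ hab => pos_injective pos t hab)]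
  exact Finset.sum_le_sum_of_subset_of_nonneg (Finset.subset_univ _) fun n _ _ => hf n

theorem sum_injectI_header_le (t : ℕ) (n : V) (a : Header V) :
    ∑ b, (N.injectI x e t n b (.uplink, a) + N.injectI x e t n b (.relay, a))
      ≤ ∑ l, if N.IsGateway l then ∑ b, e.sendII t (.inl n) l (some b) a else 0 := by
  have hnn : ∀ l c, 0 ≤ e.sendII t (.inl n) l c a := fun l c => (h.servesII t _ l).nonneg c a
  by_cases hn : N.IsGateway n
  · have h1 : ∀ b, N.injectI x e t n b (.uplink, a) + N.injectI x e t n b (.relay, a)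
        ≤ ∑ l, if N.IsGateway l then e.sendII t (.inl n) l (some b) a else 0 := by
      intro b
      simp only [Network.injectI, hn, not_true, if_false, true_and, zero_add]
      split_ifs with hb
      · refine Finset.sum_le_sum fun l _ => ?_
        split_ifs with hl
        · exact le_rfl
        · refine le_of_eq ?_
          by_contra hne
          rcases (h.sendII_some hne).2 with h2 | ⟨rfl, -⟩
          · exact hl h2.2.1
          · exact hl hb
      · refine Finset.sum_nonneg fun l _ => ?_
        split_ifs
        · exact hnn _ _
        · exact le_rfl
    refine (Finset.sum_le_sum fun b _ => h1 b).trans ?_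
    rw [Finset.sum_comm]
    refine Finset.sum_le_sum fun l _ => ?_
    split_ifs
    · exact le_rfl
    · simp
  · refine Finset.sum_le_sum fun b _ => ?_
    simp only [Network.injectI, hn, not_false_eq_true, if_true, false_and, if_false, add_zero]
    split_ifs with hb
    · exact Finset.single_le_sum (f := fun b' => e.sendII t (.inl n) b (some b') a)
        (fun b' _ => hnn _ _) (Finset.mem_univ b)
    · refine le_of_eq ?_
      by_contra hne
      exact hb ((h.contents t).u_internal _ _ _ (h.u_of_sendII hne) hn).1

omit h in
theorem sum_gateway (f : V → ℝ) (N : Network ι V J) :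
    (∑ l, if N.IsGateway l then f l else 0) = ∑ l ∈ Finset.univ.filter N.IsGateway, f l :=
  (Finset.sum_filter _ _).symm

/-- The whole journey up to `g` is counted, including the real queues kept for gateways, whose
releases return to the counted type-II queues. Arrival at `g` feeds the real queue `(g,d)`, whose
release is the only exit. -/
theorem headerMass_succ_le (t : ℕ) {g d : V} {a : Header V} (hg : N.IsGateway g)
    (hd : ¬ N.IsGateway d) (ha : a.2.2 = g) (had : a.2.1 = d) :
    e.headerMass N (t + 1) a + e.w (t + 1) g d a
      ≤ e.headerMass N t a + e.w t g d a + ∑ l, ∑ s, N.newInter x T e t s l a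
        - e.release t g d a := by
  set G := Finset.univ.filter N.IsGateway with hG
  have hgG : g ∈ G := by simp [hG, hg]
  have hnn : ∀ n l c, 0 ≤ e.sendII t n l c a := fun n l c => (h.servesII t n l).nonneg c a
  -- A mobile stores a packet only under its destination gateway, here `g`.
  have hmob : ∀ m l, l ≠ g → e.sendII t (.inr m) l none a = 0 := by
    intro m l hl
    by_contra hne
    exact hl (((h.contents t).u_mobile _ _ _ (h.u_of_sendII hne)).2.symm.trans ha)
  -- queues at nodes
  have h1 : ∑ l ∈ G, ∑ n, e.u (t + 1) (.inl n) l a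
      ≤ ∑ l ∈ G, ∑ n, e.u t (.inl n) l a - ∑ l ∈ G, ∑ n, ∑ c, e.sendII t (.inl n) l c a
        + ∑ l, ∑ s, N.newInter x T e t s l a + ∑ l ∈ G, ∑ n, e.release t n l a
        + (∑ n, (Network.fromGateway e t n a + N.fromMobile T pos e t n g a)
          - (Network.fromGateway e t g a + N.fromMobile T pos e t g g a)) := by
    have e1 : ∑ l ∈ G, ∑ s, N.newInter x T e t s l a ≤ ∑ l, ∑ s, N.newInter x T e t s l a :=
      Finset.sum_le_sum_of_subset_of_nonneg (Finset.subset_univ _) fun l _ _ =>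
        Finset.sum_nonneg fun s _ => h.newInter_nonneg t s l a
    have e2 : ∀ n, ∑ l ∈ G, (if l = n then 0 else
        (if a.2.2 = l then Network.fromGateway e t n a else 0) + N.fromMobile T pos e t n l a)
        = (Network.fromGateway e t n a + N.fromMobile T pos e t n g a)
          - if n = g then Network.fromGateway e t g a + N.fromMobile T pos e t g g a else 0 := by
      intro n
      rw [Finset.sum_eq_single_of_mem g hgG]
      · by_cases hgn : g = n
        · subst hgn
          simp
        · rw [if_neg hgn, if_pos ha, if_neg (Ne.symm hgn), sub_zero]
      · intro l _ hl
        rw [if_neg (show ¬ a.2.2 = l from fun h' => hl (h'.symm.trans ha))]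
        split_ifs
        · rfl
        · rw [zero_add]
          refine Finset.sum_eq_zero fun m _ => ?_
          rw [hmob m l hl, ite_self]
    have e3 : ∑ l ∈ G, ∑ n, (if l = n then 0 else
        (if a.2.2 = l then Network.fromGateway e t n a else 0) + N.fromMobile T pos e t n l a)
        = ∑ n, (Network.fromGateway e t n a + N.fromMobile T pos e t n g a)
          - (Network.fromGateway e t g a + N.fromMobile T pos e t g g a) := by
      rw [Finset.sum_comm, Finset.sum_congr rfl fun n _ => e2 n, Finset.sum_sub_distrib]
      simp
    rw [← e3]
    simp only [h.u_succ_inl, Finset.sum_add_distrib, Finset.sum_sub_distrib] at e1 ⊢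
    linarith
  -- queues at mobiles
  have h2 : ∑ l ∈ G, ∑ m, e.u (t + 1) (.inr m) l a
      ≤ ∑ l ∈ G, ∑ m, e.u t (.inr m) l a - ∑ m, e.sendII t (.inr m) g none a
        + ∑ l ∈ G, ∑ n, e.sendII t (.inl n) l none a := by
    have e1 : ∀ l, ∑ m, e.sendII t (.inl (pos (t / T) m).1) l none a
        ≤ ∑ n, e.sendII t (.inl n) l none a := fun l =>
      h.sum_pos_le (t / T) (fun n => e.sendII t (.inl n) l none a) fun n => hnn _ _ _
    have e2 : ∑ m, e.sendII t (.inr m) g none a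
        ≤ ∑ l ∈ G, ∑ m, ∑ c, e.sendII t (.inr m) l c a := by
      refine le_trans (Finset.sum_le_sum fun m _ => ?_) (Finset.single_le_sum
        (f := fun l => ∑ m, ∑ c, e.sendII t (.inr m) l c a)
        (fun l _ => Finset.sum_nonneg fun m _ => Finset.sum_nonneg fun c _ => hnn _ _ _) hgG)
      exact Finset.single_le_sum (f := fun c => e.sendII t (.inr m) g c a)
        (fun c _ => hnn _ _ _) (Finset.mem_univ none)
    have e3 := Finset.sum_le_sum fun l (_ : l ∈ G) => e1 l
    simp only [h.u_succ_inr, Finset.sum_add_distrib, Finset.sum_sub_distrib]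
    linarith
  have h3 : ∑ n, N.fromMobile T pos e t n g a = ∑ m, e.sendII t (.inr m) g none a := by
    unfold Network.fromMobile
    rw [Finset.sum_comm]
    exact Finset.sum_congr rfl fun m _ => by simp
  have h4 : ∑ l ∈ G, ∑ n, ∑ c, e.sendII t (.inl n) l c a
      = ∑ l ∈ G, ∑ n, e.sendII t (.inl n) l none a
        + ∑ n, ∑ l ∈ G, ∑ b, e.sendII t (.inl n) l (some b) a := by
    rw [Finset.sum_comm (s := Finset.univ) (t := G), ← Finset.sum_add_distrib]
    refine Finset.sum_congr rfl fun l _ => ?_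
    rw [← Finset.sum_add_distrib]
    exact Finset.sum_congr rfl fun n _ => Fintype.sum_option _
  have h5 : ∑ n, ∑ b, (N.injectI x e t n b (.uplink, a) + N.injectI x e t n b (.relay, a))
      ≤ ∑ n, ∑ l ∈ G, ∑ b, e.sendII t (.inl n) l (some b) a := by
    refine Finset.sum_le_sum fun n _ => ?_
    rw [← sum_gateway]
    exact h.sum_injectI_header_le t n a
  rw [Finset.sum_comm] at h5
  simp only [Finset.sum_add_distrib] at h5
  -- real queues for gateways
  have h6 : ∑ l ∈ G, ∑ b, e.w (t + 1) b l a ≤ ∑ l ∈ G, ∑ b, e.w t b l a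
      - ∑ l ∈ G, ∑ b, e.release t b l a + ∑ b, ∑ n, e.sendI t n b b (.uplink, a) := by
    have e1 : ∑ l ∈ G, ∑ b, (if N.IsGateway b ∧ a.2.2 = l then
        ∑ n, e.sendI t n b b (.uplink, a) else 0) ≤ ∑ b, ∑ n, e.sendI t n b b (.uplink, a) := by
      rw [Finset.sum_eq_single_of_mem g hgG]
      · refine Finset.sum_le_sum fun b _ => ?_
        split_ifs
        · exact le_rfl
        · exact Finset.sum_nonneg fun n _ => (h.servesI t n b).nonneg _ _
      · intro l _ hl
        exact Finset.sum_eq_zero fun b _ => if_neg fun h' => hl (h'.2.symm.trans ha)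
    have e2 : ∑ l ∈ G, ∑ b, (if a.2.2 = b ∧ a.2.1 = l then
        Network.fromGateway e t b a + N.fromMobile T pos e t b b a else 0) = 0 := by
      refine Finset.sum_eq_zero fun l hlG => Finset.sum_eq_zero fun b _ => if_neg fun h' => hd ?_
      rw [← had, h'.2]
      exact (Finset.mem_filter.1 hlG).2
    simp only [h.w_succ, Finset.sum_add_distrib, Finset.sum_sub_distrib] at e1 e2 ⊢
    linarith
  have h7 : ∀ k, k = .uplink ∨ k = .relay → ∑ b, ∑ n, e.q (t + 1) n b (k, a)
      = ∑ b, ∑ n, e.q t n b (k, a) - ∑ b, ∑ n, e.sendI t n b b (k, a)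
        + ∑ b, ∑ n, N.injectI x e t n b (k, a) := by
    intro k hk
    rw [← Finset.sum_sub_distrib, ← Finset.sum_add_distrib]
    refine Finset.sum_congr rfl fun b _ => ?_
    rw [h.sum_q_succ, h.injectI_self t b k a hk, sub_zero]
  have h8 : e.w (t + 1) g d a = e.w t g d a - e.release t g d a
      + (Network.fromGateway e t g a + N.fromMobile T pos e t g g a) := by
    rw [h.w_succ, if_neg (fun h' => hd ?_), if_pos ⟨ha, had⟩, add_zero]
    rw [← h'.2, ha]
    exact hg
  have h9 := h7 .uplink (.inl rfl)
  have h10 := h7 .relay (.inr rfl)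
  have h11 : ∑ n, Network.fromGateway e t n a = ∑ b, ∑ n, e.sendI t n b b (.relay, a) := rfl
  unfold Execution.headerMass
  simp only [sum_gateway, Fintype.sum_sum_type, Finset.sum_add_distrib] at *
  linarith

/-- This is `le_of_served` for the sum over the headers in `S` of upstream mass `M` and real queue.
`hreg` makes the inflow of this sum the traffic to which the regulator is tuned. -/
theorem wLen_le_of_mass {g l : V} (S : Header V → Prop) {M I : ℕ → Header V → ℝ} {Z : ℝ} {n : ℕ}
    (hS : ∀ t a, e.w t g l a ≠ 0 → S a) (hM : ∀ t a, 0 ≤ M t a) (hM0 : ∀ a, M 0 a = 0)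
    (hI : ∀ t a, 0 ≤ I t a)
    (hstep : ∀ t a, S a → M (t + 1) a + e.w (t + 1) g l a
      ≤ M t a + e.w t g l a + I t a - e.release t g l a)
    (hreg : ∀ t, (1 + δ) * (∑ a ∈ Finset.univ.filter S, I t a) = N.regulated x T δ e t g l)
    (hZ : ∀ t ≤ n, ∑ a, M t a ≤ Z) : ∀ t ≤ n, e.wLen t g l ≤ Z + ∑ s, ∑ d, x s d := by
  set F := Finset.univ.filter S with hF
  have hδ : 0 < 1 + δ := by linarith [h.δ_nonneg]
  have hw : ∀ t, ∑ a ∈ F, e.w t g l a = e.wLen t g l := fun t =>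
    Finset.sum_subset (Finset.subset_univ F) fun a _ ha => by
      by_contra hne
      exact ha (by simpa [hF] using hS t a hne)
  have hr : ∀ t, ∑ a ∈ F, e.release t g l a = min (e.wLen t g l) ((1 + δ) * ∑ a ∈ F, I t a) := by
    intro t
    have h1 := (h.servesW t g l).2.2.2
    rw [hreg]
    simp only [Finset.univ_unique, Finset.sum_singleton] at h1
    refine Eq.trans ?_ h1
    refine Finset.sum_subset (Finset.subset_univ F) fun a _ ha => ?_
    by_contra hne
    exact ha (by simpa [hF] using hS t a (h.w_of_release hne))
  have hZ0 : 0 ≤ Z := (Finset.sum_nonneg fun a _ => hM 0 a).trans (hZ 0 (Nat.zero_le n))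
  intro t ht
  have hbound : ∀ t, ∑ a ∈ F, I t a ≤ ∑ s, ∑ d, x s d := fun t =>
    le_of_mul_le_mul_left ((hreg t).le.trans (h.regulated_le t g l)) hδ
  refine le_trans ?_ (le_of_served (Y := fun t => ∑ a ∈ F, (M t a + e.w t g l a))
    (w := fun t => e.wLen t g l) (a := fun t => ∑ a ∈ F, I t a) h.δ_nonneg hZ0
    (fun t => Finset.sum_nonneg fun a _ => hI t a) hbound ?_ (fun t => ?_) (fun t ht => ?_) t ht)
  · simp only [Finset.sum_add_distrib]
    rw [hw]
    linarith [Finset.sum_nonneg fun a (_ : a ∈ F) => hM t a]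
  · simp [hM0, h.w_zero]
  · have h1 := Finset.sum_le_sum fun a (ha : a ∈ F) => hstep t a (Finset.mem_filter.1 ha).2
    rw [← hr]
    simp only [Finset.sum_add_distrib, Finset.sum_sub_distrib] at h1 ⊢
    linarith
  · simp only [Finset.sum_add_distrib]
    rw [hw]
    have h1 := Finset.sum_le_sum_of_subset_of_nonneg (Finset.subset_univ F)
      fun a _ _ => hM t a
    linarith [hZ t ht]

omit h in
theorem sum_newInter_header (t l) (a : Header V) : ∑ s, N.newInter x T e t s l a
    = if N.cl a.1 ≠ N.cl a.2.1 ∧ e.srcGate (t / T) a.1 a.2.1 = l ∧ e.dstGate (t / T) a.1 a.2.1 = a.2.2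
      then x a.1 a.2.1 else 0 := by
  rw [Finset.sum_eq_single a.1]
  · simp only [Network.newInter, true_and]
  · intro s _ hs
    exact if_neg fun h' => hs h'.1.symm
  · simp

/-- The regulator uses the traffic assigned at present, not the packets that arrive at present. That
is exactly the inflow of upstream mass and real queue taken together. -/
theorem uplink_regulated (t) {g l : V} (hl : N.IsGateway l) :
    (1 + δ) * (∑ a ∈ Finset.univ.filter (fun a : Header V => a.2.2 = l),
      ∑ s, N.newInter x T e t s g a) = N.regulated x T δ e t g l := by
  unfold Network.regulated
  rw [if_pos hl, Finset.sum_filter]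
  simp only [sum_newInter_header, Fintype.sum_prod_type, Finset.sum_ite_eq', Finset.mem_univ, if_true]

theorem header_regulated (t) {g d : V} (hd : ¬ N.IsGateway d) :
    (1 + δ) * (∑ a ∈ Finset.univ.filter (fun a : Header V => a.2.2 = g ∧ a.2.1 = d),
      ∑ l, ∑ s, N.newInter x T e t s l a) = N.regulated x T δ e t g d := by
  unfold Network.regulated
  rw [if_neg hd, Finset.sum_filter]
  simp only [sum_newInter_header, Fintype.sum_prod_type]
  congr 1
  refine Finset.sum_congr rfl fun s _ => ?_
  rw [Finset.sum_eq_single d, Finset.sum_eq_single g, if_pos ⟨rfl, rfl⟩,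
    Finset.sum_eq_single (e.srcGate (t / T) s d)]
  · simp
  · intro l _ hl
    exact if_neg fun h' => hl h'.2.1.symm
  · simp
  · intro g' _ hg'
    exact if_neg fun h' => hg' h'.1
  · simp
  · intro d' _ hd'
    exact Finset.sum_eq_zero fun g' _ => if_neg fun h' => hd' h'.2
  · simp

theorem uplinkMass_nonneg (t g a) : 0 ≤ e.uplinkMass N t g a := by
  refine add_nonneg (Finset.sum_nonneg fun s _ => ?_) (Finset.sum_nonneg fun n _ => h.q_nonneg _ _ _ _)
  split_ifs
  · exact le_rfl
  · exact h.u_nonneg _ _ _ _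

theorem headerMass_nonneg (t a) : 0 ≤ e.headerMass N t a := by
  refine add_nonneg (add_nonneg (Finset.sum_nonneg fun l _ => ?_) (add_nonneg
    (Finset.sum_nonneg fun b _ => Finset.sum_nonneg fun n _ => h.q_nonneg _ _ _ _)
    (Finset.sum_nonneg fun b _ => Finset.sum_nonneg fun n _ => h.q_nonneg _ _ _ _)))
    (Finset.sum_nonneg fun l _ => ?_)
  · split_ifs
    · exact Finset.sum_nonneg fun n _ => h.u_nonneg _ _ _ _
    · exact le_rfl
  · split_ifs
    · exact Finset.sum_nonneg fun n _ => h.w_nonneg _ _ _ _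
    · exact le_rfl

theorem sum_uplinkMass_le (t g) :
    ∑ a, e.uplinkMass N t g a ≤ ∑ s, e.uLen t (.inl s) g + ∑ n, e.qLen t n g := by
  unfold Execution.uplinkMass
  rw [Finset.sum_add_distrib]
  refine add_le_add ?_ ?_
  · rw [Finset.sum_comm]
    refine Finset.sum_le_sum fun s _ => Finset.sum_le_sum fun a _ => ?_
    split_ifs
    · exact h.u_nonneg _ _ _ _
    · exact le_rfl
  · rw [Finset.sum_comm]
    refine Finset.sum_le_sum fun n _ => ?_
    unfold Execution.qLen
    rw [Fintype.sum_prod_type (fun a : Leg × Header V => e.q t n g a)]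
    exact Finset.single_le_sum (f := fun k => ∑ a, e.q t n g (k, a))
      (fun k _ => Finset.sum_nonneg fun a _ => h.q_nonneg _ _ _ _) (Finset.mem_univ _)

theorem sum_headerMass_le (t) : ∑ a, e.headerMass N t a
    ≤ ∑ l, ∑ n, e.uLen t n l + ∑ b, ∑ n, e.qLen t n b
      + ∑ l, if N.IsGateway l then ∑ b, e.wLen t b l else 0 := by
  unfold Execution.headerMass
  rw [Finset.sum_add_distrib, Finset.sum_add_distrib]
  refine add_le_add (add_le_add ?_ ?_) ?_
  · rw [Finset.sum_comm]
    refine Finset.sum_le_sum fun l _ => ?_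
    unfold Execution.uLen
    split_ifs
    · rw [Finset.sum_comm]
    · rw [Finset.sum_const_zero]
      exact Finset.sum_nonneg fun n _ => h.uLen_nonneg _ _ _
  · simp only [← Finset.sum_add_distrib]
    rw [Finset.sum_comm]
    refine Finset.sum_le_sum fun b _ => ?_
    rw [Finset.sum_comm]
    refine Finset.sum_le_sum fun n _ => ?_
    unfold Execution.qLen
    rw [Fintype.sum_prod_type (fun a : Leg × Header V => e.q t n b a), sum_leg, Finset.sum_add_distrib]
    have h2 : ∀ k, 0 ≤ ∑ a, e.q t n b (k, a) := fun k => Finset.sum_nonneg fun a _ => h.q_nonneg _ _ _ _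
    have := h2 .intra
    have := h2 .downlink
    linarith
  · rw [Finset.sum_comm]
    refine Finset.sum_le_sum fun l _ => ?_
    unfold Execution.wLen
    split_ifs
    · rw [Finset.sum_comm]
    · simp

variable (V J) in
/-- Slope of the bound on real queues in terms of the other queues. -/
def _root_.ICN.realSlope : ℝ :=
  2 * Fintype.card V + (Fintype.card V * Fintype.card (V ⊕ J) + Fintype.card V * Fintype.card V)
    + Fintype.card V * (Fintype.card V * (2 * Fintype.card V))

variable (V) in
/-- Constant term of the bound on real queues in terms of the other queues. -/
noncomputable def _root_.ICN.realOffset (x : V → V → ℝ) : ℝ :=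
  Fintype.card V * (Fintype.card V * ∑ s, ∑ d, x s d) + ∑ s, ∑ d, x s d

/-- Real queues are bounded in terms of type-I and regulated type-II queues. -/
theorem wLen_le {n : ℕ} {Z : ℝ} (hq : ∀ t ≤ n, ∀ a b, e.qLen t a b ≤ Z)
    (hu : ∀ t ≤ n, ∀ a l, e.uLen t a l ≤ Z) (hZ : 0 ≤ Z) :
    ∀ t ≤ n, ∀ g l, e.wLen t g l ≤ realSlope V J * Z + realOffset V x := by
  have hA := h.sum_x_nonneg
  set A := ∑ s, ∑ d, x s d with hAdef
  have hzero : ∀ t g l, ¬ (N.IsGateway g ∧ l ≠ g) → e.wLen t g l = 0 := by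
    intro t g l hgl
    refine Finset.sum_eq_zero fun a _ => ?_
    by_contra hne
    exact hgl ⟨(h.w_gateway hne).1, (h.w_gateway hne).2.1⟩
  have hV : (0 : ℝ) ≤ Fintype.card V := Nat.cast_nonneg _
  have hVJ : (0 : ℝ) ≤ Fintype.card (V ⊕ J) := Nat.cast_nonneg _
  -- Queues kept for gateways come first, because only type-I and regulated type-II queues lie
  -- upstream of them.
  have h1 : ∀ t ≤ n, ∀ g l, N.IsGateway l → e.wLen t g l ≤ 2 * Fintype.card V * Z + A := by
    intro t ht g l hl
    by_cases hgl : N.IsGateway g ∧ l ≠ g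
    swap
    · rw [hzero t g l hgl]
      positivity
    refine h.wLen_le_of_mass (n := n) (M := fun t a => e.uplinkMass N t g a)
      (I := fun t a => ∑ s, N.newInter x T e t s g a) (fun a => a.2.2 = l)
      (fun t a hne => (h.contents t).w_header _ _ _ hne hl)
      (fun t a => h.uplinkMass_nonneg t g a) (fun a => ?_)
      (fun t a => Finset.sum_nonneg fun s _ => h.newInter_nonneg t s g a)
      (fun t a ha => (h.uplinkMass_succ t hgl.1 hgl.2 ha).le)
      (fun t => h.uplink_regulated t hl) (fun t ht => ?_) t ht
    · simp [Execution.uplinkMass, h.u_zero, h.q_zero]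
    · refine (h.sum_uplinkMass_le t g).trans ?_
      have e1 := sum_le_card_mul (fun s => e.uLen t (.inl s) g) Z fun s => hu t ht _ _
      have e2 := sum_le_card_mul (fun s => e.qLen t s g) Z fun s => hq t ht _ _
      linarith
  intro t ht g l
  have hVV : (0 : ℝ) ≤ Fintype.card V * (Fintype.card V * (2 * Fintype.card V)) := by positivity
  have hVV2 : (0 : ℝ) ≤ Fintype.card V * Fintype.card (V ⊕ J) + Fintype.card V * Fintype.card V := by
    positivity
  unfold realSlope realOffset
  by_cases hl : N.IsGateway l
  · refine (h1 t ht g l hl).trans ?_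
    have e1 := mul_nonneg hVV hZ
    have e2 := mul_nonneg hVV2 hZ
    have e3 : 0 ≤ Fintype.card V * (Fintype.card V * A) := by positivity
    linarith
  by_cases hg : N.IsGateway g
  swap
  · rw [hzero t g l fun h' => hg h'.1]
    positivity
  -- Upstream of the queues kept for destinations are also the real queues bounded in `h1`; they
  -- enter `Z` with that bound.
  have e0 := h.wLen_le_of_mass (n := n) (g := g) (l := l) (M := fun t a => e.headerMass N t a)
      (I := fun t a => ∑ l, ∑ s, N.newInter x T e t s l a)
      (Z := (Fintype.card V * Fintype.card (V ⊕ J) + Fintype.card V * Fintype.card V) * Z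
        + Fintype.card V * (Fintype.card V * (2 * Fintype.card V * Z + A)))
      (fun a => a.2.2 = g ∧ a.2.1 = l)
      (fun t a hne => (h.w_gateway hne).2.2 hl)
      (fun t a => h.headerMass_nonneg t a) (fun a => ?_)
      (fun t a => Finset.sum_nonneg fun l _ => Finset.sum_nonneg fun s _ => h.newInter_nonneg t s l a)
      (fun t a ha => h.headerMass_succ_le t hg hl ha.1 ha.2)
      (fun t => by convert h.header_regulated t hl) (fun t ht => ?_) t ht
  · refine e0.trans ?_
    have e1 : (0 : ℝ) ≤ 2 * Fintype.card V * Z := by positivity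
    linarith
  · simp [Execution.headerMass, h.u_zero, h.q_zero, h.w_zero]
  · refine (h.sum_headerMass_le t).trans ?_
    have e1 := sum_le_card_mul (fun l => ∑ n, e.uLen t n l) _ fun l =>
      sum_le_card_mul (fun n => e.uLen t n l) Z fun s => hu t ht _ _
    have e2 := sum_le_card_mul (fun b => ∑ n, e.qLen t n b) _ fun l =>
      sum_le_card_mul (fun n => e.qLen t n l) Z fun s => hq t ht _ _
    have e3 : (∑ l, if N.IsGateway l then ∑ b, e.wLen t b l else 0)
        ≤ Fintype.card V * (Fintype.card V * (2 * Fintype.card V * Z + A)) := by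
      refine sum_le_card_mul _ _ fun l => ?_
      split_ifs with hl
      · exact sum_le_card_mul _ _ fun b => h1 t ht b l hl
      · positivity
    linarith

end Run

/-! ### Finite Markov chains: Poisson equation, Markov property, variance -/

open MeasureTheory

/-- Maximum principle: the value at a maximum is an average with positive weight on any given state
for some power of the matrix. -/
theorem Network.eq_of_harmonic (N : Network ι V J) (j : J) {f : N.Port j → ℝ}
    (hf : ∀ y, ∑ y', N.trans j y y' * f y' = f y) (y y' : N.Port j) : f y = f y' := by
  have hpow : ∀ k : ℕ, ∀ y, ∑ y', (N.trans j ^ k) y y' * f y' = f y := by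
    intro k
    induction k with
    | zero => intro y; simp [Matrix.one_apply]
    | succ k ih =>
      intro y
      simp only [pow_succ, Matrix.mul_apply, Finset.sum_mul]
      rw [Finset.sum_comm]
      simp only [mul_assoc, ← Finset.mul_sum, hf]
      exact ih y
  have hrow : ∀ k : ℕ, ∀ y, ∑ y', (N.trans j ^ k) y y' = 1 := by
    intro k
    induction k with
    | zero => intro y; simp [Matrix.one_apply]
    | succ k ih =>
      intro y
      simp only [pow_succ, Matrix.mul_apply]
      rw [Finset.sum_comm]
      simp only [← Finset.mul_sum, N.trans_row_sum, mul_one]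
      exact ih y
  have : Nonempty (N.Port j) := ⟨y⟩
  obtain ⟨y₀, hy₀⟩ := Finite.exists_max f
  have key : ∀ y, f y = f y₀ := by
    intro y
    obtain ⟨k, -, hk⟩ := (Matrix.isIrreducible_iff_exists_pow_pos (N.trans_nonneg j)).1
      (N.trans_irreducible j) y₀ y
    have h1 : ∑ y', (N.trans j ^ k) y₀ y' * (f y₀ - f y') = 0 := by
      simp only [mul_sub, Finset.sum_sub_distrib, ← Finset.sum_mul, hrow, hpow]
      ring
    rw [Finset.sum_eq_zero_iff_of_nonneg] at h1
    · have h2 := h1 y (Finset.mem_univ y)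
      rcases mul_eq_zero.1 h2 with h3 | h3
      · exact absurd h3 hk.ne'
      · linarith
    · intro y' _
      exact mul_nonneg (Matrix.pow_apply_nonneg (N.trans_nonneg j) k _ _) (by linarith [hy₀ y'])
  rw [key y, key y']

/-- The Poisson equation of the indicator of a state of an irreducible finite chain. -/
theorem Network.exists_poisson (N : Network ι V J) (j : J) (g : N.Port j) :
    ∃ f : N.Port j → ℝ, ∀ y, f y - ∑ y', N.trans j y y' * f y'
      = (if y = g then 1 else 0) - N.stat j g := by
  -- The map `f ↦ f - P f` kills constants; adding the stationary mean makes it injective, hence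
  -- surjective in finite dimension.
  let L : (N.Port j → ℝ) →ₗ[ℝ] (N.Port j → ℝ) :=
    { toFun := fun f y => f y - ∑ y', N.trans j y y' * f y' + ∑ y', N.stat j y' * f y'
      map_add' := fun f f' => by
        ext y
        simp only [Pi.add_apply, mul_add, Finset.sum_add_distrib]
        ring
      map_smul' := fun a f => by
        ext y
        simp only [Pi.smul_apply, smul_eq_mul, RingHom.id_apply, mul_left_comm _ a,
          ← Finset.mul_sum]
        ring }
  have hL : ∀ f y, L f y = f y - ∑ y', N.trans j y y' * f y' + ∑ y', N.stat j y' * f y' :=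
    fun f y => rfl
  have hstat : ∀ f, ∑ y, N.stat j y * L f y = ∑ y, N.stat j y * f y := by
    intro f
    have h1 : ∑ y, N.stat j y * ∑ y', N.trans j y y' * f y' = ∑ y, N.stat j y * f y := by
      simp only [Finset.mul_sum]
      rw [Finset.sum_comm]
      simp only [← mul_assoc, ← Finset.sum_mul, N.stat_invariant]
    simp only [hL, mul_add, mul_sub, Finset.sum_add_distrib, Finset.sum_sub_distrib]
    rw [h1, ← Finset.sum_mul, N.stat_sum]
    ring
  have hinj : Function.Injective L := by
    rw [injective_iff_map_eq_zero]
    intro f hf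
    have h1 := hstat f
    rw [hf] at h1
    simp only [Pi.zero_apply, mul_zero, Finset.sum_const_zero] at h1
    have h2 : ∀ y, ∑ y', N.trans j y y' * f y' = f y := by
      intro y
      have := congrFun hf y
      rw [hL, ← h1] at this
      simp only [Pi.zero_apply] at this
      linarith
    ext y
    have h3 : ∑ y', N.stat j y' * f y' = f y := by
      rw [Finset.sum_congr rfl fun y' _ => by rw [N.eq_of_harmonic j h2 y' y], ← Finset.sum_mul,
        N.stat_sum, one_mul]
    rw [← h3, ← h1]
    rfl
  obtain ⟨f, hf⟩ := LinearMap.injective_iff_surjective.1 hinj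
    fun y => (if y = g then 1 else 0) - N.stat j g
  refine ⟨f, fun y => ?_⟩
  -- The right-hand side has stationary mean zero, so `f` has too, and the added term of `L`
  -- disappears.
  have h1 := hstat f
  rw [hf] at h1
  simp only [mul_sub, Finset.sum_sub_distrib, ← Finset.sum_mul, N.stat_sum, mul_ite, mul_one,
    mul_zero, Finset.sum_ite_eq', Finset.mem_univ, if_true, one_mul, sub_self] at h1
  have h2 := congrFun hf y
  rw [hL, ← h1, add_zero] at h2
  exact h2

/-- A process with values in a finite set that is a Markov chain with transition probabilities
`p`. -/
structure IsChain {S : Type*} [Fintype S] {Ω : Type*} [MeasurableSpace Ω] (P : Measure Ω)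
    (p : S → S → ℝ) (Y : Ω → ℕ → S) : Prop where
  measurable : ∀ τ s, MeasurableSet {ω | Y ω τ = s}
  cylinder : ∀ (n : ℕ) (c : ℕ → S), P {ω | ∀ k ≤ n + 1, Y ω k = c k} =
      P {ω | ∀ k ≤ n, Y ω k = c k} * ENNReal.ofReal (p (c n) (c (n + 1)))
  nonneg : ∀ s s', 0 ≤ p s s'
  row_sum : ∀ s, ∑ s', p s s' = 1

namespace IsChain

variable {S : Type*} [Fintype S] {Ω : Type*} [MeasurableSpace Ω] {P : Measure Ω}
    [IsProbabilityMeasure P] {p : S → S → ℝ} {Y : Ω → ℕ → S}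

/-- The trajectory that runs through the word `w` and then stops. -/
def extend {n : ℕ} (w : Fin (n + 1) → S) (k : ℕ) : S :=
  w ⟨min k n, Nat.lt_succ_of_le (min_le_right k n)⟩

/-- A functional of finitely many positions is a finite combination of cylinder indicators, whose
probabilities are all that the definition of the chain prescribes. -/
theorem eq_sum_extend {n : ℕ} {F : (ℕ → S) → ℝ} (hF : DependsOn F (Set.Iic n)) (c : ℕ → S) :
    F c = ∑ w : Fin (n + 1) → S, if ∀ k ≤ n, c k = extend w k then F (extend w) else 0 := by
  have h0 : ∀ k ≤ n, c k = extend (fun i : Fin (n + 1) => c i) k := fun k hk => by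
    simp only [extend, min_eq_left hk]
  rw [Finset.sum_eq_single (fun i : Fin (n + 1) => c i)]
  · rw [if_pos h0]
    exact hF fun k hk => h0 k hk
  · intro w _ hw
    refine if_neg fun h => hw ?_
    ext i
    have := h i (Nat.lt_succ_iff.1 i.2)
    simp only [extend, min_eq_left (Nat.lt_succ_iff.1 i.2)] at this
    exact this.symm
  · simp

variable (h : IsChain P p Y)
include h

theorem measurableSet_cylinder (n : ℕ) (c : ℕ → S) : MeasurableSet {ω | ∀ k ≤ n, Y ω k = c k} := by
  simp only [Set.ofPred_forall]
  exact MeasurableSet.iInter fun k => MeasurableSet.iInter fun _ => h.measurable k _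

theorem integrable_integral {n : ℕ} {F : (ℕ → S) → ℝ} (hF : DependsOn F (Set.Iic n)) :
    Integrable (fun ω => F (Y ω)) P ∧ ∫ ω, F (Y ω) ∂P
      = ∑ w : Fin (n + 1) → S, P.real {ω | ∀ k ≤ n, Y ω k = extend w k} * F (extend w) := by
  have h1 : (fun ω => F (Y ω)) = fun ω => ∑ w : Fin (n + 1) → S,
      Set.indicator {ω | ∀ k ≤ n, Y ω k = extend w k} (fun _ => F (extend w)) ω := by
    ext ω
    rw [eq_sum_extend hF]
    simp only [Set.indicator, Set.mem_ofPred_eq]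
  have h2 : ∀ w : Fin (n + 1) → S, Integrable
      (Set.indicator {ω | ∀ k ≤ n, Y ω k = extend w k} fun _ => F (extend w)) P := fun w =>
    (integrable_const _).indicator (h.measurableSet_cylinder n _)
  rw [h1]
  refine ⟨integrable_finsetSum _ fun w _ => h2 w, ?_⟩
  rw [integral_finsetSum _ fun w _ => h2 w]
  refine Finset.sum_congr rfl fun w _ => ?_
  rw [integral_indicator_const _ (h.measurableSet_cylinder n _), smul_eq_mul]

theorem integrable {n : ℕ} {F : (ℕ → S) → ℝ} (hF : DependsOn F (Set.Iic n)) :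
    Integrable (fun ω => F (Y ω)) P := (h.integrable_integral hF).1

/-- The Markov property. -/
theorem integral_mul_succ {n : ℕ} {G : (ℕ → S) → ℝ} (hG : DependsOn G (Set.Iic n)) (f : S → ℝ) :
    ∫ ω, G (Y ω) * f (Y ω (n + 1)) ∂P = ∫ ω, G (Y ω) * ∑ y, p (Y ω n) y * f y ∂P := by
  have hR : DependsOn (fun c : ℕ → S => G c * ∑ y, p (c n) y * f y) (Set.Iic n) := fun c c' hc => by
    simp only
    rw [hG hc, hc n (Set.mem_Iic.2 le_rfl)]
  have hL : DependsOn (fun c : ℕ → S => G c * f (c (n + 1))) (Set.Iic (n + 1)) := fun c c' hc => by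
    simp only
    rw [hG fun k hk => hc k (Set.mem_Iic.2 ((Set.mem_Iic.1 hk).trans (Nat.le_succ n))),
      hc (n + 1) (Set.mem_Iic.2 le_rfl)]
  rw [(h.integrable_integral hR).2]
  have h1 : (fun ω => G (Y ω) * f (Y ω (n + 1))) = fun ω => ∑ w : Fin (n + 1) → S, ∑ y,
      Set.indicator {ω | ∀ k ≤ n + 1, Y ω k = Function.update (extend w) (n + 1) y k}
        (fun _ => G (extend w) * f y) ω := by
    ext ω
    rw [eq_sum_extend hG, Finset.sum_mul]
    refine Finset.sum_congr rfl fun w _ => ?_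
    have h2 : ∀ y, (∀ k ≤ n + 1, Y ω k = Function.update (extend w) (n + 1) y k) ↔
        (∀ k ≤ n, Y ω k = extend w k) ∧ Y ω (n + 1) = y := by
      intro y
      constructor
      · intro h3
        refine ⟨fun k hk => ?_, ?_⟩
        · have := h3 k (hk.trans (Nat.le_succ n))
          rwa [Function.update_of_ne (by omega)] at this
        · simpa using h3 (n + 1) le_rfl
      · rintro ⟨h3, h4⟩ k hk
        rcases Nat.le_succ_iff.1 hk with h5 | rfl
        · rw [Function.update_of_ne (by omega)]
          exact h3 k h5
        · simpa using h4
    simp only [Set.indicator, Set.mem_ofPred_eq, h2]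
    by_cases h3 : ∀ k ≤ n, Y ω k = extend w k
    · simp only [if_pos h3, and_iff_right h3, Finset.sum_ite_eq, Finset.mem_univ, if_true]
    · simp only [h3, false_and, if_false, Finset.sum_const_zero, zero_mul]
  have hm : ∀ (w : Fin (n + 1) → S) y, MeasurableSet
      {ω | ∀ k ≤ n + 1, Y ω k = Function.update (extend w) (n + 1) y k} := fun w y =>
    h.measurableSet_cylinder _ _
  rw [h1, integral_finsetSum _ fun w _ => integrable_finsetSum _ fun y _ =>
    (integrable_const _).indicator (hm w y)]
  refine Finset.sum_congr rfl fun w _ => ?_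
  rw [integral_finsetSum _ fun y _ => (integrable_const _).indicator (hm w y)]
  simp only [Finset.mul_sum]
  refine Finset.sum_congr rfl fun y _ => ?_
  rw [integral_indicator_const _ (hm w y), smul_eq_mul, measureReal_def, h.cylinder,
    ENNReal.toReal_mul, ENNReal.toReal_ofReal (h.nonneg _ _), Function.update_self,
    Function.update_of_ne (by omega), measureReal_def]
  have h5 : {ω | ∀ k ≤ n, Y ω k = Function.update (extend w) (n + 1) y k}
      = {ω | ∀ k ≤ n, Y ω k = extend w k} := by
    ext ω
    refine forall_congr' fun k => imp_congr_right fun hk => ?_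
    rw [Function.update_of_ne (by omega)]
  rw [h5]
  ring

omit h [IsProbabilityMeasure P] in
theorem integral_linear_comb {A B C D : Ω → ℝ} (hA : Integrable A P) (hB : Integrable B P)
    (hC : Integrable C P) (hD : Integrable D P) (k : ℝ) :
    ∫ ω, (A ω + 2 * (B ω - C ω) + k * D ω) ∂P
      = ∫ ω, A ω ∂P + 2 * (∫ ω, B ω ∂P - ∫ ω, C ω ∂P) + k * ∫ ω, D ω ∂P := by
  have h1 : Integrable (fun ω => 2 * (B ω - C ω)) P := (hB.sub hC).const_mul 2
  have h2 : Integrable (fun ω => A ω + 2 * (B ω - C ω)) P := hA.add h1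
  rw [integral_add h2 (hD.const_mul k), integral_add hA h1, integral_const_mul, integral_const_mul,
    integral_sub hB hC]

/-- Second moment of a weighted sum of martingale differences of the chain. -/
theorem integral_mul_sq_le {a : ℕ} {Φ : (ℕ → S) → ℝ} (hΦ : DependsOn Φ (Set.Iic a))
    (hΦ0 : ∀ c, 0 ≤ Φ c) (f : S → ℝ) {H : ℝ} (hf : ∀ y, |f y| ≤ H) (L : ℕ) :
    ∫ ω, Φ (Y ω) * (∑ i ∈ Finset.Ico a (a + L),
        (f (Y ω (i + 1)) - ∑ y, p (Y ω i) y * f y)) ^ 2 ∂P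
      ≤ L * (2 * H) ^ 2 * ∫ ω, Φ (Y ω) ∂P := by
  have hpf : ∀ y, |∑ y', p y y' * f y'| ≤ H := by
    intro y
    refine (Finset.abs_sum_le_sum_abs _ _).trans ?_
    calc ∑ y', |p y y' * f y'| ≤ ∑ y', p y y' * H := by
          refine Finset.sum_le_sum fun y' _ => ?_
          rw [abs_mul, abs_of_nonneg (h.nonneg y y')]
          exact mul_le_mul_of_nonneg_left (hf y') (h.nonneg y y')
      _ = H := by rw [← Finset.sum_mul, h.row_sum, one_mul]
  set M : ℕ → (ℕ → S) → ℝ := fun L c => ∑ i ∈ Finset.Ico a (a + L),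
        (f (c (i + 1)) - ∑ y, p (c i) y * f y) with hM
  have hΦn : ∀ n, a ≤ n → DependsOn Φ (Set.Iic n) := fun n hn c c' hc =>
    hΦ fun k hk => hc k (Set.mem_Iic.2 ((Set.mem_Iic.1 hk).trans hn))
  have hMn : ∀ L, DependsOn (M L) (Set.Iic (a + L)) := fun L c c' hc => by
    simp only [hM]
    refine Finset.sum_congr rfl fun i hi => ?_
    have := (Finset.mem_Ico.1 hi).2
    rw [hc i (Set.mem_Iic.2 (by omega)), hc (i + 1) (Set.mem_Iic.2 (by omega))]
  change ∫ ω, Φ (Y ω) * (M L (Y ω)) ^ 2 ∂P ≤ _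
  induction L with
  | zero => simp [hM]
  | succ L ih =>
    have hsucc : ∀ c, M (L + 1) c = M L c + (f (c (a + L + 1)) - ∑ y, p (c (a + L)) y * f y) := by
      intro c
      simp only [hM]
      rw [← add_assoc, Finset.sum_Ico_succ_top (by omega)]
    have hG : DependsOn (fun c => Φ c * M L c) (Set.Iic (a + L)) := fun c c' hc => by
      simp only
      rw [hΦn _ (by omega) hc, hMn L hc]
    have hG' : ∀ c c', (∀ k ∈ Set.Iic (a + L), c k = c' k) → Φ c * M L c = Φ c' * M L c' := hG
    have hi1 : Integrable (fun ω => Φ (Y ω) * M L (Y ω) ^ 2) P :=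
      h.integrable (F := fun c => Φ c * M L c ^ 2) (n := a + L) fun c c' hc => by
        simp only
        rw [hΦn _ (by omega) hc, hMn L hc]
    have hi2 : Integrable (fun ω => Φ (Y ω) * M L (Y ω) * f (Y ω (a + L + 1))) P :=
      h.integrable (F := fun c => Φ c * M L c * f (c (a + L + 1))) (n := a + L + 1) fun c c' hc => by
        simp only
        rw [hG' c c' fun k hk => hc k (Set.mem_Iic.2 ((Set.mem_Iic.1 hk).trans (Nat.le_succ _))),
          hc _ (Set.mem_Iic.2 le_rfl)]
    have hi3 : Integrable (fun ω => Φ (Y ω) * M L (Y ω) * ∑ y, p (Y ω (a + L)) y * f y) P :=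
      h.integrable (F := fun c => Φ c * M L c * ∑ y, p (c (a + L)) y * f y) (n := a + L)
        fun c c' hc => by
          simp only
          rw [hG' c c' hc, hc _ (Set.mem_Iic.2 le_rfl)]
    have hi4 : Integrable (fun ω => Φ (Y ω)) P := h.integrable hΦ
    have hle : ∀ ω, Φ (Y ω) * M (L + 1) (Y ω) ^ 2 ≤ Φ (Y ω) * M L (Y ω) ^ 2
        + 2 * (Φ (Y ω) * M L (Y ω) * f (Y ω (a + L + 1))
          - Φ (Y ω) * M L (Y ω) * ∑ y, p (Y ω (a + L)) y * f y)
        + (2 * H) ^ 2 * Φ (Y ω) := by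
      intro ω
      rw [hsucc]
      set d := f (Y ω (a + L + 1)) - ∑ y, p (Y ω (a + L)) y * f y with hd
      have h1 : d ^ 2 ≤ (2 * H) ^ 2 := by
        rw [← sq_abs]
        refine pow_le_pow_left₀ (abs_nonneg _) ((abs_sub _ _).trans ?_) 2
        linarith [hf (Y ω (a + L + 1)), hpf (Y ω (a + L))]
      have h2 := mul_le_mul_of_nonneg_left h1 (hΦ0 (Y ω))
      have h3 : Φ (Y ω) * M L (Y ω) * f (Y ω (a + L + 1))
          - Φ (Y ω) * M L (Y ω) * ∑ y, p (Y ω (a + L)) y * f y = Φ (Y ω) * M L (Y ω) * d := by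
        rw [hd]; ring
      rw [h3]
      nlinarith
    have hi5 : Integrable (fun ω => Φ (Y ω) * M (L + 1) (Y ω) ^ 2) P :=
      h.integrable (F := fun c => Φ c * M (L + 1) c ^ 2) (n := a + (L + 1)) fun c c' hc => by
        simp only
        rw [hΦn _ (by omega) hc, hMn (L + 1) hc]
    refine (integral_mono hi5 ((hi1.add ((hi2.sub hi3).const_mul 2)).add (hi4.const_mul _))
      hle).trans ?_
    refine (integral_linear_comb hi1 hi2 hi3 hi4 ((2 * H) ^ 2)).le.trans ?_
    -- The cross term vanishes: the new increment has mean zero given the past, on which `Φ` and the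
    -- partial sum depend.
    rw [h.integral_mul_succ hG f, sub_self, mul_zero, add_zero]
    push_cast
    linarith

end IsChain

/-! ### Irregular blocks of a mobile -/

variable (N : Network ι V J)

/-- The mobile `j` on the trajectory `c` contacts one of its gateways too seldom in block `k`. -/
def Network.Irregular (γ : ℝ) (L : ℕ) (j : J) (c : ℕ → N.Port j) (k : ℕ) : Prop :=
  ∃ g, ((Finset.Ico (k * L) ((k + 1) * L)).filter fun τ => c τ = g).card
    < (1 + γ)⁻¹ * N.stat j g * L

/-- Number of irregular blocks of mobile `j` from block `a` to block `k`. -/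
noncomputable def Network.irregularCount (γ : ℝ) (L : ℕ) (j : J) (c : ℕ → N.Port j) (a k : ℕ) : ℝ :=
  ∑ i ∈ Finset.Ico a k, if N.Irregular γ L j c i then 1 else 0

theorem Network.Irregular.congr {γ : ℝ} {L : ℕ} {j : J} {c c' : ℕ → N.Port j} {k : ℕ}
    (hc : ∀ i < (k + 1) * L, c i = c' i) :
    N.Irregular γ L j c k ↔ N.Irregular γ L j c' k := by
  refine exists_congr fun g => ?_
  rw [Finset.filter_congr fun τ hτ => by rw [hc τ (Finset.mem_Ico.1 hτ).2]]

theorem Network.irregularCount_congr {γ : ℝ} {L : ℕ} {j : J} {c c' : ℕ → N.Port j} {a k : ℕ}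
    (hc : ∀ i < k * L, c i = c' i) :
    N.irregularCount γ L j c a k = N.irregularCount γ L j c' a k := by
  refine Finset.sum_congr rfl fun i hi => ?_
  have h1 : N.Irregular γ L j c i ↔ N.Irregular γ L j c' i := Network.Irregular.congr N fun τ hτ =>
    hc τ (lt_of_lt_of_le hτ (Nat.mul_le_mul_right L (Finset.mem_Ico.1 hi).2))
  simp only [h1]

/-- For long blocks, the probability of an irregular block is small given the past. -/
theorem Network.exists_irregular_le (j : J) {γ q : ℝ} (hγ : 0 < γ) (hq : 0 < q) :
    ∃ L₀ : ℕ, ∀ L : ℕ, L₀ ≤ L → ∀ (Ω : Type uΩ) [MeasurableSpace Ω] (P : Measure Ω)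
      [IsProbabilityMeasure P] (Y : Ω → ℕ → N.Port j), IsChain P (N.trans j) Y →
      ∀ (k : ℕ) (Φ : (ℕ → N.Port j) → ℝ), DependsOn Φ (Set.Iic (k * L)) → (∀ c, 0 ≤ Φ c) →
        ∫ ω, Φ (Y ω) * (if N.Irregular γ L j (Y ω) k then 1 else 0) ∂P
          ≤ q * ∫ ω, Φ (Y ω) ∂P := by
  choose f hf using N.exists_poisson j
  set H := ∑ g, ∑ y, |f g y| with hH
  have hfH : ∀ g y, |f g y| ≤ H := fun g y =>
    (Finset.single_le_sum (f := fun y => |f g y|) (fun y _ => abs_nonneg _) (Finset.mem_univ y)).trans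
      (Finset.single_le_sum (f := fun g => ∑ y, |f g y|)
        (fun g _ => Finset.sum_nonneg fun y _ => abs_nonneg _) (Finset.mem_univ g))
  have hγ1 : (1 + γ)⁻¹ < 1 := inv_lt_one_of_one_lt₀ (by linarith)
  have := N.port_nonempty j
  obtain ⟨g₀, hg₀⟩ := Finite.exists_min (N.stat j)
  -- In an irregular block of length `L` some gateway falls short of its stationary count by more
  -- than `c₀ * L`.
  set c₀ := (1 - (1 + γ)⁻¹) * N.stat j g₀ with hc₀
  have hc₀0 : 0 < c₀ := mul_pos (by linarith) (N.stat_pos j g₀)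
  obtain ⟨L₁, hL₁⟩ := exists_nat_ge (4 * H / c₀)
  obtain ⟨L₂, hL₂⟩ := exists_nat_ge (Fintype.card (N.Port j) * (16 * H ^ 2) / (c₀ ^ 2 * q))
  refine ⟨max (max L₁ L₂) 1, fun L hL Ω _ P _ Y hY k Φ hΦ hΦ0 => ?_⟩
  have hL1 : (1 : ℝ) ≤ L := by exact_mod_cast (le_max_right _ _).trans hL
  have hL2 : 4 * H ≤ c₀ * L := by
    have : 4 * H / c₀ ≤ L := hL₁.trans
      (Nat.cast_le.2 (((le_max_left _ _).trans (le_max_left _ _)).trans hL))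
    rw [div_le_iff₀ hc₀0] at this
    linarith
  have hL3 : Fintype.card (N.Port j) * (16 * H ^ 2) ≤ q * (c₀ ^ 2 * L) := by
    have : Fintype.card (N.Port j) * (16 * H ^ 2) / (c₀ ^ 2 * q) ≤ L := hL₂.trans
      (Nat.cast_le.2 (((le_max_right _ _).trans (le_max_left _ _)).trans hL))
    rw [div_le_iff₀ (by positivity)] at this
    linarith
  set a := k * L with ha
  have hk : (k + 1) * L = a + L := by rw [ha]; ring
  set M : N.Port j → (ℕ → N.Port j) → ℝ := fun g c =>
    ∑ i ∈ Finset.Ico a (a + L), (f g (c (i + 1)) - ∑ y, N.trans j (c i) y * f g y) with hM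
  -- By the Poisson equation the centred visit count is the martingale sum `M` minus a telescoping
  -- boundary term of size at most `2 * H`.
  have hMc : ∀ g c, M g c = ((Finset.Ico a (a + L)).filter fun τ => c τ = g).card
      - N.stat j g * L + (f g (c (a + L)) - f g (c a)) := by
    intro g c
    have h1 : ∀ i, f g (c (i + 1)) - ∑ y, N.trans j (c i) y * f g y
        = ((if c i = g then 1 else 0) - N.stat j g) + (f g (c (i + 1)) - f g (c i)) := fun i => by
      linarith [hf g (c i)]
    simp only [hM]
    rw [Finset.sum_congr rfl fun i _ => h1 i, Finset.sum_add_distrib, Finset.sum_sub_distrib,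
      Finset.sum_Ico_sub (fun i => f g (c i)) (Nat.le_add_right a L), Finset.sum_boole]
    simp [mul_comm]
  -- Chebyshev's inequality pointwise: once `4 * H ≤ c₀ * L`, irregularity forces `|M g c| ≥ c₀ * L
  -- / 2` for some `g`.
  have hpt : ∀ c, (if N.Irregular γ L j c k then (1 : ℝ) else 0)
      ≤ ∑ g, 4 / (c₀ ^ 2 * L ^ 2) * M g c ^ 2 := by
    intro c
    have hnn : ∀ g, 0 ≤ 4 / (c₀ ^ 2 * L ^ 2) * M g c ^ 2 := fun g => by positivity
    split_ifs with hirr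
    · obtain ⟨g, hg⟩ := hirr
      rw [hk] at hg
      refine le_trans ?_ (Finset.single_le_sum (fun g _ => hnn g) (Finset.mem_univ g))
      have h1 : c₀ ≤ (1 - (1 + γ)⁻¹) * N.stat j g :=
        mul_le_mul_of_nonneg_left (hg₀ g) (by linarith)
      have h2 : c₀ * L ≤ (1 - (1 + γ)⁻¹) * N.stat j g * L :=
        mul_le_mul_of_nonneg_right h1 (by linarith)
      have h3 : M g c ≤ -(c₀ * L / 2) := by
        rw [hMc]
        have := (abs_le.1 (hfH g (c (a + L)))).2
        have := (abs_le.1 (hfH g (c a))).1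
        linarith
      have h4 : (c₀ * L / 2) ^ 2 ≤ M g c ^ 2 := by
        have : 0 ≤ c₀ * L / 2 := by positivity
        nlinarith
      rw [div_mul_eq_mul_div, le_div_iff₀ (by positivity)]
      linarith
    · exact Finset.sum_nonneg fun g _ => hnn g
  have hirr : DependsOn (fun c : ℕ → N.Port j => Φ c * if N.Irregular γ L j c k then (1 : ℝ) else 0)
      (Set.Iic (a + L)) := fun c c' hc => by
    have h1 : N.Irregular γ L j c k ↔ N.Irregular γ L j c' k := Network.Irregular.congr N fun τ hτ =>
      hc τ (Set.mem_Iic.2 (by omega))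
    simp only [h1]
    rw [hΦ fun i hi => hc i (Set.mem_Iic.2 ((Set.mem_Iic.1 hi).trans (Nat.le_add_right a L)))]
  have hMd : ∀ g, DependsOn (fun c : ℕ → N.Port j => Φ c * M g c ^ 2) (Set.Iic (a + L)) := by
    intro g c c' hc
    have h1 : M g c = M g c' := by
      simp only [hM]
      refine Finset.sum_congr rfl fun i hi => ?_
      have := (Finset.mem_Ico.1 hi).2
      rw [hc i (Set.mem_Iic.2 (by omega)), hc (i + 1) (Set.mem_Iic.2 (by omega))]
    simp only [h1]
    rw [hΦ fun i hi => hc i (Set.mem_Iic.2 ((Set.mem_Iic.1 hi).trans (Nat.le_add_right a L)))]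
  have hMi : ∀ g, Integrable (fun ω => Φ (Y ω) * M g (Y ω) ^ 2) P := fun g => hY.integrable (hMd g)
  have hint : Integrable (fun ω => ∑ g, 4 / (c₀ ^ 2 * L ^ 2) * (Φ (Y ω) * M g (Y ω) ^ 2)) P :=
    integrable_finsetSum _ fun g _ => (hMi g).const_mul _
  have hE0 : 0 ≤ ∫ ω, Φ (Y ω) ∂P := integral_nonneg fun ω => hΦ0 _
  refine (integral_mono (hY.integrable hirr) hint fun ω => ?_).trans ?_
  · have := mul_le_mul_of_nonneg_left (hpt (Y ω)) (hΦ0 (Y ω))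
    rw [Finset.mul_sum] at this
    refine this.trans (le_of_eq (Finset.sum_congr rfl fun g _ => ?_))
    ring
  · rw [integral_finsetSum _ fun g _ => (hMi g).const_mul _]
    have h1 : ∀ g, ∫ ω, 4 / (c₀ ^ 2 * L ^ 2) * (Φ (Y ω) * M g (Y ω) ^ 2) ∂P
        ≤ 16 * H ^ 2 / (c₀ ^ 2 * L) * ∫ ω, Φ (Y ω) ∂P := by
      intro g
      rw [integral_const_mul]
      have h2 := mul_le_mul_of_nonneg_left
        (hY.integral_mul_sq_le hΦ hΦ0 (f g) (hfH g) L)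
        (show 0 ≤ 4 / (c₀ ^ 2 * (L : ℝ) ^ 2) by positivity)
      refine h2.trans (le_of_eq ?_)
      field_simp
      ring
    refine (Run.sum_le_card_mul _ _ h1).trans ?_
    rw [← mul_assoc]
    refine mul_le_mul_of_nonneg_right ?_ hE0
    rw [mul_div_assoc', div_le_iff₀ (by positivity)]
    exact hL3

theorem Network.irregularCount_succ {γ : ℝ} {L : ℕ} {j : J} (c : ℕ → N.Port j) {a k : ℕ} (hak : a ≤ k) :
    N.irregularCount γ L j c a (k + 1) = N.irregularCount γ L j c a k
      + if N.Irregular γ L j c k then 1 else 0 :=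
  Finset.sum_Ico_succ_top hak _

/-- Each further block multiplies the exponential by `1 + (e - 1) 1_irregular`. Taking the
exponential of the earlier count as the weight `Φ` in `hirr`, the mean grows by a factor of at most
`1 + (e - 1) q`. -/
theorem Network.integral_exp_irregularCount_le {j : J} {γ q : ℝ} {L : ℕ}
    {Ω : Type uΩ} [MeasurableSpace Ω] {P : Measure Ω} [IsProbabilityMeasure P]
    {Y : Ω → ℕ → N.Port j} (hY : IsChain P (N.trans j) Y)
    (hirr : ∀ (k : ℕ) (Φ : (ℕ → N.Port j) → ℝ), DependsOn Φ (Set.Iic (k * L)) → (∀ c, 0 ≤ Φ c) →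
      ∫ ω, Φ (Y ω) * (if N.Irregular γ L j (Y ω) k then 1 else 0) ∂P ≤ q * ∫ ω, Φ (Y ω) ∂P)
    (a n : ℕ) :
    Integrable (fun ω => Real.exp (N.irregularCount γ L j (Y ω) a (a + n))) P ∧
    ∫ ω, Real.exp (N.irregularCount γ L j (Y ω) a (a + n)) ∂P
      ≤ Real.exp ((Real.exp 1 - 1) * q * n) := by
  have hdep : ∀ n, DependsOn (fun c : ℕ → N.Port j => Real.exp (N.irregularCount γ L j c a (a + n)))
      (Set.Iic ((a + n) * L)) := fun n c c' hc => by
    simp only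
    rw [N.irregularCount_congr fun i hi => hc i (Set.mem_Iic.2 hi.le)]
  refine ⟨hY.integrable (hdep n), ?_⟩
  have he : 0 ≤ Real.exp 1 - 1 := by linarith [Real.add_one_le_exp 1]
  induction n with
  | zero => simp [Network.irregularCount]
  | succ n ih =>
    have h1 : ∀ c : ℕ → N.Port j, Real.exp (N.irregularCount γ L j c a (a + (n + 1)))
        = Real.exp (N.irregularCount γ L j c a (a + n)) + (Real.exp 1 - 1) *
          (Real.exp (N.irregularCount γ L j c a (a + n)) *
            if N.Irregular γ L j c (a + n) then 1 else 0) := by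
      intro c
      rw [← add_assoc, N.irregularCount_succ c (Nat.le_add_right a n), Real.exp_add]
      split_ifs
      · ring
      · simp
    have h2 := hirr (a + n) _ (hdep n) fun c => (Real.exp_pos _).le
    have h3 : Integrable (fun ω => Real.exp (N.irregularCount γ L j (Y ω) a (a + n)) *
        if N.Irregular γ L j (Y ω) (a + n) then (1 : ℝ) else 0) P :=
      hY.integrable (F := fun c => Real.exp (N.irregularCount γ L j c a (a + n)) *
        if N.Irregular γ L j c (a + n) then (1 : ℝ) else 0) (n := (a + n + 1) * L) fun c c' hc => by
        have h4 : N.Irregular γ L j c (a + n) ↔ N.Irregular γ L j c' (a + n) :=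
          Network.Irregular.congr N fun τ hτ => hc τ (Set.mem_Iic.2 hτ.le)
        simp only [h4]
        rw [N.irregularCount_congr fun i hi => hc i (Set.mem_Iic.2
          (hi.le.trans (Nat.mul_le_mul_right L (Nat.le_succ _))))]
    rw [integral_congr_ae (Filter.Eventually.of_forall fun ω => h1 (Y ω)),
      integral_add (hY.integrable (hdep n)) (h3.const_mul _), integral_const_mul]
    have h5 := mul_le_mul_of_nonneg_left h2 he
    set E := ∫ ω, Real.exp (N.irregularCount γ L j (Y ω) a (a + n)) ∂P with hE
    have hE0 : 0 ≤ E := integral_nonneg fun ω => (Real.exp_pos _).le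
    have h6 : E + (Real.exp 1 - 1) * (q * E) ≤ Real.exp ((Real.exp 1 - 1) * q) * E := by
      have := mul_le_mul_of_nonneg_right (Real.add_one_le_exp ((Real.exp 1 - 1) * q)) hE0
      linarith
    refine (add_le_add le_rfl h5).trans (h6.trans ?_)
    refine (mul_le_mul_of_nonneg_left ih (Real.exp_pos _).le).trans (le_of_eq ?_)
    rw [← Real.exp_add]
    push_cast
    ring_nf

/-! ### Pathwise drift, Chernoff bound and integration of tails -/

open MeasureTheory

/-- A sequence that decreases when large, except at irregular times, is bounded by the worst excess
of irregular times over a window. -/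
theorem le_add_of_drift {v : ℕ → ℝ} {irr : ℕ → Prop} [DecidablePred irr] {α ρ B : ℝ} (hB : 0 ≤ B) (h0 : v 0 = 0)
    (hgrow : ∀ k, v (k + 1) ≤ v k + α) (hreg : ∀ k, ¬ irr k → v (k + 1) ≤ max (v k - ρ) B) (k : ℕ) :
    ∀ b : ℝ, (∀ a ≤ k, (α + ρ) * ∑ i ∈ Finset.Ico a k, (if irr i then (1 : ℝ) else 0)
      ≤ b + ρ * (k - a : ℕ)) → v k ≤ B + b := by
  induction k with
  | zero =>
    intro b hb
    have := hb 0 le_rfl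
    simp at this
    linarith
  | succ k ih =>
    intro b hb
    have hb0 : 0 ≤ b := by simpa using hb (k + 1) le_rfl
    have hstep : ∀ a ≤ k, (α + ρ) * ∑ i ∈ Finset.Ico a k, (if irr i then (1 : ℝ) else 0)
        + (α + ρ) * (if irr k then 1 else 0) ≤ b + ρ + ρ * (k - a : ℕ) := by
      intro a ha
      have h1 := hb a (ha.trans (Nat.le_succ k))
      rw [Finset.sum_Ico_succ_top ha, Nat.succ_sub ha] at h1
      push_cast at h1
      linarith
    -- The allowance `b` varies in the induction: before an irregular step it must be smaller by the
    -- growth `α`, before a regular one it may be larger by `ρ`.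
    by_cases hk : irr k
    · have h1 := ih (b - α) fun a ha => by
        have := hstep a ha
        rw [if_pos hk] at this
        linarith
      linarith [hgrow k]
    · have h1 := ih (b + ρ) fun a ha => by
        have := hstep a ha
        rw [if_neg hk] at this
        linarith
      refine (hreg k hk).trans (max_le ?_ ?_) <;> linarith

theorem sum_pow_sub_le {r : ℝ} (h0 : 0 ≤ r) (h1 : r < 1) (k : ℕ) :
    ∑ a ∈ Finset.range (k + 1), r ^ (k - a) ≤ (1 - r)⁻¹ := by
  have h2 := Finset.sum_range_reflect (fun i => r ^ i) (k + 1)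
  simp only [Nat.add_sub_cancel] at h2
  rw [h2, ← tsum_geometric_of_lt_one h0 h1]
  exact (summable_geometric_of_lt_one h0 h1).sum_le_tsum _ fun i _ => pow_nonneg h0 i

/-- Layer-cake formula; the tail bound is integrated over `Z > 0`. -/
theorem integral_le_of_tail {Ω : Type*} [MeasurableSpace Ω] {P : Measure Ω} [IsProbabilityMeasure P]
    {f : Ω → ℝ} (hf : Measurable f) (h0 : ∀ ω, 0 ≤ f ω) {C c : ℝ} (hC : 0 < C) (hc : 0 < c)
    (h : ∀ Z, P.real {ω | Z < f ω} ≤ C * Real.exp (-c * Z)) :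
    Integrable f P ∧ ∫ ω, f ω ∂P ≤ C / c := by
  have hnn : 0 ≤ᵐ[P] f := Filter.Eventually.of_forall h0
  have hint : IntegrableOn (fun Z => C * Real.exp (-c * Z)) (Set.Ioi (0 : ℝ)) :=
    (integrableOn_exp_mul_Ioi (neg_lt_zero.2 hc) 0).const_mul C
  have h1 : ∫⁻ ω, ENNReal.ofReal (f ω) ∂P ≤ ENNReal.ofReal (C / c) := by
    rw [lintegral_eq_lintegral_meas_lt P hnn hf.aemeasurable]
    calc ∫⁻ Z in Set.Ioi (0 : ℝ), P {ω | Z < f ω}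
        ≤ ∫⁻ Z in Set.Ioi (0 : ℝ), ENNReal.ofReal (C * Real.exp (-c * Z)) := by
          refine lintegral_mono fun Z => ?_
          rw [← ofReal_measureReal]
          exact ENNReal.ofReal_le_ofReal (h Z)
      _ = ENNReal.ofReal (∫ Z in Set.Ioi (0 : ℝ), C * Real.exp (-c * Z)) :=
          (ofReal_integral_eq_lintegral_ofReal hint (Filter.Eventually.of_forall fun Z =>
            mul_nonneg hC.le (Real.exp_pos _).le)).symm
      _ = ENNReal.ofReal (C / c) := by
          rw [integral_const_mul, integral_exp_mul_Ioi (neg_lt_zero.2 hc)]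
          simp [div_eq_mul_inv]
  refine ⟨(lintegral_ofReal_ne_top_iff_integrable hf.aestronglyMeasurable hnn).1
    (ne_top_of_le_ne_top ENNReal.ofReal_ne_top h1), ?_⟩
  rw [integral_eq_lintegral_of_nonneg_ae hnn hf.aestronglyMeasurable]
  exact ENNReal.toReal_le_of_le_ofReal (by positivity) h1

variable [Fintype J] {N : Network ι V J}

theorem Network.IsMobility.isChain {Ω : Type uΩ} [MeasurableSpace Ω] {P : Measure Ω} {X : Ω → N.Path}
    (hX : N.IsMobility P X) (j : J) : IsChain P (N.trans j) fun ω τ => X ω τ j :=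
  ⟨fun τ s => hX.1 τ j s, hX.2 j, N.trans_nonneg j, N.trans_row_sum j⟩

theorem Network.regularBlock_iff {γ : ℝ} {L : ℕ} {pos : N.Path} {k : ℕ} :
    N.RegularBlock γ L pos k ↔ ∀ j, ¬ N.Irregular γ L j (fun τ => pos τ j) k := by
  simp only [Network.RegularBlock, Network.Irregular, not_exists, not_lt]

theorem Network.sum_irregular_le (γ : ℝ) (L : ℕ) (pos : N.Path) (a k : ℕ) :
    ∑ i ∈ Finset.Ico a k, (if ¬ N.RegularBlock γ L pos i then (1 : ℝ) else 0)
      ≤ ∑ j, N.irregularCount γ L j (fun τ => pos τ j) a k := by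
  unfold Network.irregularCount
  rw [Finset.sum_comm]
  refine Finset.sum_le_sum fun i _ => ?_
  have hnn : ∀ j, (0 : ℝ) ≤ if N.Irregular γ L j (fun τ => pos τ j) i then 1 else 0 := fun j => by
    split_ifs <;> norm_num
  split_ifs with h
  · exact Finset.sum_nonneg fun j _ => hnn j
  · rw [Network.regularBlock_iff] at h
    push Not at h
    obtain ⟨j, hj⟩ := h
    refine le_trans ?_ (Finset.single_le_sum (fun j _ => hnn j) (Finset.mem_univ j))
    rw [if_pos hj]

/-- Chernoff bound with parameter `1`. The exponential moment takes up at most half of `κ ρ (k -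
a)`; the other half makes the bound geometric in the window length. -/
theorem Network.real_irregularCount_le {j : J} {γ q κ ρ : ℝ} {L : ℕ} (hκ : (Real.exp 1 - 1) * q ≤ κ * ρ / 2)
    {Ω : Type uΩ} [MeasurableSpace Ω] {P : Measure Ω} [IsProbabilityMeasure P]
    {Y : Ω → ℕ → N.Port j} (hY : IsChain P (N.trans j) Y)
    (hirr : ∀ (k : ℕ) (Φ : (ℕ → N.Port j) → ℝ), DependsOn Φ (Set.Iic (k * L)) → (∀ c, 0 ≤ Φ c) →
      ∫ ω, Φ (Y ω) * (if N.Irregular γ L j (Y ω) k then 1 else 0) ∂P ≤ q * ∫ ω, Φ (Y ω) ∂P)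
    {a k : ℕ} (hak : a ≤ k) (s : ℝ) :
    P.real {ω | κ * (s + ρ * (k - a : ℕ)) ≤ N.irregularCount γ L j (Y ω) a k}
      ≤ Real.exp (-κ * s) * Real.exp (-(κ * ρ / 2)) ^ (k - a) := by
  obtain ⟨n, rfl⟩ := Nat.exists_eq_add_of_le hak
  rw [Nat.add_sub_cancel_left]
  obtain ⟨h1, h2⟩ := N.integral_exp_irregularCount_le hY hirr a n
  have h3 := ProbabilityTheory.measure_ge_le_exp_mul_mgf (μ := P)
    (X := fun ω => N.irregularCount γ L j (Y ω) a (a + n)) (t := 1) (κ * (s + ρ * n)) zero_le_one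
    (by simpa using h1)
  refine h3.trans ?_
  have h4 : ProbabilityTheory.mgf (fun ω => N.irregularCount γ L j (Y ω) a (a + n)) P 1
      ≤ Real.exp ((Real.exp 1 - 1) * q * n) := by
    unfold ProbabilityTheory.mgf
    simpa using h2
  refine (mul_le_mul_of_nonneg_left h4 (Real.exp_pos _).le).trans ?_
  rw [← Real.exp_nat_mul, ← Real.exp_add, ← Real.exp_add, Real.exp_le_exp]
  have := mul_le_mul_of_nonneg_right hκ (Nat.cast_nonneg (α := ℝ) n)
  linarith

theorem Network.potential_zero {x : V → V → ℝ} {T : ℕ} {R η δ : ℝ} {pos : N.Path}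
    {e : Execution ι V J} (h : Run N x T R η δ pos e) : N.potential T e 0 = 0 := by
  have hq : ∀ n b, e.qLen 0 n b = 0 := fun n b => Finset.sum_eq_zero fun a _ => h.q_zero n b a
  have hu : ∀ n b, e.uLen 0 n b = 0 := fun n b => Finset.sum_eq_zero fun a _ => h.u_zero n b a
  have ht : ∀ b l, e.transit 0 b l = 0 := fun b l => by simp [Execution.transit, h.q_zero]
  have hc : ∀ i, N.coord T e 0 i = 0 := by
    rintro (⟨n | m, l⟩ | ⟨n, b⟩) <;> simp [Network.coord, Execution.vLen, hq, hu, ht]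
  simp [Network.potential, hc]

/-! ### Uniform tails and bounds for all queues -/

namespace Run

/-- Type-I and regulated type-II queues have an exponential tail, uniformly in time. -/
theorem exists_tail (N : Network ι V J) (x : V → V → ℝ) {r η δ ε : ℝ} (hr : 0 < r)
    (hη : 0 < η) (hδ : 0 ≤ δ) (hε : 0 < ε) (hx : N.IsTraffic x)
    (hsup : N.Supportable r fun s d => (1 + δ + ε) * x s d) :
    ∃ T₀ : ℕ, 0 < T₀ ∧ ∀ T : ℕ, T₀ ≤ T → ∃ C c : ℝ, 0 < C ∧ 0 < c ∧
      ∀ (Ω : Type uΩ) [MeasurableSpace Ω] (P : Measure Ω) [IsProbabilityMeasure P]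
        (X : Ω → N.Path), N.IsMobility P X → ∀ e : Ω → Execution ι V J,
        (∀ ω, Run N x T (r * T) η δ (X ω) (e ω)) → ∀ (t : ℕ) (Z : ℝ),
          P.real {ω | ¬ ((∀ n b, (e ω).qLen t n b ≤ Z) ∧ ∀ n l, (e ω).uLen t n l ≤ Z)}
            ≤ C * Real.exp (-c * Z) := by
  -- The law of large numbers needs a strictly positive slack below the stationary frequencies; this
  -- choice spends half of `ε` on it.
  set γ := ε / (2 * (1 + δ)) with hγdef
  have hδ1 : 0 < 1 + δ := by linarith
  have hγ : 0 < γ := by positivity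
  have hγε : (1 + γ) * (1 + δ) < 1 + δ + ε := by
    have : γ * (1 + δ) = ε / 2 := by rw [hγdef]; field_simp
    linarith
  obtain ⟨T₀, hT₀, hdrift⟩ := exists_drift N x hr hη hδ hε hγ.le hx hγε hsup
  refine ⟨T₀, hT₀, fun T hT => ?_⟩
  obtain ⟨α, ρ, hα, hρ, hB⟩ := hdrift T hT
  have hT0 : 0 < T := hT₀.trans_le hT
  -- With this share for each mobile, all mobiles together stay within the allowance of
  -- `le_add_of_drift`; the `+ 1` avoids dividing by zero without mobiles.
  set κ := 1 / ((α + ρ) * (Fintype.card J + 1)) with hκ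
  have hκ0 : 0 < κ := by positivity
  set q := κ * ρ / 4 with hq
  have hq0 : 0 < q := by positivity
  have hqκ : (Real.exp 1 - 1) * q ≤ κ * ρ / 2 := by
    have := mul_le_mul_of_nonneg_right
      (show Real.exp 1 - 1 ≤ 2 by linarith [Real.exp_one_lt_three]) hq0.le
    linarith
  choose L₀ hL₀ using fun j => Network.exists_irregular_le.{uι, uV, uJ, uΩ} N j hγ hq0
  -- One positive block length long enough for every mobile. The `L₀` depend on `q`, hence on `α`
  -- and `ρ`, which do not depend on `T'`.
  set T' := (∑ j, L₀ j) + 1 with hT'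
  have hT'0 : 0 < T' := Nat.succ_pos _
  have hT'R : (0 : ℝ) < T' := Nat.cast_pos.2 hT'0
  have hT'L : ∀ j, L₀ j ≤ T' := fun j =>
    (Finset.single_le_sum (fun j _ => Nat.zero_le (L₀ j)) (Finset.mem_univ j)).trans (Nat.le_succ _)
  obtain ⟨B, hB0, hrun⟩ := hB T' hT'0
  set θ := Real.exp (-(κ * ρ / 2)) with hθ
  have hθ0 : 0 ≤ θ := (Real.exp_pos _).le
  have hθ1 : θ < 1 := by
    rw [hθ, Real.exp_lt_one_iff]
    have : 0 < κ * ρ := by positivity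
    linarith
  set C₀ := Fintype.card J * (1 - θ)⁻¹ with hC₀
  have hC₀0 : 0 ≤ C₀ := mul_nonneg (Nat.cast_nonneg _) (inv_nonneg.2 (by linarith))
  set c := κ / T' with hc
  have hc0 : 0 < c := by positivity
  refine ⟨(C₀ + 1) * Real.exp (c * (2 * B)), c, by positivity, hc0, fun Ω _ P _ X hX e he t Z => ?_⟩
  rw [mul_assoc, ← Real.exp_add, show c * (2 * B) + -c * Z = -(c * (Z - 2 * B)) by ring]
  -- One `B` comes from the pathwise bound at block boundaries, the other from the growth inside a
  -- block. Below `2 * B` the claimed bound is at least `1`.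
  rcases le_total Z (2 * B) with hZ | hZ
  · refine measureReal_le_one.trans ?_
    have h1 : 1 ≤ Real.exp (-(c * (Z - 2 * B))) := by
      rw [Real.one_le_exp_iff]
      nlinarith
    nlinarith
  set b := Z - 2 * B with hb
  have hb0 : 0 ≤ b := by linarith
  set k := t / (T' * T) with hk
  have ht1 : k * T' * T ≤ t := by
    rw [mul_assoc]
    exact Nat.div_mul_le_self t (T' * T)
  have ht2 : t ≤ (k + 1) * T' * T := by
    rw [mul_assoc]
    exact (Nat.lt_div_mul_add (Nat.mul_pos hT'0 hT0)).le.trans (by rw [hk]; ring_nf; exact le_rfl)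
  -- A large queue forces too many irregular blocks of one mobile `j` in some window from `a` to
  -- `k`. The union over windows is a geometric sum, so the bound does not depend on `k`.
  set E : ℕ → J → Set Ω := fun a j => {ω | κ * (b / T' + ρ * (k - a : ℕ))
    ≤ N.irregularCount γ T' j (fun τ => X ω τ j) a k} with hE
  have hsub : {ω | ¬ ((∀ n b, (e ω).qLen t n b ≤ Z) ∧ ∀ n l, (e ω).uLen t n l ≤ Z)}
      ⊆ ⋃ a ∈ Finset.range (k + 1), ⋃ j, E a j := by
    intro ω hω
    by_contra hcon
    refine hω ?_
    simp only [Set.mem_iUnion, not_exists, hE, Set.mem_ofPred_eq, not_le, Finset.mem_range] at hcon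
    have hpot : N.potential T (e ω) (k * T' * T) ≤ B + b := by
      refine le_add_of_drift (v := fun k => N.potential T (e ω) (k * T' * T))
        (irr := fun k => ¬ N.RegularBlock γ T' (X ω) k) (α := α * T') (ρ := ρ * T') hB0
        (by simpa using Network.potential_zero (he ω)) (fun k => (hrun (X ω) (e ω) (he ω) k).1)
        (fun k hk => (hrun (X ω) (e ω) (he ω) k).2.1 (not_not.1 hk)) k b fun a ha => ?_
      have h1 := (N.sum_irregular_le γ T' (X ω) a k).trans (Run.sum_le_card_mul _ _ fun j =>
        (hcon a (Nat.lt_succ_of_le ha) j).le)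
      have h2 : 0 ≤ b / T' + ρ * (k - a : ℕ) := by positivity
      have h3 : (α + ρ) * (Fintype.card J * κ) ≤ 1 := by
        rw [hκ, mul_one_div, mul_div_assoc', div_le_one (by positivity)]
        have : 0 < α + ρ := by linarith
        nlinarith
      have h4 := mul_le_mul_of_nonneg_left h1 (show 0 ≤ α * T' + ρ * T' by positivity)
      refine h4.trans ?_
      have h5 := mul_le_mul_of_nonneg_right h3 (mul_nonneg hT'R.le h2)
      have h6 : T' * (b / T' + ρ * (k - a : ℕ)) = b + ρ * T' * (k - a : ℕ) := by field_simp
      rw [one_mul, h6] at h5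
      refine le_trans (le_of_eq ?_) h5
      rw [← h6]
      ring
    have h7 := (hrun (X ω) (e ω) (he ω) k).2.2 t ht1 ht2
    exact ⟨fun n b' => (h7.1 n b').trans (by linarith), fun n l => (h7.2 n l).trans (by linarith)⟩
  refine (measureReal_mono hsub (measure_ne_top P _)).trans ((measureReal_biUnion_finset_le _ _).trans ?_)
  have hEP : ∀ a ∈ Finset.range (k + 1), P.real (⋃ j, E a j)
      ≤ Fintype.card J * (Real.exp (-κ * (b / T')) * θ ^ (k - a)) := by
    intro a ha
    refine (measureReal_iUnion_fintype_le _).trans (Run.sum_le_card_mul _ _ fun j => ?_)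
    exact N.real_irregularCount_le hqκ (hX.isChain j) (hL₀ j T' (hT'L j) Ω P _ (hX.isChain j))
      (Nat.lt_succ_iff.1 (Finset.mem_range.1 ha)) (b / T')
  refine (Finset.sum_le_sum hEP).trans ?_
  rw [← Finset.mul_sum, ← Finset.mul_sum]
  have h8 : Real.exp (-κ * (b / T')) = Real.exp (-(c * b)) := by
    rw [hc]
    congr 1
    ring
  rw [h8]
  have h9 := sum_pow_sub_le hθ0 hθ1 k
  have h10 : Fintype.card J * (Real.exp (-(c * b)) * ∑ a ∈ Finset.range (k + 1), θ ^ (k - a))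
      ≤ Fintype.card J * (Real.exp (-(c * b)) * (1 - θ)⁻¹) := by gcongr
  refine h10.trans ?_
  rw [hC₀]
  linarith [Real.exp_pos (-(c * b))]

/-- A bound on type-I and regulated type-II queues gives a bound on all queues. -/
theorem allQueuesLE {x : V → V → ℝ} {T : ℕ} {R η δ : ℝ} {pos : N.Path}
    {e : Execution ι V J} (h : Run N x T R η δ pos e) {n : ℕ} {Z : ℝ} (hZ : 0 ≤ Z)
    (hZn : ∀ t ≤ n, (∀ a b, e.qLen t a b ≤ Z) ∧ ∀ a l, e.uLen t a l ≤ Z) :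
    ∀ t ≤ n, e.AllQueuesLE t ((realSlope V J + 1) * Z + realOffset V x) := by
  have hA := h.sum_x_nonneg
  have hs : 0 ≤ realSlope V J := by unfold realSlope; positivity
  have ho : 0 ≤ realOffset V x := by unfold realOffset; positivity
  have h1 : Z ≤ (realSlope V J + 1) * Z + realOffset V x := by nlinarith
  exact fun t ht => ⟨fun a b => ((hZn t ht).1 a b).trans h1, fun a l => ((hZn t ht).2 a l).trans h1,
    fun g l => (h.wLen_le (fun t ht => (hZn t ht).1) (fun t ht => (hZn t ht).2) hZ t ht g l).trans
      (by linarith)⟩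

theorem of_isExecution {x : V → V → ℝ} {T : ℕ} {r η δ ε : ℝ} {pos : N.Path} {e : Execution ι V J}
    (hx : N.IsTraffic x) (hη : N.ExceedsNodeRates η) (hr : 0 ≤ r) (hδ : 0 ≤ δ) (hε : 0 ≤ ε)
    (hsup : N.Supportable r fun s d => (1 + δ + ε) * x s d) (hT : 0 < T)
    (he : N.IsExecution x T (r * T) η δ pos e) : Run N x T (r * T) η δ pos e where
  traffic := hx
  rates := hη
  T_pos := hT
  R_nonneg := by positivity
  δ_nonneg := hδ
  conn := fun _ _ hne => hsup.conn (mul_ne_zero (by linarith) hne)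
  exec := he

/-- All queues stay bounded when the contacts are regular in all blocks. -/
theorem exists_bound (N : Network ι V J) (x : V → V → ℝ) {r η δ ε γ : ℝ} (hr : 0 < r)
    (hη : 0 < η) (hδ : 0 ≤ δ) (hε : 0 < ε) (hγ : 0 ≤ γ) (hx : N.IsTraffic x)
    (hγε : (1 + γ) * (1 + δ) < 1 + δ + ε)
    (hsup : N.Supportable r fun s d => (1 + δ + ε) * x s d) :
    ∃ T₀ : ℕ, ∀ T : ℕ, T₀ ≤ T → ∀ T' : ℕ, 0 < T' → ∃ B : ℝ, ∀ (pos : N.Path),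
      N.RegularContacts γ T' pos → ∀ e : Execution ι V J, Run N x T (r * T) η δ pos e →
        ∀ t, e.AllQueuesLE t B := by
  obtain ⟨T₀, -, hdrift⟩ := exists_drift N x hr hη hδ hε hγ hx hγε hsup
  refine ⟨T₀, fun T hT T' hT' => ?_⟩
  obtain ⟨α, ρ, -, hρ, hB⟩ := hdrift T hT
  obtain ⟨B, hB0, hrun⟩ := hB T' hT'
  refine ⟨(realSlope V J + 1) * (B + B) + realOffset V x, fun pos hreg e h t => ?_⟩
  have hv : ∀ k, N.potential T e (k * T' * T) ≤ B := by
    intro k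
    induction k with
    | zero => simpa [Network.potential_zero h] using hB0
    | succ k ih =>
      refine ((hrun pos e h k).2.1 (hreg k)).trans (max_le ?_ le_rfl)
      have : 0 ≤ ρ * T' := by positivity
      linarith
  refine h.allQueuesLE (by linarith) (fun s _ => ?_) t le_rfl
  have h1 := (hrun pos e h (s / (T' * T))).2.2 s (by
    rw [mul_assoc]
    exact Nat.div_mul_le_self s (T' * T)) (by
    rw [mul_assoc, add_mul, one_mul]
    exact (Nat.lt_div_mul_add (Nat.mul_pos hT' h.T_pos)).le)
  exact ⟨fun a b => (h1.1 a b).trans (add_le_add_left (hv _) B),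
    fun a l => (h1.2 a l).trans (add_le_add_left (hv _) B)⟩

/-- The largest of all queues over a finite horizon has an exponential tail. -/
theorem measure_not_allQueuesLE_le {x : V → V → ℝ} {T : ℕ} {R η δ C c : ℝ} (hC : 0 < C)
    (hc : 0 < c) {Ω : Type*} [MeasurableSpace Ω] {P : Measure Ω} [IsProbabilityMeasure P]
    {X : Ω → N.Path} {e : Ω → Execution ι V J} (he : ∀ ω, Run N x T R η δ (X ω) (e ω))
    (htail : ∀ (t : ℕ) (Z : ℝ),
      P.real {ω | ¬ ((∀ n b, (e ω).qLen t n b ≤ Z) ∧ ∀ n l, (e ω).uLen t n l ≤ Z)}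
        ≤ C * Real.exp (-c * Z)) (n : ℕ) (b : ℝ) :
    P {ω | ∃ t ≤ n, ¬ (e ω).AllQueuesLE t b} ≤ ENNReal.ofReal
      ((C + 1) * Real.exp (c * (realOffset V x / (realSlope V J + 1))) * (n + 1)
        * Real.exp (-(c / (realSlope V J + 1)) * b)) := by
  have hs : 0 ≤ realSlope V J := by unfold realSlope; positivity
  set s := realSlope V J + 1 with hsdef
  have hs0 : 0 < s := by linarith
  set Z := (b - realOffset V x) / s with hZ
  have hbZ : s * Z + realOffset V x = b := by rw [hZ]; field_simp; ring
  have h1 : (C + 1) * Real.exp (c * (realOffset V x / s)) * (n + 1) * Real.exp (-(c / s) * b)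
      = (n + 1) * ((C + 1) * Real.exp (-c * Z)) := by
    have : Real.exp (-c * Z) = Real.exp (c * (realOffset V x / s)) * Real.exp (-(c / s) * b) := by
      rw [← Real.exp_add, hZ]
      congr 1
      field_simp
      ring
    rw [this]
    ring
  rw [h1, ← ofReal_measureReal]
  refine ENNReal.ofReal_le_ofReal ?_
  have hn : (1 : ℝ) ≤ n + 1 := by linarith [Nat.cast_nonneg (α := ℝ) n]
  have hexp := Real.exp_pos (-c * Z)
  -- For negative `Z` the right-hand side exceeds `1`, thanks to the constant `C + 1`.
  rcases lt_or_ge Z 0 with hZ0 | hZ0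
  · have h2 : 1 ≤ Real.exp (-c * Z) := by
      rw [Real.one_le_exp_iff]
      nlinarith
    have h3 : 1 ≤ (C + 1) * Real.exp (-c * Z) := by nlinarith
    exact measureReal_le_one.trans (by nlinarith)
  -- The bound on real queues uses the other queues at every slot up to `n`, so a union over the
  -- horizon is needed, and it gives the factor `n + 1`.
  have hsub : {ω | ∃ t ≤ n, ¬ (e ω).AllQueuesLE t b} ⊆ ⋃ t ∈ Finset.range (n + 1),
      {ω | ¬ ((∀ n b, (e ω).qLen t n b ≤ Z) ∧ ∀ n l, (e ω).uLen t n l ≤ Z)} := by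
    rintro ω ⟨t, ht, hω⟩
    by_contra hcon
    simp only [Set.mem_iUnion, not_exists, Set.mem_ofPred_eq, not_not, Finset.mem_range] at hcon
    refine hω ?_
    rw [← hbZ]
    exact (he ω).allQueuesLE hZ0 (fun t ht => hcon t (Nat.lt_succ_of_le ht)) t ht
  refine (measureReal_mono hsub (measure_ne_top P _)).trans
    ((measureReal_biUnion_finset_le _ _).trans ?_)
  refine (Finset.sum_le_sum fun t _ => htail t Z).trans ?_
  rw [Finset.sum_const, Finset.card_range, nsmul_eq_mul]
  push_cast
  have : C * Real.exp (-c * Z) ≤ (C + 1) * Real.exp (-c * Z) := by linarith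
  exact mul_le_mul_of_nonneg_left this (by linarith)

end Run

end ICN

theorem mainTheorem2 {ι : Type uι} {V : Type uV} {J : Type uJ} [Fintype V] [Fintype J]
    (N : ICN.Network ι V J) (x : V → V → ℝ) (hx : N.IsTraffic x)
    (r : ℝ) (hr : 0 < r) (η : ℝ) (hη : N.ExceedsNodeRates η)
    (δ : ℝ) (hδ : 0 < δ) (ε : ℝ) (hε : 0 < ε)
    (hsup : N.Supportable r (fun s d => (1 + δ + ε) * x s d))
    (γ : ℝ) (hγ : 0 ≤ γ) (hγε : (1 + γ) * (1 + δ) < 1 + δ + ε) :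
    ∃ T₀ : ℕ, ∀ T : ℕ, T₀ ≤ T →
      -- sure bound on all queues while the contacts are regular over super-super time slots
      (∀ T' : ℕ, 0 < T' → ∃ B : ℝ, ∀ pos : N.Path, N.RegularContacts γ T' pos →
        ∀ e, N.IsExecution x T (r * T) η δ pos e → ∀ t, e.AllQueuesLE t B) ∧
      -- Markov mobiles: expected bound, uniform in time, on type-I and type-II queues
      (∃ B : ℝ, ∀ (Ω : Type uΩ) [MeasurableSpace Ω] (P : MeasureTheory.Measure Ω)
        [MeasureTheory.IsProbabilityMeasure P] (X : Ω → N.Path), N.IsMobility P X →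
        ∀ e : Ω → ICN.Execution ι V J,
          (∀ ω, N.IsExecution x T (r * T) η δ (X ω) (e ω)) →
          (∀ t n b, Measurable fun ω => (e ω).qLen t n b) →
          (∀ t n l, Measurable fun ω => (e ω).uLen t n l) →
          (∀ t n b, MeasureTheory.Integrable (fun ω => (e ω).qLen t n b) P ∧
            ∫ ω, (e ω).qLen t n b ∂P ≤ B) ∧
          (∀ t n l, MeasureTheory.Integrable (fun ω => (e ω).uLen t n l) P ∧
            ∫ ω, (e ω).uLen t n l ∂P ≤ B)) ∧
      -- Markov mobiles: exponential tail, over any horizon, of the largest of all queues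
      (∃ C c : ℝ, 0 < C ∧ 0 < c ∧ ∀ (Ω : Type uΩ) [MeasurableSpace Ω]
        (P : MeasureTheory.Measure Ω) [MeasureTheory.IsProbabilityMeasure P] (X : Ω → N.Path),
        N.IsMobility P X → ∀ e : Ω → ICN.Execution ι V J,
          (∀ ω, N.IsExecution x T (r * T) η δ (X ω) (e ω)) →
          ∀ (n : ℕ) (b : ℝ), 0 ≤ b →
            P {ω | ∃ t ≤ n, ¬ (e ω).AllQueuesLE t b} ≤
              ENNReal.ofReal (C * (n + 1) * Real.exp (-c * b))) := by
  obtain ⟨T₁, h₁⟩ := ICN.Run.exists_bound N x hr hη.1 hδ.le hε hγ hx hγε hsup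
  obtain ⟨T₂, hT₂, h₂⟩ := ICN.Run.exists_tail.{uι, uV, uJ, uΩ} N x hr hη.1 hδ.le hε hx hsup
  refine ⟨max T₁ T₂, fun T hT => ?_⟩
  have hT0 : 0 < T := hT₂.trans_le ((le_max_right _ _).trans hT)
  have hrun : ∀ pos e, N.IsExecution x T (r * T) η δ pos e →
      ICN.Run N x T (r * T) η δ pos e := fun pos e he =>
    .of_isExecution hx hη hr.le hδ.le hε.le hsup hT0 he
  obtain ⟨C, c, hC, hc, htail⟩ := h₂ T ((le_max_right _ _).trans hT)
  -- `C / c` is the integral of the uniform tail `C e^{-cZ}` over `Z > 0`.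
  refine ⟨fun T' hT' => ?_, ⟨C / c, ?_⟩, ?_⟩
  · obtain ⟨B, hB⟩ := h₁ T ((le_max_left _ _).trans hT) T' hT'
    exact ⟨B, fun pos hreg e he => hB pos hreg e (hrun pos e he)⟩
  · intro Ω _ P _ X hX e he hq hu
    have ht := htail Ω P X hX e fun ω => hrun _ _ (he ω)
    refine ⟨fun t n b => ICN.integral_le_of_tail (hq t n b)
        (fun ω => (hrun _ _ (he ω)).qLen_nonneg t n b) hC hc fun Z =>
          (MeasureTheory.measureReal_mono ?_ (MeasureTheory.measure_ne_top P _)).trans (ht t Z),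
      fun t n l => ICN.integral_le_of_tail (hu t n l)
        (fun ω => (hrun _ _ (he ω)).uLen_nonneg t n l) hC hc fun Z =>
          (MeasureTheory.measureReal_mono ?_ (MeasureTheory.measure_ne_top P _)).trans (ht t Z)⟩
    · exact fun ω hω hcon => absurd (hcon.1 n b) (not_le.2 hω)
    · exact fun ω hω hcon => absurd (hcon.2 n l) (not_le.2 hω)
  · exact ⟨_, _, by positivity, div_pos hc (by unfold ICN.realSlope; positivity),
      fun Ω _ P _ X hX e he n b _ => ICN.Run.measure_not_allQueuesLE_le hC hc
        (fun ω => hrun _ _ (he ω)) (htail Ω P X hX e fun ω => hrun _ _ (he ω)) n b⟩
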